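/- **Push-Forward Theorem, special case $Z=\mathbb R_+$.** Write $\mathbb R_+=[0,\infty)$. *Index sets.* An index set is a set $F\subset\mathbb C\times\mathbb N_0$ such that $\{(z,p)\in F:\operatorname{Re}z<N\}$ is finite for every $N\in\mathbb R$, and such that $(z,p)\in F$ implies $(z+1,p)\in F$ and $(z,q)\in F$ for all $q\le p$. Put $\inf F=\inf\{\operatorname{Re}z:(z,p)\in F\}$ (with $\inf\emptyset=+\infty$) and $$E\,\overline\cup\,F=E\cup F\cup\{(z,p'+p''+1):(z,p')\in E,\ (z,p'')\in F\}.$$ *Setting.* Let $W$ be a (Hausdorff, second countable) smooth manifold with corners of dimension $n$, all of whose boundary hypersurfaces (closures of the connected components of the set of points of codimension one) are embedded. An index family $\mathcal E$ for $W$ assigns an index set $\mathcal E(G)$ to every boundary hypersurface $G$. A map $f:W\to\mathbb R_+$ is a b-map if near each point $w\in W$ it has the form $f=a\prod_{j\in S}x_j^{\alpha_j}$, where $x_j$, $j\in S$, are the coordinates in which $W$ is locally $\{x_j\ge0,\ j\in S\}$, with $x_j(w)=0$ for $j\in S$, the function $a$ is smooth and non-vanishing near $w$, and $\alpha_j\in\mathbb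 N_0$. For a boundary hypersurface $G$, $e_f(G)$ is the order of vanishing of $f$ at $G$, i.e. the exponent $\alpha_j$ of the coordinate $x_j$ that defines $G$ near a point of $G$. The map $f$ is a fibration over $(0,\infty)$ if for each $x>0$ a neighbourhood of $L=f^{-1}(x)$ can be identified by a diffeomorphism with $U\times L$, where $U\subset(0,\infty)$ is a neighbourhood of $x$ and $L$ is a manifold with corners, in such a way that $f(x',l)=x'$. *Nice functions and b-densities.* In local coordinates as above, a function $u$ on the interior of $W$ is nice near $w$ with index sets $E_j$, $j\in S$, if it is smooth in the interior near $w$ (if $S=\emptyset$ this is the whole condition) and, for every $j\in S$, $$u\sim\sum_{(z,p)\in E_j}a_{z,p}\,x_j^z\log^p x_j\qquad(x_j\to0),$$ where the $a_{z,p}$ are functions of the other variables that are (inductively) nice with index sets $E_i$, $i\in S\setminus\{j\}$, and $\sim$ means: there is an $M$ such that for all $N$ the difference of $u$ and the partial sum over $\operatorname{Re}z\le N$, and all its derivatives formed with $x_i\partial_{x_i}$ ($i\in S$) and $\partial_{x_i}$ ($i\notin S$), are $O\bigl(x_j^N\prod_{i\in S\setminus\{j\}}x_i^{-M}\bigr)$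 near $w$. A b-density $\mu$ on $W$ is a smooth complex density on the interior of $W$; it is nice with index family $\mathcal E$ if near every point $\mu=u\prod_{j\in S}\frac{dx_j}{x_j}\prod_{j\notin S}dx_j$ with $u$ nice with index sets $\mathcal E(G)$. For an index set $F$, a b-density $v(t)\frac{dt}t$ on $\mathbb R_+$ is thus nice with index set $F$ if $v$ is smooth on $(0,\infty)$ and $v(t)\sim\sum_{(z,p)\in F}a_{z,p}t^z\log^pt$ as $t\to0$ with constants $a_{z,p}$, together with all $t\,d/dt$-derivatives. *Index set of the push-forward.* For a face $F$ of $W$ (a non-empty intersection of boundary hypersurfaces) let $$\tilde{\mathcal E}(F)=\overline{\bigcup_{G\supset F,\ e_f(G)>0}}\Bigl\{\bigl(\tfrac{z}{e_f(G)},p\bigr):(z,p)\in\mathcal E(G)\Bigr\}$$ be the (iterated) extended union $\overline\cup$ over all boundary hypersurfaces $G$ that contain $F$ and have $e_f(G)>0$, and let $f_\#\mathcal E=\bigcup_F\tilde{\mathcal E}(F)$, the union over all faces $F$. *Theorem.* Let $f:W\to\mathbb R_+$ be a b-map which is a fibration over $(0,\infty)$, and let $\mathcal E$ be an index family for $W$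 such that $$\inf\mathcal E(G)>0\quad\text{whenever } e_f(G)=0 .$$ If $\mu$ is a compactly supported b-density on $W$, nice with index family $\mathcal E$, then the push-forward measure $f_*\mu$ on $(0,\infty)$, $(f_*\mu)(V)=\mu(f^{-1}(V))$, is well defined (the integrals converge absolutely for Borel sets $V$ contained in a compact subset of $(0,\infty)$), and it is a b-density $v(t)\frac{dt}t$ on $\mathbb R_+$, nice with index set $f_\#\mathcal E$. Moreover, $f_\#\mathcal E$ is an index set if only finitely many boundary hypersurfaces $G$ have $e_f(G)>0$ (in particular if $W$ is compact). If $f_\#\mathcal E$ is not an index set, niceness means that $v$ has an expansion as above with coefficients $a_{z,p}$ that vanish for $(z,p)\notin f_\#\mathcal E$ and of which, for each $N$, only finitely many with $\operatorname{Re}z\le N$ are non-zero. -/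

import Mathlib

open Set Filter MeasureTheory
open scoped Manifold ContDiff Topology

universe u

noncomputable section

namespace PushForward

/-! ### Index sets -/

/-- An index set, including the condition `(z, p) ∈ F → (z + 1, p) ∈ F` that makes
polyhomogeneity independent of coordinates. -/
structure IsIndexSet (F : Set (ℂ × ℕ)) : Prop where
  finite_left : ∀ N : ℝ, {q ∈ F | q.1.re < N}.Finite
  lower : ∀ (z : ℂ) (p q : ℕ), (z, p) ∈ F → q ≤ p → (z, q) ∈ F
  shift : ∀ (z : ℂ) (p : ℕ), (z, p) ∈ F → (z + 1, p) ∈ F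

/-- `inf E = inf {Re z : (z, p) ∈ E}`, equal to `+∞` for empty `E`. -/
def indexInf (E : Set (ℂ × ℕ)) : EReal := ⨅ q ∈ E, ((q.1.re : ℝ) : EReal)

/-- The extended union of two index sets. -/
def extUnion (E F : Set (ℂ × ℕ)) : Set (ℂ × ℕ) :=
  E ∪ F ∪ {q | ∃ p' p'' : ℕ, (q.1, p') ∈ E ∧ (q.1, p'') ∈ F ∧ q.2 = p' + p'' + 1}

/-- The iterated extended union of the index sets `E i`, `i ∈ A`. The two facts
`extUnionFamily_empty` and `extUnionFamily_insert` below say that for finite `A` it is the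
iteration of the binary operation `extUnion`. -/
def extUnionFamily {ι : Type*} (A : Set ι) (E : ι → Set (ℂ × ℕ)) : Set (ℂ × ℕ) :=
  {q | ∃ T : Finset ι, T.Nonempty ∧ (T : Set ι) ⊆ A ∧
    ∃ p : ι → ℕ, (∀ i ∈ T, (q.1, p i) ∈ E i) ∧ q.2 + 1 = ∑ i ∈ T, (p i + 1)}

theorem extUnionFamily_empty {ι : Type*} (E : ι → Set (ℂ × ℕ)) :
    extUnionFamily (∅ : Set ι) E = ∅ := by
  ext q
  simp only [extUnionFamily, mem_ofPred_eq, mem_empty_iff_false, iff_false]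
  rintro ⟨T, ⟨i, hi⟩, hT, -⟩
  exact hT (Finset.mem_coe.2 hi)

theorem extUnionFamily_insert {ι : Type*} (E : ι → Set (ℂ × ℕ)) (A : Set ι) (i : ι)
    (hi : i ∉ A) :
    extUnionFamily (insert i A) E = extUnion (E i) (extUnionFamily A E) := by
  classical
  ext ⟨z, m⟩
  simp only [extUnionFamily, extUnion, mem_ofPred_eq, mem_union]
  constructor
  · rintro ⟨T, hTne, hT, p, hp, hm⟩
    by_cases hiT : i ∈ T
    · have hsub : ((T.erase i : Finset ι) : Set ι) ⊆ A := by
        intro k hk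
        have hk' := Finset.mem_erase.1 (Finset.mem_coe.1 hk)
        exact (hT (Finset.mem_coe.2 hk'.2)).resolve_left hk'.1
      have hsum := Finset.add_sum_erase T (fun k => p k + 1) hiT
      by_cases hne : (T.erase i).Nonempty
      · right
        obtain ⟨k, hk⟩ := hne
        have hpos : p k + 1 ≤ ∑ k ∈ T.erase i, (p k + 1) :=
          Finset.single_le_sum (f := fun k => p k + 1) (fun _ _ => Nat.zero_le _) hk
        refine ⟨p i, ∑ k ∈ T.erase i, (p k + 1) - 1, hp i hiT,
          ⟨T.erase i, ⟨k, hk⟩, hsub, p, fun l hl => hp l (Finset.mem_of_mem_erase hl), ?_⟩, ?_⟩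
        · omega
        · omega
      · left; left
        rw [Finset.not_nonempty_iff_eq_empty] at hne
        rw [hne] at hsum
        simp only [Finset.sum_empty] at hsum
        have : m = p i := by omega
        rw [this]
        exact hp i hiT
    · left; right
      refine ⟨T, hTne, fun k hk => (hT hk).resolve_left ?_, p, hp, hm⟩
      rintro rfl
      exact hiT (Finset.mem_coe.1 hk)
  · rintro ((h | ⟨T, hTne, hT, p, hp, hm⟩) | ⟨p', p'', h, ⟨T, hTne, hT, p, hp, hm⟩, hmm⟩)
    · exact ⟨{i}, by simp, by simp, fun _ => m, by simpa using h, by simp⟩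
    · exact ⟨T, hTne, hT.trans (subset_insert _ _), p, hp, hm⟩
    · have hiT : i ∉ T := fun h => hi (hT (Finset.mem_coe.2 h))
      have hne : ∀ k ∈ T, k ≠ i := fun k hk hki => hiT (hki ▸ hk)
      refine ⟨insert i T, by simp, ?_, fun k => if k = i then p' else p k, ?_, ?_⟩
      · rw [Finset.coe_insert]
        exact insert_subset_insert hT
      · intro k hk
        rcases Finset.mem_insert.1 hk with rfl | hk
        · simpa using h
        · simpa [hne k hk] using hp k hk
      · rw [Finset.sum_insert hiT]
        have : ∑ k ∈ T, ((if k = i then p' else p k) + 1) = ∑ k ∈ T, (p k + 1) :=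
          Finset.sum_congr rfl fun k hk => by simp [hne k hk]
        rw [this]
        simp only [if_true] at hm hmm ⊢
        omega

/-! ### Polyhomogeneous ("nice") functions in coordinates -/

/-- The part near `c` of the region of `ℝⁿ` where the coordinates `x i`, `i ∈ S`, are positive. -/
def cornerBox {n : ℕ} (S : Finset (Fin n)) (c : EuclideanSpace ℝ (Fin n)) (ε : ℝ) :
    Set (EuclideanSpace ℝ (Fin n)) :=
  {x | ∀ i, |x i - c i| < ε ∧ (i ∈ S → 0 < x i)}

/-- The derivative `x i ∂_i` for a boundary coordinate `i ∈ S`, and `∂_i` for `i ∉ S`. -/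
def bDeriv {n : ℕ} (S : Finset (Fin n)) (i : Fin n) (u : EuclideanSpace ℝ (Fin n) → ℂ) :
    EuclideanSpace ℝ (Fin n) → ℂ :=
  fun x => (if i ∈ S then ((x i : ℝ) : ℂ) else 1) * fderiv ℝ u x (EuclideanSpace.single i 1)

/-- Iterated derivatives `bDeriv`. -/
def bDerivs {n : ℕ} (S : Finset (Fin n)) (l : List (Fin n))
    (u : EuclideanSpace ℝ (Fin n) → ℂ) : EuclideanSpace ℝ (Fin n) → ℂ :=
  l.foldr (bDeriv S) u

/-- The partial sum `∑_{Re z ≤ N} a_{z,p}(x) (x j)^z (log (x j))^p`. -/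
def partialExpansion {n : ℕ} (j : Fin n) (a : ℂ × ℕ → EuclideanSpace ℝ (Fin n) → ℂ) (N : ℝ) :
    EuclideanSpace ℝ (Fin n) → ℂ :=
  fun x => ∑ᶠ (q : ℂ × ℕ) (_ : q.1.re ≤ N),
    a q x * ((x j : ℝ) : ℂ) ^ q.1 * ((Real.log (x j) : ℝ) : ℂ) ^ q.2

/-- `u` is nice (polyhomogeneous conormal) near the corner point `c` of
`{x | x i ≥ 0 for i ∈ S}` with index set `𝓔 i` at `{x i = 0}`, `i ∈ S`: it is smooth in the
interior, and for each `j ∈ S` there is an expansion `u ∼ ∑ a_{z,p} (x j)^z (log (x j))^p`, where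
the coefficients do not depend on `x j` and are (inductively) nice in the remaining variables, and
where the remainders and all their derivatives `bDerivs` are `O((x j)^N ∏_{i ≠ j} (x i)^(-M))`
with one `M` for all `N`. -/
def IsNiceLocal {n : ℕ} (𝓔 : Fin n → Set (ℂ × ℕ)) (c : EuclideanSpace ℝ (Fin n)) (ε : ℝ)
    (S : Finset (Fin n)) (u : EuclideanSpace ℝ (Fin n) → ℂ) : Prop :=
  ContDiffOn ℝ ∞ u (cornerBox S c ε) ∧
  ∀ j, ∀ _hj : j ∈ S, ∃ a : ℂ × ℕ → EuclideanSpace ℝ (Fin n) → ℂ,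
    (∀ q ∉ 𝓔 j, a q = 0) ∧
    (∀ q x y, (∀ i, i ≠ j → x i = y i) → a q x = a q y) ∧
    (∀ q, IsNiceLocal 𝓔 c ε (S.erase j) (a q)) ∧
    ∃ M : ℝ, ∀ (N : ℝ) (l : List (Fin n)), ∃ C : ℝ, ∀ x ∈ cornerBox S c ε,
      ‖bDerivs S l (u - partialExpansion j a N) x‖
        ≤ C * x j ^ N * ∏ i ∈ S.erase j, x i ^ (-M)
termination_by S.card
decreasing_by exact Finset.card_erase_lt_of_mem _hj

/-- The function `v` on `(0, ∞)` is nice on `ℝ₊ = [0, ∞)` with index set `F`: it is smooth on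
`(0, ∞)` and `v(t) ∼ ∑_{(z,p) ∈ F} a_{z,p} t^z (log t)^p` as `t → 0`, together with all
derivatives `(t d/dt)^k`. If `F` is an index set, the second condition on `a` follows from the
first; it makes the partial sums meaningful for an arbitrary `F`. -/
def IsNiceHalfLine (F : Set (ℂ × ℕ)) (v : ℝ → ℂ) : Prop :=
  ContDiffOn ℝ ∞ v (Ioi 0) ∧
  ∃ a : ℂ × ℕ → ℂ, (∀ q ∉ F, a q = 0) ∧
    (∀ N : ℝ, {q : ℂ × ℕ | a q ≠ 0 ∧ q.1.re ≤ N}.Finite) ∧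
    ∀ (N : ℝ) (k : ℕ), ∃ C : ℝ, ∀ t ∈ Ioo (0 : ℝ) 1,
      ‖((fun (g : ℝ → ℂ) (s : ℝ) => (s : ℂ) * deriv g s)^[k]
          (fun s : ℝ => v s - ∑ᶠ (q : ℂ × ℕ) (_ : q.1.re ≤ N),
            a q * (s : ℂ) ^ q.1 * ((Real.log s : ℝ) : ℂ) ^ q.2)) t‖ ≤ C * t ^ N

/-! ### Manifolds with corners

A manifold with corners of dimension `n` is a space `W` modelled on `[0, ∞)ⁿ`; this is the same
as being locally modelled on the spaces `[0, ∞)^k × ℝ^(n-k)`. -/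

section Manifold

variable {n : ℕ} {W : Type u} [TopologicalSpace W] [ChartedSpace (EuclideanQuadrant n) W]

/-- The coordinates of `y` in the chart around `w`. -/
def coord (w y : W) : EuclideanSpace ℝ (Fin n) :=
  extChartAt (modelWithCornersEuclideanQuadrant n) w y

/-- The indices of the coordinates at `w` that vanish at `w`: the boundary coordinates. -/
def boundaryIndices (n : ℕ) {W : Type u} [TopologicalSpace W]
    [ChartedSpace (EuclideanQuadrant n) W] (w : W) : Finset (Fin n) :=
  Finset.univ.filter fun j => coord (n := n) w w j = 0

/-- A boundary hypersurface: the closure of a connected component of the set of points of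
codimension one. -/
def IsBhs (n : ℕ) {W : Type u} [TopologicalSpace W]
    [ChartedSpace (EuclideanQuadrant n) W] (G : Set W) : Prop :=
  ∃ w : W, (boundaryIndices n w).card = 1 ∧
    G = closure (connectedComponentIn {v : W | (boundaryIndices n v).card = 1} w)

/-- Near its point `w`, the set `G` is the zero set of the `j`-th coordinate. -/
def IsLocalFace (G : Set W) (w : W) (j : Fin n) : Prop :=
  w ∈ G ∧ ∀ᶠ y in 𝓝 w, (y ∈ G ↔ coord w y j = 0)

/-- All boundary hypersurfaces are embedded. -/
def EmbeddedBoundary (n : ℕ) (W : Type u) [TopologicalSpace W]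
    [ChartedSpace (EuclideanQuadrant n) W] : Prop :=
  ∀ G : Set W, IsBhs n G → ∀ w ∈ G, ∃ j : Fin n, IsLocalFace G w j

/-- A face: a non-empty intersection of boundary hypersurfaces. -/
def IsFace (n : ℕ) {W : Type u} [TopologicalSpace W]
    [ChartedSpace (EuclideanQuadrant n) W] (F : Set W) : Prop :=
  F.Nonempty ∧ ∃ 𝒢 : Set (Set W), 𝒢.Nonempty ∧ (∀ G ∈ 𝒢, IsBhs n G) ∧ F = ⋂₀ 𝒢

/-- Near `w` one has `f = a · ∏ (x j)^(α j)`, the product running over the boundary coordinates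
at `w`, with `a` smooth near `w` and non-vanishing at `w`. -/
def IsProductForm (f : W → ℝ) (w : W) (α : Fin n → ℕ) : Prop :=
  ∃ a : W → ℝ,
    (∃ U ∈ 𝓝 w, ContMDiffOn (modelWithCornersEuclideanQuadrant n) 𝓘(ℝ, ℝ) ∞ a U) ∧
    a w ≠ 0 ∧
    ∀ᶠ y in 𝓝 w, f y = a y * ∏ j ∈ boundaryIndices n w, coord w y j ^ α j

/-- `f : W → ℝ₊` is a (interior) b-map. At a point with `f w > 0` the exponents in
`IsProductForm` are zero, and the condition just says that `f` is smooth near `w`. -/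
def IsBMap (n : ℕ) {W : Type u} [TopologicalSpace W]
    [ChartedSpace (EuclideanQuadrant n) W] (f : W → ℝ) : Prop :=
  (∀ w, 0 ≤ f w) ∧ ∀ w, ∃ α : Fin n → ℕ, IsProductForm f w α

/-- The order of vanishing `e_f(G)` of the b-map `f` at the boundary hypersurface `G`: the
exponent, in the product form of `f` at a point of `G`, of the coordinate that defines `G`. (All
points of `G` give the same exponent.) -/
def vanishingOrder (n : ℕ) {W : Type u} [TopologicalSpace W]
    [ChartedSpace (EuclideanQuadrant n) W] (f : W → ℝ) (G : Set W) : ℕ :=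
  sInf {k | ∃ (w : W) (α : Fin n → ℕ) (j : Fin n),
    IsProductForm f w α ∧ IsLocalFace G w j ∧ k = α j}

/-- `f` is a fibration over `(0, ∞)`, with manifolds with corners as fibres: for each `x > 0`, a
neighbourhood `Φ.source` of `f ⁻¹ {x}` is diffeomorphic to `U × L`, where `U` is a neighbourhood
of `x` and `L` (necessarily a copy of `f ⁻¹ {x}`) is a manifold with corners, in such a way that
`f` becomes the projection to `U`. -/
def IsFibrationOverPos (n : ℕ) {W : Type u} [TopologicalSpace W]
    [ChartedSpace (EuclideanQuadrant n) W] (f : W → ℝ) : Prop :=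
  ∀ x : ℝ, 0 < x → ∃ (m : ℕ) (L : Type u) (_ : TopologicalSpace L)
    (_ : ChartedSpace (EuclideanQuadrant m) L)
    (_ : IsManifold (modelWithCornersEuclideanQuadrant m) ∞ L)
    (U : Set ℝ) (Φ : OpenPartialHomeomorph W (ℝ × L)),
    IsOpen U ∧ x ∈ U ∧ U ⊆ Ioi 0 ∧ f ⁻¹' {x} ⊆ Φ.source ∧ Φ.target = U ×ˢ (univ : Set L) ∧
    ContMDiffOn (modelWithCornersEuclideanQuadrant n)
      (𝓘(ℝ, ℝ).prod (modelWithCornersEuclideanQuadrant m)) ∞ Φ Φ.source ∧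
    ContMDiffOn (𝓘(ℝ, ℝ).prod (modelWithCornersEuclideanQuadrant m))
      (modelWithCornersEuclideanQuadrant n) ∞ Φ.symm Φ.target ∧
    ∀ w ∈ Φ.source, (Φ w).1 = f w

/-- The index set `f_# E`: the union over all faces `F` of the extended unions, over the boundary
hypersurfaces `G ⊇ F` with `e_f(G) > 0`, of the sets `{(z / e_f(G), p) : (z, p) ∈ E(G)}`. -/
def pushIndexSet (n : ℕ) {W : Type u} [TopologicalSpace W]
    [ChartedSpace (EuclideanQuadrant n) W] (f : W → ℝ) (E : Set W → Set (ℂ × ℕ)) :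
    Set (ℂ × ℕ) :=
  ⋃ F ∈ {F : Set W | IsFace n F},
    extUnionFamily {G : Set W | IsBhs n G ∧ F ⊆ G ∧ 0 < vanishingOrder n f G}
      fun G => (fun q : ℂ × ℕ => (q.1 / (vanishingOrder n f G : ℂ), q.2)) '' E G

/-! ### Densities -/

/-- A complex measure which need not have finite total variation, given in the form
`val · ref` with a positive measure `ref`. -/
structure CDensity (W : Type u) [MeasurableSpace W] where
  ref : Measure W
  val : W → ℂ

/-- The index set of the family `E` at the boundary hypersurface which near `w` is the zero set
of the `j`-th coordinate. (There is exactly one if `j ∈ boundaryIndices n w`.) -/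
def localIndexSet (E : Set W → Set (ℂ × ℕ)) (w : W) (j : Fin n) : Set (ℂ × ℕ) :=
  ⋃ G ∈ {G : Set W | IsBhs n G ∧ IsLocalFace G w j}, E G

/-- `μ` is a b-density on the manifold with corners `W` (that is, a smooth density on the
interior of `W`), nice with index family `E`: near each point `w`, in the coordinates around `w`,
`μ = u(x) ∏_{j ∈ S} dx_j / x_j ∏_{j ∉ S} dx_j` with a nice function `u`, where `S` is the set of
boundary coordinates at `w`. -/
def IsNiceBDensity (n : ℕ) {W : Type u} [TopologicalSpace W]
    [ChartedSpace (EuclideanQuadrant n) W] [MeasurableSpace W]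
    (E : Set W → Set (ℂ × ℕ)) (μ : CDensity W) : Prop :=
  ∀ w : W, ∃ (ε : ℝ) (u : EuclideanSpace ℝ (Fin n) → ℂ), 0 < ε ∧
    cornerBox (boundaryIndices n w) (coord w w) ε ⊆
      (extChartAt (modelWithCornersEuclideanQuadrant n) w).target ∧
    IsNiceLocal (localIndexSet E w) (coord w w) ε (boundaryIndices n w) u ∧
    ∀ K ⊆ cornerBox (boundaryIndices n w) (coord w w) ε, IsCompact K →
      ∀ B ⊆ K, MeasurableSet B →
        IntegrableOn μ.val
          ((extChartAt (modelWithCornersEuclideanQuadrant n) w).symm '' B) μ.ref ∧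
        ∫ y in (extChartAt (modelWithCornersEuclideanQuadrant n) w).symm '' B, μ.val y ∂μ.ref
          = ∫ x in B, u x * ∏ j ∈ boundaryIndices n w, ((x j : ℝ) : ℂ)⁻¹

/-- `μ`, a density on the interior of `W`, vanishes outside a compact subset of `W`. -/
def HasCompactSupp (n : ℕ) {W : Type u} [TopologicalSpace W]
    [ChartedSpace (EuclideanQuadrant n) W] [MeasurableSpace W] (μ : CDensity W) : Prop :=
  ∃ K : Set W, IsCompact K ∧
    ∀ᵐ y ∂(μ.ref.restrict ((modelWithCornersEuclideanQuadrant n).interior W)),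
      y ∉ K → μ.val y = 0

/-- The push-forward `f_* μ` exists as a measure on `(0, ∞)` and equals the b-density
`v(t) dt / t`: for all Borel subsets `V` of compact subsets of `(0, ∞)`, the measure
`μ (f ⁻¹ V)` is defined (by an absolutely convergent integral) and equal to `∫_V v(t) dt / t`. -/
def PushForwardEq (n : ℕ) {W : Type u} [TopologicalSpace W]
    [ChartedSpace (EuclideanQuadrant n) W] [MeasurableSpace W]
    (f : W → ℝ) (μ : CDensity W) (v : ℝ → ℂ) : Prop :=
  ∀ K ⊆ Ioi (0 : ℝ), IsCompact K → ∀ V ⊆ K, MeasurableSet V →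
    IntegrableOn μ.val
      (f ⁻¹' V ∩ (modelWithCornersEuclideanQuadrant n).interior W) μ.ref ∧
    ∫ y in f ⁻¹' V ∩ (modelWithCornersEuclideanQuadrant n).interior W, μ.val y ∂μ.ref
      = ∫ t in V, v t * ((t : ℝ) : ℂ)⁻¹

end Manifold

end PushForward

end

noncomputable section

namespace PushForward

/-! ### Derivatives tangent to the boundary -/

section Calculus

variable {n : ℕ} {S : Finset (Fin n)} {B : Set (EuclideanSpace ℝ (Fin n))}
  {u v : EuclideanSpace ℝ (Fin n) → ℂ} {w w' : EuclideanSpace ℝ (Fin n) → ℝ}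

/-! Asymptotic expansions are detected by differential operators, and these operators are
transported from `W` to the half-line by integration by parts; no fibre integral is ever computed.

Let D_j be x_j ∂_j for a boundary coordinate and ∂_j otherwise. If u has the exponents z, with
multiplicities ρ_j(z), at x_j = 0, then applying D_j - z often enough for all z with Re z ≤ m_j
leaves a function that is O(∏ x_j^(m_j)). This property, `IsPhg`, replaces the inductive definition
of niceness (`IsNiceLocal.bound`) and survives multiplication by functions that are smooth up to the
boundary (`IsPhg.smooth_mul`). Conversely, on the half-line a function whose decay improves under
products of operators t d/dt - ζ has an expansion with these exponents ζ (`hasExpansion_of_tOps`).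

Near a point f = a ∏ x_j^(α_j), so D_i f = κ_i f with κ_i smooth up to the boundary. Where κ_i ≠ 0,
the field κ_i⁻¹ D_i sends Ψ(f) to (t Ψ')(f). Integrating by parts against ∏ dx_j/x_j, one finds that
the push-forward of g is v dt/t, where v is the distribution function of the push-forward of
D_i(κ_i⁻¹ g), and that t d/dt acts on v as g ↦ D_i(κ_i⁻¹ g) acts on g (`IsTame.isWeakPush_cumul`,
`IsPush.hasDerivAt`). So v is smooth, and bounded together with all its derivatives t d/dt; a factor
f^N in g gives a factor t^N in v. A direction with κ_i ≠ 0 exists: if some α_j > 0, take i = j;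
otherwise f > 0 at the point, and a fibration has no critical points along the faces
(`IsFibrationOverPos.exists_deriv_ne_zero`).

If α_j > 0, then α_j κ_j⁻¹ = 1 + O(x_j). Hence t d/dt - z/α_j acts on g, up to the factor α_j, as
D_j - z plus a term of the form D_j(b x_j g), and removes one root z at x_j = 0
(`IsProductPhase.exists_tOps_cumul`). Faces with α_j = 0 carry only exponents with positive real
part, which never obstruct integrability. To remove all roots, t d/dt - ζ is needed ∑_j ρ_j(α_j ζ)
times, so multiplicities add up over the hypersurfaces through the point; this is the extended union
(`subset_pushIndexSet`). A partition of unity globalises the result. -/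

/-- The coefficient of `∂_i` in `bDeriv S i`. -/
def bCoef (S : Finset (Fin n)) (i : Fin n) (x : EuclideanSpace ℝ (Fin n)) : ℂ :=
  if i ∈ S then ((x i : ℝ) : ℂ) else 1

theorem bDeriv_apply (i : Fin n) (x : EuclideanSpace ℝ (Fin n)) :
    bDeriv S i u x = bCoef S i x * fderiv ℝ u x (EuclideanSpace.single i 1) := rfl

theorem contDiff_coord (i : Fin n) :
    ContDiff ℝ ∞ (fun x : EuclideanSpace ℝ (Fin n) => x i) :=
  (EuclideanSpace.proj (𝕜 := ℝ) i).contDiff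

theorem contDiff_coordC (i : Fin n) :
    ContDiff ℝ ∞ (fun x : EuclideanSpace ℝ (Fin n) => ((x i : ℝ) : ℂ)) :=
  Complex.ofRealCLM.contDiff.comp (contDiff_coord i)

theorem hasFDerivAt_coord (i : Fin n) (x : EuclideanSpace ℝ (Fin n)) :
    HasFDerivAt (fun x : EuclideanSpace ℝ (Fin n) => x i) (EuclideanSpace.proj (𝕜 := ℝ) i) x :=
  (EuclideanSpace.proj (𝕜 := ℝ) i).hasFDerivAt

theorem contDiff_bCoef (i : Fin n) : ContDiff ℝ ∞ (bCoef S i) := by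
  unfold bCoef
  split_ifs
  · exact contDiff_coordC i
  · exact contDiff_const

theorem contDiffOn_pderiv (hB : IsOpen B) (hu : ContDiffOn ℝ ∞ u B) (i : Fin n) :
    ContDiffOn ℝ ∞ (fun x => fderiv ℝ u x (EuclideanSpace.single i 1)) B :=
  (hu.fderiv_of_isOpen hB (m := ∞) (by simp)).clm_apply contDiffOn_const

theorem contDiffOn_bDeriv (hB : IsOpen B) (hu : ContDiffOn ℝ ∞ u B) (i : Fin n) :
    ContDiffOn ℝ ∞ (bDeriv S i u) B :=
  (contDiff_bCoef i).contDiffOn.mul (contDiffOn_pderiv hB hu i)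

theorem ContDiffOn.differentiableAt_of_isOpen {F : Type*} [NormedAddCommGroup F] [NormedSpace ℝ F]
    {u : EuclideanSpace ℝ (Fin n) → F}
    (hu : ContDiffOn ℝ ∞ u B) (hB : IsOpen B) {x} (hx : x ∈ B) : DifferentiableAt ℝ u x :=
  (hu.contDiffAt (hB.mem_nhds hx)).differentiableAt (by simp)

theorem bDeriv_congr (hB : IsOpen B) (h : EqOn u v B) (i : Fin n) :
    EqOn (bDeriv S i u) (bDeriv S i v) B := by
  intro x hx
  have : u =ᶠ[𝓝 x] v := by filter_upwards [hB.mem_nhds hx] with y hy using h hy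
  simp only [bDeriv_apply, this.fderiv_eq]

theorem bDeriv_add (hB : IsOpen B) (hu : ContDiffOn ℝ ∞ u B) (hv : ContDiffOn ℝ ∞ v B)
    (i : Fin n) :
    EqOn (bDeriv S i fun x => u x + v x) (fun x => bDeriv S i u x + bDeriv S i v x) B := by
  intro x hx
  have := fderiv_fun_add (ContDiffOn.differentiableAt_of_isOpen hu hB hx)
    (ContDiffOn.differentiableAt_of_isOpen hv hB hx)
  simp only [bDeriv_apply, this, add_apply, mul_add]

theorem bDeriv_const_mul (hB : IsOpen B) (hu : ContDiffOn ℝ ∞ u B) (c : ℂ)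
    (i : Fin n) :
    EqOn (bDeriv S i fun x => c * u x) (fun x => c * bDeriv S i u x) B := by
  intro x hx
  have := fderiv_const_mul (ContDiffOn.differentiableAt_of_isOpen hu hB hx) c
  simp only [bDeriv_apply, this, smul_apply, smul_eq_mul]
  ring

theorem bDeriv_mul (hB : IsOpen B) (hu : ContDiffOn ℝ ∞ u B) (hv : ContDiffOn ℝ ∞ v B)
    (i : Fin n) :
    EqOn (bDeriv S i fun x => u x * v x)
      (fun x => bDeriv S i u x * v x + u x * bDeriv S i v x) B := by
  intro x hx
  have := fderiv_fun_mul (ContDiffOn.differentiableAt_of_isOpen hu hB hx)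
    (ContDiffOn.differentiableAt_of_isOpen hv hB hx)
  simp only [bDeriv_apply, this, add_apply, smul_apply, smul_eq_mul]
  ring

/-- For i ≠ k the coefficient of D_k does not depend on x_i, so both sides reduce to the symmetric
second derivative. -/
theorem bDeriv_comm (hB : IsOpen B) (hu : ContDiffOn ℝ ∞ u B) (i k : Fin n) :
    EqOn (bDeriv S i (bDeriv S k u)) (bDeriv S k (bDeriv S i u)) B := by
  rcases eq_or_ne i k with rfl | hik
  · exact fun _ _ => rfl
  intro x hx
  have key : ∀ i k : Fin n, i ≠ k → bDeriv S i (bDeriv S k u) x = bCoef S i x * bCoef S k x *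
      fderiv ℝ (fderiv ℝ u) x (EuclideanSpace.single i 1) (EuclideanSpace.single k 1) := by
    intro i k hik
    have hc : fderiv ℝ (bCoef S k) x (EuclideanSpace.single i 1) = 0 := by
      by_cases hk : k ∈ S
      · have h1 : bCoef S k = fun y : EuclideanSpace ℝ (Fin n) => ((y k : ℝ) : ℂ) := by
          ext y; simp [bCoef, hk]
        have h2 : HasFDerivAt (fun y : EuclideanSpace ℝ (Fin n) => ((y k : ℝ) : ℂ))
            (Complex.ofRealCLM.comp (EuclideanSpace.proj (𝕜 := ℝ) k)) x :=
          Complex.ofRealCLM.hasFDerivAt.comp x (hasFDerivAt_coord k x)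
        rw [h1, h2.fderiv]
        simp [hik.symm]
      · have h1 : bCoef S k = fun _ : EuclideanSpace ℝ (Fin n) => (1 : ℂ) := by
          ext y; simp [bCoef, hk]
        rw [h1]; simp
    have hd : DifferentiableAt ℝ (fderiv ℝ u) x :=
      ContDiffOn.differentiableAt_of_isOpen (hu.fderiv_of_isOpen hB (m := ∞) (by simp)) hB hx
    have h3 : bDeriv S k u = fun y => bCoef S k y * fderiv ℝ u y (EuclideanSpace.single k 1) := rfl
    have h4 := fderiv_fun_mul ((contDiff_bCoef (S := S) k).contDiffAt.differentiableAt (by simp))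
      (ContDiffOn.differentiableAt_of_isOpen (contDiffOn_pderiv hB hu k) hB hx)
    have h5 : fderiv ℝ (fun y => fderiv ℝ u y (EuclideanSpace.single k 1)) x =
        (fderiv ℝ (fderiv ℝ u) x).flip (EuclideanSpace.single k 1) := by
      rw [fderiv_clm_apply hd (by fun_prop)]
      simp
    rw [bDeriv_apply, h3, h4, h5]
    simp only [add_apply, smul_apply, smul_eq_mul, hc, ContinuousLinearMap.flip_apply]
    ring
  rw [key i k hik, key k i hik.symm]
  have hs : IsSymmSndFDerivAt ℝ u x :=
    (hu.contDiffAt (hB.mem_nhds hx)).isSymmSndFDerivAt (by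
      rw [minSmoothness_of_isRCLikeNormedField]
      exact WithTop.coe_le_coe.2 (le_top : (2 : ℕ∞) ≤ ⊤))
  rw [hs.eq]
  ring

theorem bDeriv_comp_coord {h : ℝ → ℂ} {j : Fin n} (i : Fin n) {x : EuclideanSpace ℝ (Fin n)}
    (hh : DifferentiableAt ℝ h (x j)) :
    bDeriv S i (fun y => h (y j)) x = if i = j then bCoef S i x * deriv h (x j) else 0 := by
  have h1 : HasFDerivAt (fun y : EuclideanSpace ℝ (Fin n) => h (y j))
      (deriv h (x j) • (EuclideanSpace.proj (𝕜 := ℝ) j).smulRight (1 : ℂ)) x := by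
    have h1 := HasFDerivAt.comp (f := fun y : EuclideanSpace ℝ (Fin n) => y j) x
      hh.hasDerivAt.hasFDerivAt (hasFDerivAt_coord j x)
    refine h1.congr_fderiv ?_
    ext y
    simp [mul_comm]
  rw [bDeriv_apply, h1.fderiv]
  split_ifs with hij
  · subst hij; simp
  · simp [Ne.symm hij]

/-! ### Iterated derivatives and symbols -/

theorem bDerivs_append (l l' : List (Fin n)) :
    bDerivs S (l ++ l') u = bDerivs S l (bDerivs S l' u) := by
  simp [bDerivs]

theorem bDerivs_concat (l : List (Fin n)) (i : Fin n) :
    bDerivs S (l ++ [i]) u = bDerivs S l (bDeriv S i u) := by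
  simp [bDerivs]

theorem contDiffOn_bDerivs (hB : IsOpen B) (hu : ContDiffOn ℝ ∞ u B) (l : List (Fin n)) :
    ContDiffOn ℝ ∞ (bDerivs S l u) B := by
  induction l with
  | nil => exact hu
  | cons i l ih => exact contDiffOn_bDeriv hB ih i

theorem bDerivs_congr (hB : IsOpen B) (h : EqOn u v B) (l : List (Fin n)) :
    EqOn (bDerivs S l u) (bDerivs S l v) B := by
  induction l with
  | nil => exact h
  | cons i l ih => exact bDeriv_congr hB ih i

theorem bDerivs_add (hB : IsOpen B) (hu : ContDiffOn ℝ ∞ u B) (hv : ContDiffOn ℝ ∞ v B)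
    (l : List (Fin n)) :
    EqOn (bDerivs S l fun x => u x + v x) (fun x => bDerivs S l u x + bDerivs S l v x) B := by
  induction l with
  | nil => exact fun _ _ => rfl
  | cons i l ih =>
    exact (bDeriv_congr hB ih i).trans
      (bDeriv_add hB (contDiffOn_bDerivs hB hu l) (contDiffOn_bDerivs hB hv l) i)

theorem bDerivs_const_mul (hB : IsOpen B) (hu : ContDiffOn ℝ ∞ u B) (c : ℂ)
    (l : List (Fin n)) :
    EqOn (bDerivs S l fun x => c * u x) (fun x => c * bDerivs S l u x) B := by
  induction l with
  | nil => exact fun _ _ => rfl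
  | cons i l ih =>
    exact (bDeriv_congr hB ih i).trans
      (bDeriv_const_mul hB (contDiffOn_bDerivs hB hu l) c i)

/-- `u` is smooth on `B`, and all its derivatives `bDerivs` are `O(w)` on `B`. -/
structure IsSymbol (S : Finset (Fin n)) (B : Set (EuclideanSpace ℝ (Fin n)))
    (w : EuclideanSpace ℝ (Fin n) → ℝ) (u : EuclideanSpace ℝ (Fin n) → ℂ) : Prop where
  contDiffOn : ContDiffOn ℝ ∞ u B
  bound : ∀ l : List (Fin n), ∃ C : ℝ, ∀ x ∈ B, ‖bDerivs S l u x‖ ≤ C * w x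

theorem IsSymbol.congr (hB : IsOpen B) (hu : IsSymbol S B w u) (h : EqOn u v B) :
    IsSymbol S B w v := by
  refine ⟨hu.contDiffOn.congr fun x hx => (h hx).symm, fun l => ?_⟩
  obtain ⟨C, hC⟩ := hu.bound l
  exact ⟨C, fun x hx => by rw [← bDerivs_congr hB h l hx]; exact hC x hx⟩

theorem IsSymbol.map_bDeriv (hB : IsOpen B) (hu : IsSymbol S B w u) (i : Fin n) :
    IsSymbol S B w (bDeriv S i u) := by
  refine ⟨contDiffOn_bDeriv hB hu.contDiffOn i, fun l => ?_⟩
  obtain ⟨C, hC⟩ := hu.bound (l ++ [i])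
  rw [bDerivs_append] at hC
  exact ⟨C, hC⟩

theorem IsSymbol.add (hB : IsOpen B) (hu : IsSymbol S B w u) (hv : IsSymbol S B w v) :
    IsSymbol S B w fun x => u x + v x := by
  refine ⟨hu.contDiffOn.add hv.contDiffOn, fun l => ?_⟩
  obtain ⟨C, hC⟩ := hu.bound l
  obtain ⟨C', hC'⟩ := hv.bound l
  refine ⟨C + C', fun x hx => ?_⟩
  rw [bDerivs_add hB hu.contDiffOn hv.contDiffOn l hx, add_mul]
  exact (norm_add_le _ _).trans (add_le_add (hC x hx) (hC' x hx))

theorem IsSymbol.const_mul (hB : IsOpen B) (hu : IsSymbol S B w u) (c : ℂ) :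
    IsSymbol S B w fun x => c * u x := by
  refine ⟨contDiffOn_const.mul hu.contDiffOn, fun l => ?_⟩
  obtain ⟨C, hC⟩ := hu.bound l
  refine ⟨‖c‖ * C, fun x hx => ?_⟩
  rw [bDerivs_const_mul hB hu.contDiffOn c l hx, norm_mul, mul_assoc]
  exact mul_le_mul_of_nonneg_left (hC x hx) (norm_nonneg _)

theorem IsSymbol.sub (hB : IsOpen B) (hu : IsSymbol S B w u) (hv : IsSymbol S B w v) :
    IsSymbol S B w fun x => u x - v x :=
  (hu.add hB (hv.const_mul hB (-1))).congr hB fun x _ => by ring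

theorem IsSymbol.zero (hB : IsOpen B) :
    IsSymbol S B w fun _ => 0 := by
  refine ⟨contDiffOn_const, fun l => ⟨0, fun x hx => ?_⟩⟩
  have := bDerivs_const_mul (S := S) hB (u := fun _ => 0) (contDiffOn_const) 0 l hx
  simp only [mul_zero, zero_mul] at this
  simp [this]

theorem IsSymbol.mono (hu : IsSymbol S B w u) {C : ℝ}
    (hw : ∀ x ∈ B, 0 ≤ w x) (h : ∀ x ∈ B, w x ≤ C * w' x) : IsSymbol S B w' u := by
  refine ⟨hu.contDiffOn, fun l => ?_⟩
  obtain ⟨D, hD⟩ := hu.bound l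
  refine ⟨|D| * C, fun x hx => ?_⟩
  calc _ ≤ D * w x := hD x hx
    _ ≤ |D| * w x := mul_le_mul_of_nonneg_right (le_abs_self D) (hw x hx)
    _ ≤ |D| * (C * w' x) := mul_le_mul_of_nonneg_left (h x hx) (abs_nonneg _)
    _ = _ := by ring

theorem IsSymbol.mul (hB : IsOpen B) (hu : IsSymbol S B w u) (hv : IsSymbol S B w' v) :
    IsSymbol S B (fun x => w x * w' x) fun x => u x * v x := by
  refine ⟨hu.contDiffOn.mul hv.contDiffOn, fun l => ?_⟩
  -- The last entry of a list acts first. Peeling it off, the Leibniz rule leaves products of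
  -- symbols of the same weights.
  induction l using List.reverseRecOn generalizing u v with
  | nil =>
    obtain ⟨C, hC⟩ := hu.bound []
    obtain ⟨D, hD⟩ := hv.bound []
    refine ⟨C * D, fun x hx => ?_⟩
    have h1 : ‖u x‖ ≤ C * w x := hC x hx
    have h2 : ‖v x‖ ≤ D * w' x := hD x hx
    calc ‖u x * v x‖ = ‖u x‖ * ‖v x‖ := norm_mul _ _
      _ ≤ (C * w x) * (D * w' x) :=
        mul_le_mul h1 h2 (norm_nonneg _) ((norm_nonneg _).trans h1)
      _ = _ := by ring
  | append_singleton l i ih =>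
    obtain ⟨C, hC⟩ := ih (hu.map_bDeriv hB i) hv
    obtain ⟨D, hD⟩ := ih hu (hv.map_bDeriv hB i)
    refine ⟨C + D, fun x hx => ?_⟩
    have h1 := contDiffOn_bDeriv (S := S) hB hu.contDiffOn i
    have h2 := contDiffOn_bDeriv (S := S) hB hv.contDiffOn i
    rw [bDerivs_concat, bDerivs_congr hB (bDeriv_mul hB hu.contDiffOn hv.contDiffOn i) l hx,
      bDerivs_add hB (h1.mul hv.contDiffOn) (hu.contDiffOn.mul h2) l hx, add_mul]
    exact (norm_add_le _ _).trans (add_le_add (hC x hx) (hD x hx))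

/-- Functions on `B` all of whose partial derivatives are bounded. -/
abbrev IsSmoothBdd (B : Set (EuclideanSpace ℝ (Fin n))) (u : EuclideanSpace ℝ (Fin n) → ℂ) : Prop :=
  IsSymbol ∅ B (fun _ => 1) u

theorem IsSmoothBdd.mul (hB : IsOpen B) (hu : IsSmoothBdd B u) (hv : IsSmoothBdd B v) :
    IsSmoothBdd B fun x => u x * v x := by
  have := IsSymbol.mul hB hu hv
  simpa using this

theorem bDeriv_eq_mul (i : Fin n) : bDeriv S i u = fun x => bCoef S i x * bDeriv ∅ i u x := by
  ext x
  simp [bDeriv_apply, bCoef]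

theorem isSmoothBdd_const (hB : IsOpen B) (c : ℂ) : IsSmoothBdd B fun _ => c := by
  refine ⟨contDiffOn_const, fun l => ?_⟩
  induction l using List.reverseRecOn with
  | nil => exact ⟨‖c‖, fun x _ => by simp [bDerivs]⟩
  | append_singleton l i _ =>
    rw [bDerivs_append]
    have : bDerivs ∅ [i] (fun _ : EuclideanSpace ℝ (Fin n) => c) = fun _ => 0 := by
      ext x; simp [bDerivs, bDeriv]
    rw [this]
    exact (IsSymbol.zero (w := fun _ => 1) hB).bound l

theorem isSmoothBdd_coord (hB : IsOpen B) {R : ℝ} (hR : ∀ x ∈ B, ∀ i, |x i| ≤ R) (j : Fin n) :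
    IsSmoothBdd B fun x => ((x j : ℝ) : ℂ) := by
  refine ⟨(contDiff_coordC j).contDiffOn, fun l => ?_⟩
  induction l using List.reverseRecOn with
  | nil =>
    refine ⟨R, fun x hx => ?_⟩
    simpa [bDerivs] using hR x hx j
  | append_singleton l i _ =>
    rw [bDerivs_append]
    have : bDerivs ∅ [i] (fun x : EuclideanSpace ℝ (Fin n) => ((x j : ℝ) : ℂ)) =
        fun _ => if i = j then 1 else 0 := by
      ext x
      have := bDeriv_comp_coord (S := ∅) (h := fun t : ℝ => (t : ℂ)) (j := j) i (x := x)
        Complex.ofRealCLM.differentiableAt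
      have hd : deriv (fun t : ℝ => (t : ℂ)) (x j) = 1 :=
        (Complex.ofRealCLM.hasDerivAt (x := x j)).deriv.trans (by simp)
      rw [hd] at this
      simpa [bDerivs, bCoef] using this
    rw [this]
    exact (isSmoothBdd_const hB _).bound l

theorem isSmoothBdd_bCoef (hB : IsOpen B) {R : ℝ} (hR : ∀ x ∈ B, ∀ i, |x i| ≤ R) (i : Fin n) :
    IsSmoothBdd B (bCoef S i) := by
  unfold bCoef
  split_ifs
  · exact isSmoothBdd_coord hB hR i
  · exact isSmoothBdd_const hB 1

theorem IsSmoothBdd.map_bDeriv (hB : IsOpen B) {R : ℝ} (hR : ∀ x ∈ B, ∀ i, |x i| ≤ R)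
    (hu : IsSmoothBdd B u) (i : Fin n) : IsSmoothBdd B (bDeriv S i u) := by
  rw [bDeriv_eq_mul]
  exact (isSmoothBdd_bCoef hB hR i).mul hB (IsSymbol.map_bDeriv hB hu i)

/-- On a bounded set the coefficient of D_i is smooth with bounded derivatives, so D_i preserves
this class. -/
theorem IsSmoothBdd.isSymbol (hB : IsOpen B) {R : ℝ} (hR : ∀ x ∈ B, ∀ i, |x i| ≤ R)
    (hu : IsSmoothBdd B u) : IsSymbol S B (fun _ => 1) u := by
  refine ⟨hu.contDiffOn, fun l => ?_⟩
  induction l using List.reverseRecOn generalizing u with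
  | nil => exact hu.bound []
  | append_singleton l i ih =>
    rw [bDerivs_append]
    exact ih (IsSmoothBdd.map_bDeriv hB hR hu i)

theorem IsSymbol.smooth_mul (hB : IsOpen B) {R : ℝ} (hR : ∀ x ∈ B, ∀ i, |x i| ≤ R)
    (hu : IsSmoothBdd B u) (hv : IsSymbol S B w v) : IsSymbol S B w fun x => u x * v x := by
  simpa using (hu.isSymbol (S := S) hB hR).mul hB hv

/-- Functions satisfying `D_i h = κ_i h` with smooth `κ_i` are symbols of the size of `h`. -/
theorem isSymbol_of_logDeriv (hB : IsOpen B) {R : ℝ} (hR : ∀ x ∈ B, ∀ i, |x i| ≤ R)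
    {κ : Fin n → EuclideanSpace ℝ (Fin n) → ℂ} (hκ : ∀ i, IsSmoothBdd B (κ i))
    (hu : ContDiffOn ℝ ∞ u B) (h : ∀ i, EqOn (bDeriv S i u) (fun x => κ i x * u x) B) :
    IsSymbol S B (fun x => ‖u x‖) u := by
  refine ⟨hu, fun l => ?_⟩
  -- The factor φ makes the induction close: D_i(φ u) = (D_i φ + φ κ_i) u has the same form.
  have key : ∀ φ, IsSmoothBdd B φ →
      ∃ C : ℝ, ∀ x ∈ B, ‖bDerivs S l (fun x => φ x * u x) x‖ ≤ C * ‖u x‖ := by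
    induction l using List.reverseRecOn with
    | nil =>
      intro φ hφ
      obtain ⟨C, hC⟩ := hφ.bound []
      refine ⟨C, fun x hx => ?_⟩
      have := hC x hx
      simp only [bDerivs, List.foldr_nil, mul_one, norm_mul] at this ⊢
      exact mul_le_mul_of_nonneg_right this (norm_nonneg _)
    | append_singleton l i ih =>
      intro φ hφ
      have h1 : IsSmoothBdd B fun x => bDeriv S i φ x + φ x * κ i x :=
        IsSymbol.add hB (IsSmoothBdd.map_bDeriv hB hR hφ i) (hφ.mul hB (hκ i))
      obtain ⟨C, hC⟩ := ih _ h1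
      refine ⟨C, fun x hx => ?_⟩
      rw [bDerivs_append]
      have h2 : EqOn (bDeriv S i fun x => φ x * u x)
          (fun x => (bDeriv S i φ x + φ x * κ i x) * u x) B := by
        intro y hy
        rw [bDeriv_mul hB hφ.contDiffOn hu i hy]
        simp only [h i hy]
        ring
      have h3 := bDerivs_congr (S := S) hB h2 l hx
      exact (le_of_eq (congrArg _ h3)).trans (hC x hx)
  obtain ⟨C, hC⟩ := key (fun _ => 1) (isSmoothBdd_const hB 1)
  exact ⟨C, by simpa using hC⟩

end Calculus

/-! ### Polyhomogeneity by means of differential operators -/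

section Polyhomogeneous

variable {n : ℕ} {S : Finset (Fin n)} {B : Set (EuclideanSpace ℝ (Fin n))}
  {u v : EuclideanSpace ℝ (Fin n) → ℂ} {w : EuclideanSpace ℝ (Fin n) → ℝ}
  {ρ ρ' : Fin n → ℂ → ℕ}

/-- The operator `D_i - z`, where `D_i` is `bDeriv S i` and `q = (i, z)`. -/
def bOp (S : Finset (Fin n)) (q : Fin n × ℂ) (u : EuclideanSpace ℝ (Fin n) → ℂ) :
    EuclideanSpace ℝ (Fin n) → ℂ :=
  fun x => bDeriv S q.1 u x - q.2 * u x

/-- The product of the operators `bOp`; the first one in the list is applied first. -/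
def bOps (S : Finset (Fin n)) (L : List (Fin n × ℂ)) (u : EuclideanSpace ℝ (Fin n) → ℂ) :
    EuclideanSpace ℝ (Fin n) → ℂ :=
  L.foldl (fun u q => bOp S q u) u

theorem bOps_cons (q : Fin n × ℂ) (L : List (Fin n × ℂ)) :
    bOps S (q :: L) u = bOps S L (bOp S q u) := rfl

theorem bOps_append (L L' : List (Fin n × ℂ)) :
    bOps S (L ++ L') u = bOps S L' (bOps S L u) := by
  simp [bOps]

theorem contDiffOn_bOp (hB : IsOpen B) (hu : ContDiffOn ℝ ∞ u B) (q : Fin n × ℂ) :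
    ContDiffOn ℝ ∞ (bOp S q u) B :=
  (contDiffOn_bDeriv hB hu q.1).sub (contDiffOn_const.mul hu)

theorem contDiffOn_bOps (hB : IsOpen B) (hu : ContDiffOn ℝ ∞ u B) (L : List (Fin n × ℂ)) :
    ContDiffOn ℝ ∞ (bOps S L u) B := by
  induction L generalizing u with
  | nil => exact hu
  | cons q L ih => exact ih (contDiffOn_bOp hB hu q)

theorem bOp_congr (hB : IsOpen B) (h : EqOn u v B) (q : Fin n × ℂ) :
    EqOn (bOp S q u) (bOp S q v) B := fun x hx => by
  simp only [bOp, bDeriv_congr hB h q.1 hx, h hx]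

theorem bOps_congr (hB : IsOpen B) (h : EqOn u v B) (L : List (Fin n × ℂ)) :
    EqOn (bOps S L u) (bOps S L v) B := by
  induction L generalizing u v with
  | nil => exact h
  | cons q L ih => exact ih (bOp_congr hB h q)

theorem bOp_add (hB : IsOpen B) (hu : ContDiffOn ℝ ∞ u B) (hv : ContDiffOn ℝ ∞ v B)
    (q : Fin n × ℂ) :
    EqOn (bOp S q fun x => u x + v x) (fun x => bOp S q u x + bOp S q v x) B := fun x hx => by
  simp only [bOp, bDeriv_add hB hu hv q.1 hx]
  ring

theorem bOps_add (hB : IsOpen B) (hu : ContDiffOn ℝ ∞ u B) (hv : ContDiffOn ℝ ∞ v B)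
    (L : List (Fin n × ℂ)) :
    EqOn (bOps S L fun x => u x + v x) (fun x => bOps S L u x + bOps S L v x) B := by
  induction L generalizing u v with
  | nil => exact fun _ _ => rfl
  | cons q L ih =>
    exact (bOps_congr hB (bOp_add hB hu hv q) L).trans
      (ih (contDiffOn_bOp hB hu q) (contDiffOn_bOp hB hv q))

theorem bOp_const_mul (hB : IsOpen B) (hu : ContDiffOn ℝ ∞ u B) (c : ℂ)
    (q : Fin n × ℂ) :
    EqOn (bOp S q fun x => c * u x) (fun x => c * bOp S q u x) B := fun x hx => by
  simp only [bOp, bDeriv_const_mul hB hu c q.1 hx]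
  ring

theorem bOps_const_mul (hB : IsOpen B) (hu : ContDiffOn ℝ ∞ u B) (c : ℂ)
    (L : List (Fin n × ℂ)) :
    EqOn (bOps S L fun x => c * u x) (fun x => c * bOps S L u x) B := by
  induction L generalizing u with
  | nil => exact fun _ _ => rfl
  | cons q L ih =>
    exact (bOps_congr hB (bOp_const_mul hB hu c q) L).trans (ih (contDiffOn_bOp hB hu q))

theorem bOp_comm (hB : IsOpen B) (hu : ContDiffOn ℝ ∞ u B) (q q' : Fin n × ℂ) :
    EqOn (bOp S q (bOp S q' u)) (bOp S q' (bOp S q u)) B := by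
  have key : ∀ q q' : Fin n × ℂ, EqOn (bOp S q (bOp S q' u)) (fun x =>
      bDeriv S q.1 (bDeriv S q'.1 u) x - q'.2 * bDeriv S q.1 u x - q.2 * bDeriv S q'.1 u x
        + q.2 * q'.2 * u x) B := by
    intro q q' x hx
    have h1 : bOp S q' u = fun x => bDeriv S q'.1 u x + (-q'.2) * u x := by
      ext y; simp only [bOp]; ring
    have h2 := bDeriv_add (S := S) hB (contDiffOn_bDeriv (S := S) hB hu q'.1)
      ((contDiffOn_const (c := -q'.2)).mul hu) q.1 hx
    have h3 := bDeriv_const_mul (S := S) hB hu (-q'.2) q.1 hx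
    have h4 : bOp S q (bOp S q' u) x = bDeriv S q.1 (bOp S q' u) x - q.2 * bOp S q' u x := rfl
    rw [h4, h1]
    simp only [] at h2 h3
    rw [h2, h3]
    ring
  intro x hx
  rw [key q q' hx, key q' q hx]
  simp only [bDeriv_comm hB hu q.1 q'.1 hx]
  ring

/-- Allows the operator of a chosen root to be applied first. -/
theorem bOps_perm (hB : IsOpen B) (hu : ContDiffOn ℝ ∞ u B) {L L' : List (Fin n × ℂ)}
    (h : L.Perm L') : EqOn (bOps S L u) (bOps S L' u) B := by
  induction h generalizing u with
  | nil => exact fun _ _ => rfl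
  | cons q _ ih => exact ih (contDiffOn_bOp hB hu q)
  | swap q q' L => exact bOps_congr hB (bOp_comm hB hu q q') L
  | trans _ _ ih ih' => exact (ih hu).trans (ih' hu)

theorem bDerivs_eq_bOps (l : List (Fin n)) :
    bDerivs S l u = bOps S (l.reverse.map fun i => (i, 0)) u := by
  induction l with
  | nil => rfl
  | cons i l ih =>
    rw [List.reverse_cons, List.map_append, bOps_append, ← ih]
    ext x
    simp [bOps, bOp, bDerivs]

theorem IsSymbol.bOp (hB : IsOpen B) (hu : IsSymbol S B w u) (q : Fin n × ℂ) :
    IsSymbol S B w (bOp S q u) :=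
  (hu.map_bDeriv hB q.1).sub hB (hu.const_mul hB q.2)

theorem IsSymbol.bOps (hB : IsOpen B) (hu : IsSymbol S B w u) (L : List (Fin n × ℂ)) :
    IsSymbol S B w (bOps S L u) := by
  induction L generalizing u with
  | nil => exact hu
  | cons q L ih => exact ih (hu.bOp hB q)

/-- The weight `∏_{j ∈ S} (x j)^(m j)`. -/
def weight (S : Finset (Fin n)) (m : Fin n → ℝ) (x : EuclideanSpace ℝ (Fin n)) : ℝ :=
  ∏ j ∈ S, x j ^ m j

theorem weight_nonneg (hpos : ∀ x ∈ B, ∀ j ∈ S, 0 < x j) (m : Fin n → ℝ) :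
    ∀ x ∈ B, 0 ≤ weight S m x :=
  fun x hx => Finset.prod_nonneg fun j hj => Real.rpow_nonneg (hpos x hx j hj).le _

theorem weight_pos (hpos : ∀ x ∈ B, ∀ j ∈ S, 0 < x j) (m : Fin n → ℝ) :
    ∀ x ∈ B, 0 < weight S m x :=
  fun x hx => Finset.prod_pos fun j hj => Real.rpow_pos_of_pos (hpos x hx j hj) _

theorem weight_add (hpos : ∀ x ∈ B, ∀ j ∈ S, 0 < x j) (m m' : Fin n → ℝ) :
    ∀ x ∈ B, weight S (fun j => m j + m' j) x = weight S m x * weight S m' x := by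
  intro x hx
  simp only [weight, ← Finset.prod_mul_distrib]
  exact Finset.prod_congr rfl fun j hj => Real.rpow_add (hpos x hx j hj) _ _

/-- `u` is polyhomogeneous with exponents `z` of multiplicity at most `ρ j z` at `x j = 0`. -/
structure IsPhg (S : Finset (Fin n)) (B : Set (EuclideanSpace ℝ (Fin n))) (ρ : Fin n → ℂ → ℕ)
    (u : EuclideanSpace ℝ (Fin n) → ℂ) : Prop where
  contDiffOn : ContDiffOn ℝ ∞ u B
  bound : ∀ (m : Fin n → ℝ) (L : List (Fin n × ℂ)),
    (∀ j ∈ S, ∀ z : ℂ, z.re ≤ m j → ρ j z ≤ L.count (j, z)) →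
      ∃ C : ℝ, ∀ x ∈ B, ‖bOps S L u x‖ ≤ C * weight S m x

/-- The multiplicity condition on `L` is only a lower bound, so further operators D_i = D_i - 0 may
be appended; the single estimate in `IsPhg` thus controls all derivatives. -/
theorem IsPhg.isSymbol (hB : IsOpen B) (hu : IsPhg S B ρ u) {m : Fin n → ℝ}
    {L : List (Fin n × ℂ)}
    (h : ∀ j ∈ S, ∀ z : ℂ, z.re ≤ m j → ρ j z ≤ L.count (j, z)) :
    IsSymbol S B (weight S m) (PushForward.bOps S L u) := by
  refine ⟨contDiffOn_bOps hB hu.contDiffOn L, fun l => ?_⟩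
  rw [bDerivs_eq_bOps, ← bOps_append]
  refine hu.bound m _ fun j hj z hz => (h j hj z hz).trans ?_
  rw [List.count_append]
  exact Nat.le_add_right _ _

theorem IsPhg.congr (hB : IsOpen B) (hu : IsPhg S B ρ u) (h : EqOn u v B) : IsPhg S B ρ v :=
  ⟨hu.contDiffOn.congr fun x hx => (h hx).symm, fun m L hL =>
    (hu.bound m L hL).imp fun _ hC x hx => by rw [← bOps_congr hB h L hx]; exact hC x hx⟩

theorem IsPhg.add (hB : IsOpen B) (hu : IsPhg S B ρ u) (hv : IsPhg S B ρ v) :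
    IsPhg S B ρ fun x => u x + v x := by
  refine ⟨hu.contDiffOn.add hv.contDiffOn, fun m L hL => ?_⟩
  obtain ⟨C, hC⟩ := hu.bound m L hL
  obtain ⟨D, hD⟩ := hv.bound m L hL
  refine ⟨C + D, fun x hx => ?_⟩
  rw [bOps_add hB hu.contDiffOn hv.contDiffOn L hx, add_mul]
  exact (norm_add_le _ _).trans (add_le_add (hC x hx) (hD x hx))

/-- A list sufficient for the multiplicities `ρ'` becomes sufficient for `ρ` once `q` is prepended:
the operator uses up one root. -/
theorem IsPhg.bOp (hB : IsOpen B) (hu : IsPhg S B ρ u) (q : Fin n × ℂ)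
    (h : ∀ j ∈ S, ∀ z, ρ j z ≤ ρ' j z + if (j, z) = q then 1 else 0) :
    IsPhg S B ρ' (bOp S q u) := by
  refine ⟨contDiffOn_bOp hB hu.contDiffOn q, fun m L hL =>
    hu.bound m (q :: L) fun j hj z hz => (h j hj z).trans ?_⟩
  rw [List.count_cons]
  have := hL j hj z hz
  by_cases hq : (j, z) = q
  · simp [hq] at this ⊢
    simpa [← hq] using this
  · simp only [hq, if_false]
    omega

theorem IsPhg.map_bDeriv (hB : IsOpen B) (hu : IsPhg S B ρ u) (i : Fin n) :
    IsPhg S B ρ (bDeriv S i u) :=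
  (hu.bOp hB (ρ' := ρ) (i, 0) fun _ _ _ => Nat.le_add_right _ _).congr hB fun x _ => by
    simp [PushForward.bOp]

/-- The monomial `∏_{j ∈ S} (x j)^(β j)`. -/
def monomial (S : Finset (Fin n)) (β : Fin n → ℕ) (x : EuclideanSpace ℝ (Fin n)) : ℂ :=
  ∏ j ∈ S, ((x j : ℝ) : ℂ) ^ β j

theorem contDiff_monomial (β : Fin n → ℕ) : ContDiff ℝ ∞ (monomial S β) := by
  unfold monomial
  exact contDiff_prod fun j _ => (contDiff_coordC j).pow _

theorem bDeriv_monomial (β : Fin n → ℕ) (i : Fin n) (x : EuclideanSpace ℝ (Fin n)) :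
    bDeriv S i (monomial S β) x = (if i ∈ S then (β i : ℂ) else 0) * monomial S β x := by
  -- The product grows over subsets T while the operators remain those of S.
  have key : ∀ T ⊆ S, bDeriv S i (monomial T β) x =
      (if i ∈ T then (β i : ℂ) else 0) * monomial T β x := by
    intro T
    induction T using Finset.induction_on with
    | empty =>
      intro _
      have : monomial (∅ : Finset (Fin n)) β = fun _ => 1 := by ext y; simp [monomial]
      simp [this, bDeriv_apply]
    | insert j T hj ih =>
      intro hT
      have h1 : monomial (insert j T) β = fun x => ((x j : ℝ) : ℂ) ^ β j * monomial T β x := by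
        ext y; simp [monomial, Finset.prod_insert hj]
      have h2 := bDeriv_mul (S := S) isOpen_univ ((contDiff_coordC j).pow (β j)).contDiffOn
        (contDiff_monomial (S := T) β).contDiffOn i (mem_univ x)
      have hd : HasDerivAt (fun t : ℝ => (t : ℂ) ^ β j) (β j * (x j : ℂ) ^ (β j - 1)) (x j) := by
        have := HasDerivAt.fun_pow (HasDerivAt.ofReal_comp (hasDerivAt_id (x j))) (β j)
        simpa using this
      have h3 := bDeriv_comp_coord (S := S) i hd.differentiableAt
      rw [h1, h2]
      simp only []
      rw [h3, ih ((Finset.subset_insert _ _).trans hT), hd.deriv]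
      by_cases hij : i = j
      · subst hij
        have hi : i ∈ S := hT (Finset.mem_insert_self _ _)
        simp only [hj, bCoef, hi, Finset.mem_insert_self, if_true, if_false]
        rcases Nat.eq_zero_or_pos (β i) with h0 | h0
        · simp [h0]
        · have : ((x i : ℝ) : ℂ) ^ β i = (x i : ℂ) * (x i : ℂ) ^ (β i - 1) := by
            rw [← pow_succ', Nat.sub_add_cancel h0]
          rw [this]; ring
      · simp only [hij, if_false, Finset.mem_insert, false_or]
        ring
  exact key S subset_rfl

theorem norm_monomial (hpos : ∀ x ∈ B, ∀ j ∈ S, 0 < x j) (β : Fin n → ℕ) :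
    ∀ x ∈ B, ‖monomial S β x‖ = weight S (fun j => β j) x := by
  intro x hx
  simp only [monomial, weight, norm_prod, norm_pow, Complex.norm_real]
  refine Finset.prod_congr rfl fun j hj => ?_
  rw [Real.norm_of_nonneg (hpos x hx j hj).le, Real.rpow_natCast]

/-- Conjugation with x^β turns D_j - z into D_j - (z - β_j). -/
theorem bOps_monomial_mul (hB : IsOpen B) (hu : ContDiffOn ℝ ∞ u B) (β : Fin n → ℕ)
    (L : List (Fin n × ℂ)) :
    EqOn (bOps S L fun x => monomial S β x * u x) (fun x => monomial S β x *
      bOps S (L.map fun q => (q.1, q.2 - if q.1 ∈ S then (β q.1 : ℂ) else 0)) u x) B := by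
  induction L generalizing u with
  | nil => exact fun _ _ => rfl
  | cons q L ih =>
    refine (bOps_congr hB ?_ L).trans (ih (contDiffOn_bOp hB hu _))
    intro x hx
    have h1 := bDeriv_mul (S := S) hB (contDiff_monomial (S := S) β).contDiffOn hu q.1 hx
    have h2 : bOp S q (fun x => monomial S β x * u x) x =
      bDeriv S q.1 (fun x => monomial S β x * u x) x - q.2 * (monomial S β x * u x) := rfl
    refine h2.trans ?_
    rw [h1]
    simp only [bDeriv_monomial, bOp]
    ring

theorem IsPhg.monomial_mul (hB : IsOpen B) (hpos : ∀ x ∈ B, ∀ j ∈ S, 0 < x j)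
    (hu : IsPhg S B ρ u) (β : Fin n → ℕ) (h : ∀ j ∈ S, ∀ z, ρ j z ≤ ρ' j (z + β j)) :
    IsPhg S B ρ' fun x => monomial S β x * u x := by
  refine ⟨(contDiff_monomial β).contDiffOn.mul hu.contDiffOn, fun m L hL => ?_⟩
  set σ : Fin n × ℂ → Fin n × ℂ := fun q => (q.1, q.2 - if q.1 ∈ S then (β q.1 : ℂ) else 0)
  have hσ : Function.Injective σ := by
    rintro ⟨i, z⟩ ⟨i', z'⟩ hq
    obtain ⟨rfl, h2⟩ := Prod.mk.inj hq
    simpa using h2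
  obtain ⟨C, hC⟩ := hu.bound (fun j => m j - β j) (L.map σ) (by
    intro j hj z hz
    have h1 : σ (j, z + β j) = (j, z) := by simp [σ, hj]
    rw [← h1, List.count_map_of_injective L σ hσ]
    refine (h j hj z).trans (hL j hj _ ?_)
    simp only [Complex.add_re, Complex.natCast_re]
    linarith)
  refine ⟨C, fun x hx => ?_⟩
  have h3 : weight S m x = weight S (fun j => m j - β j) x * weight S (fun j => β j) x := by
    rw [← weight_add hpos _ _ x hx]
    simp
  rw [bOps_monomial_mul hB hu.contDiffOn β L hx, norm_mul, norm_monomial hpos β x hx, h3,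
    ← mul_assoc, mul_comm]
  exact mul_le_mul_of_nonneg_right (hC x hx) (weight_nonneg hpos _ x hx)

theorem monomial_single {j : Fin n} (hj : j ∈ S) (x : EuclideanSpace ℝ (Fin n)) :
    monomial S (Pi.single j 1) x = (x j : ℂ) := by
  rw [monomial, Finset.prod_eq_single j]
  · simp
  · intro i _ hi; simp [hi]
  · exact fun h => absurd hj h

theorem IsPhg.coord_mul (hB : IsOpen B) (hpos : ∀ x ∈ B, ∀ j ∈ S, 0 < x j)
    (hu : IsPhg S B ρ u) {j : Fin n} (hj : j ∈ S)
    (h : ∀ i ∈ S, i ≠ j → ∀ z, ρ i z ≤ ρ' i z) (h' : ∀ z, ρ j z ≤ ρ' j (z + 1)) :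
    IsPhg S B ρ' fun x => ((x j : ℝ) : ℂ) * u x := by
  have := hu.monomial_mul hB hpos (ρ' := ρ') (Pi.single j 1) (by
    intro i hi z
    rcases eq_or_ne i j with rfl | hij
    · simpa using h' z
    · simpa [hij] using h i hi hij z)
  exact this.congr hB fun x _ => by simp only [monomial_single hj]

/-- Supplies the induction parameter of the later arguments: the roots below the weight, with
multiplicity, form a finite multiset whose size drops as they are removed. -/
theorem exists_multiset_roots (hfin : ∀ j ∈ S, ∀ N : ℝ, {z | ρ j z ≠ 0 ∧ z.re ≤ N}.Finite)
    (m : Fin n → ℝ) : ∃ R : Multiset (Fin n × ℂ), ∀ j z,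
      R.count (j, z) = if j ∈ S ∧ z.re ≤ m j then ρ j z else 0 := by
  classical
  have hF : (⋃ j ∈ (S : Set (Fin n)), (fun z : ℂ => (j, z)) '' {z | ρ j z ≠ 0 ∧ z.re ≤ m j}).Finite :=
    S.finite_toSet.biUnion fun j hj => (hfin j hj (m j)).image _
  refine ⟨Finsupp.toMultiset (Finsupp.onFinset hF.toFinset
    (fun q => if q.1 ∈ S ∧ q.2.re ≤ m q.1 then ρ q.1 q.2 else 0) ?_), fun j z => ?_⟩
  · rintro ⟨j, z⟩ h
    simp only [ne_eq, ite_eq_right_iff, Classical.not_imp] at h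
    simp only [Finite.mem_toFinset, mem_iUnion]
    exact ⟨j, h.1.1, z, ⟨h.2, h.1.2⟩, rfl⟩
  · rw [Finsupp.count_toMultiset]
    rfl

/-- What remains of the multiplicities after one root `q` is removed. -/
def removeRoot (ρ : Fin n → ℂ → ℕ) (q : Fin n × ℂ) : Fin n → ℂ → ℕ :=
  fun j z => ρ j z - if (j, z) = q then 1 else 0

theorem removeRoot_of_ne {q : Fin n × ℂ} {j : Fin n} {z : ℂ} (h : (j, z) ≠ q) :
    removeRoot ρ q j z = ρ j z := by simp [removeRoot, h]

theorem removeRoot_self (j : Fin n) (z : ℂ) : removeRoot ρ (j, z) j z = ρ j z - 1 := by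
  simp [removeRoot]

theorem removeRoot_le (q : Fin n × ℂ) (j : Fin n) (z : ℂ) : removeRoot ρ q j z ≤ ρ j z :=
  Nat.sub_le _ _

theorem le_removeRoot_add (q : Fin n × ℂ) (j : Fin n) (z : ℂ) :
    ρ j z ≤ removeRoot ρ q j z + if (j, z) = q then 1 else 0 := by
  unfold removeRoot; omega

/-- Removing a root of minimal real part from a shift-invariant family of multiplicities. -/
theorem exists_minimal_root (hρ : ∀ j ∈ S, ∀ z, ρ j z ≤ ρ j (z + 1)) {m : Fin n → ℝ}
    {R : Multiset (Fin n × ℂ)}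
    (hR : ∀ j z, R.count (j, z) = if j ∈ S ∧ z.re ≤ m j then ρ j z else 0) (h0 : R ≠ 0) :
    ∃ (j : Fin n) (z : ℂ), (j, z) ∈ R ∧ j ∈ S ∧ z.re ≤ m j ∧ 0 < ρ j z ∧ ρ j (z - 1) = 0 ∧
      (∀ k ∈ S, ∀ y, removeRoot ρ (j, z) k y ≤ removeRoot ρ (j, z) k (y + 1)) ∧
      (∀ y, ρ j y ≤ removeRoot ρ (j, z) j (y + 1)) ∧
      (∀ k y, (R.erase (j, z)).count (k, y) =
        if k ∈ S ∧ y.re ≤ m k then removeRoot ρ (j, z) k y else 0) := by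
  classical
  obtain ⟨q, hq⟩ := Multiset.exists_mem_of_ne_zero h0
  obtain ⟨⟨j, z⟩, hjz, hmin⟩ := R.toFinset.exists_min_image (fun q => q.2.re) ⟨q, by simpa using hq⟩
  rw [Multiset.mem_toFinset] at hjz
  have h1 : 0 < R.count (j, z) := Multiset.count_pos.2 hjz
  rw [hR] at h1
  split_ifs at h1 with h2
  swap
  · omega
  -- Minimality of Re z is used here. After z is removed, shift-invariance could fail only at z - 1,
  -- which is not a root.
  have h3 : ρ j (z - 1) = 0 := by
    by_contra h3
    have h4 : (j, z - 1) ∈ R := by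
      rw [← Multiset.count_pos, hR, if_pos ⟨h2.1, by simp; linarith [h2.2]⟩]
      omega
    have := hmin _ (Multiset.mem_toFinset.2 h4)
    simp at this
    linarith
  refine ⟨j, z, hjz, h2.1, h2.2, h1, h3, ?_, ?_, ?_⟩
  · intro k hk y
    by_cases hy : (k, y + 1) = (j, z)
    · obtain ⟨rfl, rfl⟩ := Prod.mk.inj hy
      have : ρ k y = 0 := by simpa using h3
      have h5 := removeRoot_le (ρ := ρ) (k, y + 1) k y
      omega
    · rw [removeRoot_of_ne hy]
      exact (removeRoot_le _ _ _).trans (hρ k hk y)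
  · intro y
    by_cases hy : (j, y + 1) = (j, z)
    · obtain ⟨-, rfl⟩ := Prod.mk.inj hy
      have : ρ j y = 0 := by simpa using h3
      omega
    · rw [removeRoot_of_ne hy]
      exact hρ j h2.1 y
  · intro k y
    by_cases hy : (k, y) = (j, z)
    · obtain ⟨rfl, rfl⟩ := Prod.mk.inj hy
      rw [Multiset.count_erase_self, hR, if_pos h2, if_pos h2, removeRoot_self]
    · rw [Multiset.count_erase_of_ne hy, hR, removeRoot_of_ne hy]

/-- By the Leibniz rule (D_j - z)(φ u) = φ (D_j - z)u + (∂_j φ)(x_j u). If z is a root of minimal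
real part, it is gone from both (D_j - z)u and x_j u: the operator uses it up, and the factor x_j
shifts all roots at x_j = 0 by one. Induction on the number of roots below the weight finishes the
proof. -/
theorem IsPhg.smooth_mul (hB : IsOpen B) {r : ℝ} (hr : ∀ x ∈ B, ∀ i, |x i| ≤ r)
    (hpos : ∀ x ∈ B, ∀ j ∈ S, 0 < x j)
    (hρ : ∀ j ∈ S, ∀ z, ρ j z ≤ ρ j (z + 1))
    (hfin : ∀ j ∈ S, ∀ N : ℝ, {z | ρ j z ≠ 0 ∧ z.re ≤ N}.Finite)
    {φ : EuclideanSpace ℝ (Fin n) → ℂ} (hφ : IsSmoothBdd B φ) (hu : IsPhg S B ρ u) :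
    IsPhg S B ρ fun x => φ x * u x := by
  classical
  refine ⟨hφ.contDiffOn.mul hu.contDiffOn, fun m L hL => ?_⟩
  obtain ⟨R, hR⟩ := exists_multiset_roots hfin m
  clear hfin
  obtain ⟨k, hk⟩ : ∃ k, R.card = k := ⟨_, rfl⟩
  induction k generalizing R ρ u φ L with
  | zero =>
    rw [Multiset.card_eq_zero] at hk
    subst hk
    have h1 : IsSymbol S B (weight S m) u := hu.isSymbol (L := []) hB fun j hj z hz => by
      have := hR j z
      rw [if_pos ⟨hj, hz⟩] at this
      simp [← this]
    exact ((IsSymbol.smooth_mul hB hr hφ h1).bOps hB L).bound []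
  | succ k ih =>
    have h0 : R ≠ 0 := by rintro rfl; simp at hk
    obtain ⟨j, z, hjz, hj, hz, hpz, -, hmono, hshift, hcount⟩ := exists_minimal_root hρ hR h0
    have hmem : (j, z) ∈ L := List.count_pos_iff.1 (hpz.trans_le (hL j hj z hz))
    have hL' : ∀ i ∈ S, ∀ y : ℂ, y.re ≤ m i →
        removeRoot ρ (j, z) i y ≤ (L.erase (j, z)).count (i, y) := by
      intro i hi y hy
      have := hL i hi y hy
      rw [List.count_erase]
      unfold removeRoot
      by_cases h : (i, y) = (j, z)
      · simp only [h, if_true] at this ⊢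
        simp; omega
      · have h' : ¬ ((j, z) == (i, y)) = true := by simpa using fun h1 h2 => h (by rw [h1, h2])
        rw [if_neg h, if_neg h']; omega
    have hcard : (R.erase (j, z)).card = k := by rw [Multiset.card_erase_of_mem hjz, hk]; rfl
    have hu1 : IsPhg S B (removeRoot ρ (j, z)) (PushForward.bOp S (j, z) u) :=
      hu.bOp hB _ fun i _ y => le_removeRoot_add _ i y
    have hu2 : IsPhg S B (removeRoot ρ (j, z)) fun x => ((x j : ℝ) : ℂ) * u x :=
      hu.coord_mul hB hpos hj (fun i _ hij y => by
        rw [removeRoot_of_ne]; simp [hij]) hshift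
    have hφ' : IsSmoothBdd B (bDeriv ∅ j φ) := IsSymbol.map_bDeriv hB hφ j
    obtain ⟨C, hC⟩ := ih hmono hφ hu1 _ hL' _ hcount hcard
    obtain ⟨D, hD⟩ := ih hmono hφ' hu2 _ hL' _ hcount hcard
    refine ⟨C + D, fun x hx => ?_⟩
    have h1 := bOps_perm (S := S) hB (hφ.contDiffOn.mul hu.contDiffOn) (List.perm_cons_erase hmem) hx
    have h2 : EqOn (PushForward.bOp S (j, z) fun x => φ x * u x) (fun x =>
        φ x * PushForward.bOp S (j, z) u x + bDeriv ∅ j φ x * (((x j : ℝ) : ℂ) * u x)) B := by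
      intro y hy
      have h3 := bDeriv_mul (S := S) hB hφ.contDiffOn hu.contDiffOn j hy
      have h4 : bDeriv S j φ y = (y j : ℂ) * bDeriv ∅ j φ y := by
        rw [bDeriv_eq_mul]; simp [bCoef, hj]
      simp only [PushForward.bOp]
      rw [h3]
      simp only []
      rw [h4]
      ring
    rw [h1, bOps_cons, bOps_congr hB h2 _ hx,
      bOps_add hB (hφ.contDiffOn.mul hu1.contDiffOn) (hφ'.contDiffOn.mul hu2.contDiffOn) _ hx,
      add_mul]
    exact (norm_add_le _ _).trans (add_le_add (hC x hx) (hD x hx))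

end Polyhomogeneous

/-! ### Powers times polynomials in the logarithm -/

section PowLog

open Polynomial

/-- The function `t^z P(log t)`. -/
def powLog (z : ℂ) (P : ℂ[X]) (t : ℝ) : ℂ := (t : ℂ) ^ z * P.eval ((Real.log t : ℝ) : ℂ)

theorem powLog_X_pow (z : ℂ) (p : ℕ) (t : ℝ) :
    powLog z (X ^ p) t = (t : ℂ) ^ z * ((Real.log t : ℝ) : ℂ) ^ p := by simp [powLog]

theorem powLog_add (z : ℂ) (P Q : ℂ[X]) (t : ℝ) :
    powLog z (P + Q) t = powLog z P t + powLog z Q t := by simp [powLog, mul_add]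

theorem hasDerivAt_powLog (z : ℂ) (P : ℂ[X]) {t : ℝ} (ht : 0 < t) :
    HasDerivAt (powLog z P) ((t : ℂ)⁻¹ * powLog z (C z * P + derivative P) t) t := by
  have ht' : (t : ℂ) ≠ 0 := by exact_mod_cast ht.ne'
  have h1 : HasDerivAt (fun t : ℝ => (t : ℂ) ^ z) (z * (t : ℂ) ^ (z - 1)) t := by
    rcases eq_or_ne z 0 with rfl | hz
    · simpa using hasDerivAt_const t (1 : ℂ)
    · exact hasDerivAt_ofReal_cpow_const ht.ne' hz
  have h2 : HasDerivAt (fun t : ℝ => P.eval ((Real.log t : ℝ) : ℂ))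
      ((derivative P).eval ((Real.log t : ℝ) : ℂ) * (t : ℂ)⁻¹) t := by
    have h3 := HasDerivAt.ofReal_comp (Real.hasDerivAt_log ht.ne')
    rw [Complex.ofReal_inv] at h3
    exact (P.hasDerivAt _).comp t h3
  have h4 := h1.mul h2
  refine h4.congr_deriv ?_
  rw [Complex.cpow_sub _ _ ht', Complex.cpow_one]
  simp only [powLog, eval_add, eval_mul, eval_C]
  field_simp

theorem contDiffOn_powLog (z : ℂ) (P : ℂ[X]) : ContDiffOn ℝ ∞ (powLog z P) (Ioi 0) := by
  rw [contDiffOn_infty]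
  intro k
  induction k generalizing P with
  | zero =>
    rw [Nat.cast_zero, contDiffOn_zero]
    exact fun t ht => (hasDerivAt_powLog z P ht).continuousAt.continuousWithinAt
  | succ k ih =>
    rw [Nat.cast_add, Nat.cast_one, contDiffOn_succ_iff_deriv_of_isOpen isOpen_Ioi]
    refine ⟨fun t ht => (hasDerivAt_powLog z P ht).differentiableAt.differentiableWithinAt,
      by simp, ?_⟩
    have h1 : ContDiffOn ℝ (k : WithTop ℕ∞) (fun t : ℝ => (t : ℂ)⁻¹) (Ioi 0) :=
      (Complex.ofRealCLM.contDiff.contDiffOn (s := Ioi 0)).inv fun t ht => by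
        simpa using (ne_of_gt ht : (t : ℝ) ≠ 0)
    exact (h1.mul (ih _)).congr fun t ht => (hasDerivAt_powLog z P ht).deriv

theorem powLog_bound (z : ℂ) (P : ℂ[X]) {m : ℝ} (hm : m < z.re) :
    ∃ K : ℝ, ∀ t ∈ Ioc (0 : ℝ) 1, ‖powLog z P t‖ ≤ K * t ^ m := by
  induction P using Polynomial.induction_on' with
  | add P Q hP hQ =>
    obtain ⟨K, hK⟩ := hP
    obtain ⟨K', hK'⟩ := hQ
    refine ⟨K + K', fun t ht => ?_⟩
    rw [powLog_add, add_mul]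
    exact (norm_add_le _ _).trans (add_le_add (hK t ht) (hK' t ht))
  | monomial k c =>
    -- Each of the k logarithms costs a power t^δ, and kδ ≤ Re z - m; the denominator k + 1 also
    -- covers k = 0.
    set δ := (z.re - m) / (k + 1) with hδ
    have hδ0 : 0 < δ := div_pos (by linarith) (by positivity)
    refine ⟨‖c‖ * (1 / δ) ^ k, fun t ht => ?_⟩
    have h1 := Real.abs_log_mul_self_rpow_lt t δ ht.1 ht.2 hδ0
    have h2 : (|Real.log t * t ^ δ|) ^ k ≤ (1 / δ) ^ k := by gcongr
    have h3 : t ^ (z.re) ≤ t ^ m * (t ^ δ) ^ k := by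
      rw [← Real.rpow_natCast, ← Real.rpow_mul ht.1.le, ← Real.rpow_add ht.1]
      apply Real.rpow_le_rpow_of_exponent_ge ht.1 ht.2
      have : δ * (k + 1) = z.re - m := by rw [hδ]; field_simp
      nlinarith
    rw [powLog, norm_mul, Complex.norm_cpow_eq_rpow_re_of_pos ht.1, eval_monomial, norm_mul,
      norm_pow, Complex.norm_real, Real.norm_eq_abs]
    rw [abs_mul, abs_of_pos (Real.rpow_pos_of_pos ht.1 δ), mul_pow] at h2
    calc t ^ z.re * (‖c‖ * |Real.log t| ^ k)
        ≤ t ^ m * (t ^ δ) ^ k * (‖c‖ * |Real.log t| ^ k) := by gcongr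
      _ = ‖c‖ * (|Real.log t| ^ k * (t ^ δ) ^ k) * t ^ m := by ring
      _ ≤ ‖c‖ * (1 / δ) ^ k * t ^ m := by
        have := Real.rpow_nonneg ht.1.le m
        gcongr

end PowLog

/-! ### Nice functions are polyhomogeneous -/

section Nice

open Polynomial

variable {n : ℕ} {S : Finset (Fin n)} {c : EuclideanSpace ℝ (Fin n)} {ε ε' : ℝ}
  {u : EuclideanSpace ℝ (Fin n) → ℂ} {𝓔 : Fin n → Set (ℂ × ℕ)}

theorem isOpen_cornerBox : IsOpen (cornerBox S c ε) := by
  have : cornerBox S c ε = ⋂ i, {x | |x i - c i| < ε ∧ (i ∈ S → 0 < x i)} := by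
    ext x; simp [cornerBox]
  rw [this]
  refine isOpen_iInter_of_finite fun i => ?_
  have hi : Continuous fun x : EuclideanSpace ℝ (Fin n) => x i := (contDiff_coord i).continuous
  by_cases h : i ∈ S
  · simp only [h, true_imp_iff]
    exact (isOpen_lt (hi.sub continuous_const).abs continuous_const).inter (isOpen_lt continuous_const hi)
  · simp only [h, false_imp_iff, and_true]
    exact isOpen_lt (hi.sub continuous_const).abs continuous_const

theorem cornerBox_mono {S' : Finset (Fin n)} (hS : S' ⊆ S) (h : ε' ≤ ε) :
    cornerBox S c ε' ⊆ cornerBox S' c ε :=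
  fun _ hx i => ⟨(hx i).1.trans_le h, fun hi => (hx i).2 (hS hi)⟩

theorem cornerBox_pos : ∀ x ∈ cornerBox S c ε, ∀ j ∈ S, 0 < x j := fun _ hx j hj => (hx j).2 hj

theorem cornerBox_lt (hc : ∀ j ∈ S, c j = 0) : ∀ x ∈ cornerBox S c ε, ∀ j ∈ S, x j < ε :=
  fun x hx j hj => by
    have := (abs_lt.1 (hx j).1).2
    rw [hc j hj] at this
    linarith

theorem cornerBox_bdd : ∀ x ∈ cornerBox S c ε, ∀ i, |x i| ≤ ‖c‖ + ε := fun x hx i => by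
  have h1 := (hx i).1
  have h2 : |c i| ≤ ‖c‖ := by simpa using EuclideanSpace.norm_eq c ▸ PiLp.norm_apply_le c i
  have h3 := abs_add_le (x i - c i) (c i)
  simp only [sub_add_cancel] at h3
  linarith

/-- The closed counterpart of `cornerBox`. -/
def closedCornerBox (S : Finset (Fin n)) (c : EuclideanSpace ℝ (Fin n)) (ε : ℝ) :
    Set (EuclideanSpace ℝ (Fin n)) :=
  {x | ∀ i, |x i - c i| ≤ ε ∧ (i ∈ S → 0 ≤ x i)}

theorem isCompact_closedCornerBox : IsCompact (closedCornerBox S c ε) := by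
  have h : closedCornerBox S c ε = WithLp.toLp 2 '' (Set.pi univ fun i =>
      {t : ℝ | |t - c i| ≤ ε ∧ (i ∈ S → 0 ≤ t)}) := by
    ext x
    constructor
    · intro hx
      exact ⟨x.ofLp, fun i _ => hx i, rfl⟩
    · rintro ⟨y, hy, rfl⟩ i
      exact hy i (mem_univ i)
  rw [h]
  refine (isCompact_univ_pi fun i => ?_).image (PiLp.continuous_toLp 2 _)
  have h1 : IsCompact {t : ℝ | |t - c i| ≤ ε} := by
    have : {t : ℝ | |t - c i| ≤ ε} = Metric.closedBall (c i) ε := by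
      ext t; simp [Real.dist_eq]
    rw [this]
    exact isCompact_closedBall _ _
  refine h1.of_isClosed_subset ?_ fun t ht => ht.1
  by_cases hi : i ∈ S
  · simp only [hi, true_imp_iff]
    exact (isClosed_le (continuous_id.sub continuous_const).abs continuous_const).inter
      (isClosed_le continuous_const continuous_id)
  · simp only [hi, false_imp_iff, and_true]
    exact isClosed_le (continuous_id.sub continuous_const).abs continuous_const

theorem cornerBox_subset_closed : cornerBox S c ε ⊆ closedCornerBox S c ε :=
  fun _ hx i => ⟨(hx i).1.le, fun hi => ((hx i).2 hi).le⟩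

/-- `a` does not depend on the `j`-th coordinate. -/
def IndepOf (j : Fin n) (a : EuclideanSpace ℝ (Fin n) → ℂ) : Prop :=
  ∀ x y : EuclideanSpace ℝ (Fin n), (∀ i, i ≠ j → x i = y i) → a x = a y

/-- The function is invariant under translation by x - y. -/
theorem IndepOf.fderiv_eq {j : Fin n} {a : EuclideanSpace ℝ (Fin n) → ℂ} (ha : IndepOf j a)
    {x y : EuclideanSpace ℝ (Fin n)} (h : ∀ i, i ≠ j → x i = y i) :
    fderiv ℝ a x = fderiv ℝ a y := by
  have h1 : (fun z => a (z + (x - y))) = a := by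
    ext z
    exact ha _ _ fun i hi => by simp [h i hi]
  have h2 := fderiv_comp_add_right (𝕜 := ℝ) (f := a) (x := y) (x - y)
  rw [h1] at h2
  rw [h2]
  simp

theorem IndepOf.fderiv_single {j : Fin n} {a : EuclideanSpace ℝ (Fin n) → ℂ} (ha : IndepOf j a)
    (x : EuclideanSpace ℝ (Fin n)) : fderiv ℝ a x (EuclideanSpace.single j 1) = 0 := by
  by_cases hd : DifferentiableAt ℝ a x
  · have h1 : HasLineDerivAt ℝ a (fderiv ℝ a x (EuclideanSpace.single j 1)) x
      (EuclideanSpace.single j 1) := hd.hasFDerivAt.hasLineDerivAt _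
    have h2 : (fun t : ℝ => a (x + t • EuclideanSpace.single j 1)) = fun _ => a x := by
      ext t
      exact ha _ _ fun i hi => by simp [hi]
    have h3 : HasDerivAt (fun t : ℝ => a (x + t • EuclideanSpace.single j 1))
      (fderiv ℝ a x (EuclideanSpace.single j 1)) 0 := h1
    rw [h2] at h3
    exact h3.unique (hasDerivAt_const _ _)
  -- Without differentiability `fderiv` has the default value 0.
  · rw [fderiv_zero_of_not_differentiableAt hd]; rfl

theorem IndepOf.bOp {j : Fin n} {a : EuclideanSpace ℝ (Fin n) → ℂ} (ha : IndepOf j a)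
    {q : Fin n × ℂ} (hq : q.1 ≠ j) : IndepOf j (bOp S q a) := by
  intro x y h
  have h1 : bCoef S q.1 x = bCoef S q.1 y := by simp [bCoef, h _ hq]
  simp only [PushForward.bOp, bDeriv_apply, ha.fderiv_eq h, ha x y h, h1]

/-- The variables separate. Operators in directions other than j see only the coefficient a. In
direction j, D_j - z differentiates P, while D_j - ζ with ζ ≠ z does not raise its degree. Here `d`
bounds the degree plus one, so `Q = 0` when z occurs at least `d` times in the list. -/
theorem bOps_mul_powLog {j : Fin n} (hj : j ∈ S) {B : Set (EuclideanSpace ℝ (Fin n))}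
    (hB : IsOpen B) (hpos : ∀ x ∈ B, 0 < x j) (z : ℂ) (L : List (Fin n × ℂ))
    {a : EuclideanSpace ℝ (Fin n) → ℂ} (ha : ContDiffOn ℝ ∞ a B) (hj' : IndepOf j a)
    (P : ℂ[X]) (d : ℕ) (hP : ∀ k, d ≤ k → P.coeff k = 0) :
    ∃ Q : ℂ[X], (∀ k, d - L.count (j, z) ≤ k → Q.coeff k = 0) ∧
      EqOn (bOps S L fun x => a x * powLog z P (x j)) (fun x =>
        bOps (S.erase j) (L.filter fun q => q.1 ≠ j) a x * powLog z Q (x j)) B := by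
  induction L generalizing a P d with
  | nil => exact ⟨P, by simpa using hP, fun _ _ => rfl⟩
  | cons q L ih =>
    obtain ⟨i, ζ⟩ := q
    have hpl : ContDiffOn ℝ ∞ (fun x : EuclideanSpace ℝ (Fin n) => powLog z P (x j)) B :=
      (contDiffOn_powLog z P).comp (contDiff_coord j).contDiffOn hpos
    rcases eq_or_ne i j with rfl | hij
    · obtain ⟨Q, hQ, hQ'⟩ := ih ha hj' (C (z - ζ) * P + derivative P)
        (if ζ = z then d - 1 else d) (by
          intro k hk
          split_ifs at hk with h
          · subst h
            have := hP (k + 1) (by omega)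
            simp [coeff_derivative, this]
          · rw [coeff_add, coeff_C_mul, coeff_derivative, hP k hk, hP (k + 1) (by omega)]
            simp)
      refine ⟨Q, fun k hk => hQ k ?_, ?_⟩
      · rw [List.count_cons] at hk
        by_cases h : ζ = z
        · simp [h] at hk ⊢; omega
        · simpa [h] using hk
      · rw [List.filter_cons_of_neg (by simp)]
        refine (bOps_congr hB ?_ L).trans hQ'
        intro x hx
        have h1 := bDeriv_mul (S := S) hB ha hpl i hx
        have hd := hasDerivAt_powLog z P (hpos x hx)
        have h2 := bDeriv_comp_coord (S := S) i hd.differentiableAt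
        have h3 : bDeriv S i a x = 0 := by rw [bDeriv_apply, hj'.fderiv_single, mul_zero]
        have hx0 : ((x i : ℝ) : ℂ) ≠ 0 := by exact_mod_cast (hpos x hx).ne'
        have h5 : bDeriv S i (fun x => a x * powLog z P (x i)) x - ζ * (a x * powLog z P (x i))
            = a x * powLog z (C (z - ζ) * P + derivative P) (x i) := by
          rw [h1]
          simp only []
          rw [h2, h3, hd.deriv, if_pos rfl]
          simp only [bCoef, hj, if_true, powLog, eval_add, eval_mul, eval_C]
          field_simp
          ring
        exact h5
    · obtain ⟨Q, hQ, hQ'⟩ := ih (a := bOp (S.erase j) (i, ζ) a)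
        (contDiffOn_bOp hB ha _) (hj'.bOp hij) P d hP
      refine ⟨Q, fun k hk => hQ k ?_, ?_⟩
      · rw [List.count_cons] at hk
        simpa [hij] using hk
      · rw [List.filter_cons_of_pos (by simpa using hij)]
        refine (bOps_congr hB ?_ L).trans hQ'
        intro x hx
        have h1 := bDeriv_mul (S := S) hB ha hpl i hx
        have hd := hasDerivAt_powLog z P (hpos x hx)
        have h2 := bDeriv_comp_coord (S := S) i hd.differentiableAt
        have h3 : bDeriv S i a x = bDeriv (S.erase j) i a x := by
          simp [bDeriv, hij]
        have h5 : bDeriv S i (fun x => a x * powLog z P (x j)) x - ζ * (a x * powLog z P (x j))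
            = (bDeriv (S.erase j) i a x - ζ * a x) * powLog z P (x j) := by
          rw [h1]
          simp only []
          rw [h2, h3, if_neg hij]
          ring
        exact h5

theorem partialExpansion_eq_sum {j : Fin n} {a : ℂ × ℕ → EuclideanSpace ℝ (Fin n) → ℂ} {N : ℝ}
    (F : Finset (ℂ × ℕ)) (hF : ∀ q ∈ F, q.1.re ≤ N) (h : ∀ q, q.1.re ≤ N → q ∉ F → a q = 0)
    (x : EuclideanSpace ℝ (Fin n)) :
    partialExpansion j a N x = ∑ q ∈ F, a q x * powLog q.1 (X ^ q.2) (x j) := by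
  have h1 := finsum_mem_eq_sum_of_inter_support_eq
    (fun q : ℂ × ℕ => a q x * ((x j : ℝ) : ℂ) ^ q.1 * ((Real.log (x j) : ℝ) : ℂ) ^ q.2)
    (s := {q | q.1.re ≤ N}) (t := F) (by
      ext q
      simp only [mem_inter_iff, mem_ofPred_eq, Function.mem_support, Finset.mem_coe]
      refine ⟨fun hq => ⟨?_, hq.2⟩, fun hq => ⟨hF q hq.1, hq.2⟩⟩
      by_contra h2
      exact hq.2 (by simp [h q hq.1 h2]))
  refine h1.trans (Finset.sum_congr rfl fun q _ => ?_)
  rw [powLog_X_pow]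
  ring

theorem weight_erase {j : Fin n} (hj : j ∈ S) (m : Fin n → ℝ) (x : EuclideanSpace ℝ (Fin n)) :
    weight S m x = x j ^ m j * weight (S.erase j) m x :=
  (Finset.mul_prod_erase S (fun i => x i ^ m i) hj).symm

/-- Induction on the number of boundary coordinates, the box being divided according to which
boundary coordinate is smallest. Where this is x_j, the expansion at x_j = 0 is used: the losses
x_i^(-M) in the remainder are at most powers of x_j, absorbed by a large N. In each of the finitely
many terms the operators in direction j act on the power of x_j and the others on the coefficient,
for which the induction hypothesis holds. -/
theorem IsNiceLocal.bound (h𝓔 : ∀ j ∈ S, ∀ N : ℝ, {q ∈ 𝓔 j | q.1.re < N}.Finite)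
    (hc : ∀ j ∈ S, c j = 0) (hε : ε' < ε) (hε1 : ε' ≤ 1) (hu : IsNiceLocal 𝓔 c ε S u)
    (m : Fin n → ℝ) (L : List (Fin n × ℂ))
    (hL : ∀ j ∈ S, ∀ q ∈ 𝓔 j, q.1.re ≤ m j → q.2 < L.count (j, q.1)) :
    ∃ K : ℝ, ∀ x ∈ cornerBox S c ε', ‖bOps S L u x‖ ≤ K * weight S m x := by
  classical
  obtain ⟨k, hk⟩ : ∃ k, S.card = k := ⟨_, rfl⟩
  induction k generalizing S u L with
  | zero =>
    rw [Finset.card_eq_zero] at hk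
    subst hk
    rw [IsNiceLocal] at hu
    have h1 := contDiffOn_bOps (S := ∅) isOpen_cornerBox hu.1 L
    -- Without boundary coordinates, shrinking the box makes its closure a compact subset of the
    -- domain.
    have h2 : closedCornerBox ∅ c ε' ⊆ cornerBox ∅ c ε :=
      fun x hx i => ⟨(hx i).1.trans_lt hε, fun h => absurd h (Finset.notMem_empty i)⟩
    obtain ⟨K, hK⟩ := (isCompact_closedCornerBox (S := ∅) (c := c) (ε := ε')).exists_bound_of_continuousOn
      (h1.continuousOn.mono h2)
    exact ⟨K, fun x hx => by simpa [weight] using hK x (cornerBox_subset_closed hx)⟩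
  | succ k ih =>
    have hne : S.Nonempty := Finset.card_pos.1 (by omega)
    have hsub : cornerBox S c ε' ⊆ cornerBox S c ε := cornerBox_mono subset_rfl hε.le
    have hx0 := cornerBox_pos (S := S) (c := c) (ε := ε')
    have hx1 : ∀ x ∈ cornerBox S c ε', ∀ j ∈ S, x j ≤ 1 :=
      fun x hx j hj => (cornerBox_lt hc x hx j hj).le.trans hε1
    -- the estimate where the `j`-th coordinate is the smallest one
    have main : ∀ j ∈ S, ∃ K : ℝ, 0 ≤ K ∧ ∀ x ∈ cornerBox S c ε', (∀ i ∈ S, x j ≤ x i) →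
        ‖bOps S L u x‖ ≤ K * weight S m x := by
      intro j hj
      rw [IsNiceLocal] at hu
      obtain ⟨hus, hu⟩ := hu
      obtain ⟨a, ha0, haI, haN, M, hM⟩ := hu j hj
      -- The first summand pays for the factors x_i^(-M), the second for the comparison of a power
      -- of x_j with the weight.
      set N : ℝ := (S.erase j).card * |M| + ∑ i ∈ S, |m i| with hN
      have hfin : {q ∈ 𝓔 j | q.1.re ≤ N}.Finite :=
        (h𝓔 j hj (N + 1)).subset fun q hq => ⟨hq.1, by linarith [hq.2]⟩
      set F : Finset (ℂ × ℕ) := hfin.toFinset with hFdef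
      have hFmem : ∀ q, q ∈ F ↔ q ∈ 𝓔 j ∧ q.1.re ≤ N := fun q => by simp [hFdef]
      have hpe : partialExpansion j a N = fun x => ∑ q ∈ F, a q x * powLog q.1 (X ^ q.2) (x j) :=
        funext fun x => partialExpansion_eq_sum F (fun q hq => ((hFmem q).1 hq).2)
          (fun q hq hqF => ha0 q fun h => hqF ((hFmem q).2 ⟨h, hq⟩)) x
      have haC : ∀ q, ContDiffOn ℝ ∞ (a q) (cornerBox S c ε) := fun q => by
        have := haN q
        rw [IsNiceLocal] at this
        exact this.1.mono (cornerBox_mono (Finset.erase_subset _ _) le_rfl)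
      have hplC : ∀ q : ℂ × ℕ, ContDiffOn ℝ ∞
          (fun x : EuclideanSpace ℝ (Fin n) => powLog q.1 (X ^ q.2) (x j)) (cornerBox S c ε) :=
        fun q => (contDiffOn_powLog _ _).comp (contDiff_coord j).contDiffOn
          fun x hx => cornerBox_pos x hx j hj
      -- the remainder
      have hR : IsSymbol S (cornerBox S c ε)
          (fun x => x j ^ N * ∏ i ∈ S.erase j, x i ^ (-M)) (u - partialExpansion j a N) := by
        refine ⟨?_, fun l => ?_⟩
        · rw [hpe]
          exact hus.sub (ContDiffOn.sum fun q _ => (haC q).mul (hplC q))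
        · obtain ⟨K, hK⟩ := hM N l
          exact ⟨K, fun x hx => by rw [← mul_assoc]; exact hK x hx⟩
      obtain ⟨K0, hK0⟩ := (hR.bOps isOpen_cornerBox L).bound []
      -- the terms of the expansion
      have hT : ∀ q ∈ F, ∃ K : ℝ, ∀ x ∈ cornerBox S c ε',
          ‖bOps S L (fun x => a q x * powLog q.1 (X ^ q.2) (x j)) x‖ ≤ K * weight S m x := by
        intro q hq
        obtain ⟨hqE, hqN⟩ := (hFmem q).1 hq
        obtain ⟨Q, hQ, hQe⟩ := bOps_mul_powLog hj (isOpen_cornerBox (S := S) (c := c) (ε := ε))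
          (fun x hx => cornerBox_pos x hx j hj) q.1 L (haC q) (haI q) (X ^ q.2) (q.2 + 1)
          (fun k hk => by rw [coeff_X_pow, if_neg (by omega)])
        -- For Re z ≤ m_j the list contains enough operators to annihilate the term; otherwise t^z
        -- times any polynomial in log t is O(t^(m_j)).
        obtain ⟨K1, hK1⟩ : ∃ K : ℝ, ∀ t ∈ Ioc (0 : ℝ) 1, ‖powLog q.1 Q t‖ ≤ K * t ^ m j := by
          rcases le_or_gt q.1.re (m j) with h | h
          · have h1 := hL j hj q hqE h
            have h2 : Q = 0 := by
              ext k
              exact hQ k (by omega)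
            exact ⟨0, fun t _ => by simp [h2, powLog]⟩
          · exact powLog_bound _ _ h
        obtain ⟨K2, hK2⟩ := ih (S := S.erase j) (u := a q)
          (L := L.filter fun q => q.1 ≠ j)
          (fun i hi => h𝓔 i (Finset.mem_of_mem_erase hi))
          (fun i hi => hc i (Finset.mem_of_mem_erase hi)) (haN q) (fun i hi q hq hqm => by
            rw [List.count_filter (by simpa using Finset.ne_of_mem_erase hi)]
            exact hL i (Finset.mem_of_mem_erase hi) q hq hqm)
          (by rw [Finset.card_erase_of_mem hj, hk]; rfl)
        refine ⟨K2 * K1, fun x hx => ?_⟩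
        have h3 := hK2 x (cornerBox_mono (Finset.erase_subset _ _) le_rfl hx)
        have h4 := hK1 (x j) ⟨hx0 x hx j hj, hx1 x hx j hj⟩
        rw [hQe (hsub hx), norm_mul, weight_erase hj]
        calc _ ≤ (K2 * weight (S.erase j) m x) * (K1 * x j ^ m j) :=
              mul_le_mul h3 h4 (norm_nonneg _) ((norm_nonneg _).trans h3)
          _ = _ := by ring
      choose! KT hKT using hT
      refine ⟨|K0| + ∑ q ∈ F, |KT q|, by positivity, fun x hx hmin => ?_⟩
      have hw : 0 ≤ weight S m x := weight_nonneg hx0 m x hx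
      have hxj := hx0 x hx j hj
      have hxj1 := hx1 x hx j hj
      have hsplit : bOps S L u x = bOps S L (u - partialExpansion j a N) x +
          ∑ q ∈ F, bOps S L (fun x => a q x * powLog q.1 (X ^ q.2) (x j)) x := by
        have hsum : ∀ T : Finset (ℂ × ℕ), EqOn
            (bOps S L fun x => ∑ q ∈ T, a q x * powLog q.1 (X ^ q.2) (x j))
            (fun x => ∑ q ∈ T, bOps S L (fun x => a q x * powLog q.1 (X ^ q.2) (x j)) x)
            (cornerBox S c ε) := by
          intro T
          induction T using Finset.induction_on with
          | empty =>
            intro y hy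
            have := bOps_const_mul (S := S) isOpen_cornerBox (u := fun _ => 0) contDiffOn_const 0 L hy
            simpa using this
          | insert q T hq ihT =>
            simp only [Finset.sum_insert hq]
            refine (bOps_add isOpen_cornerBox ((haC q).mul (hplC q))
              (ContDiffOn.sum fun q _ => (haC q).mul (hplC q)) L).trans fun y hy => ?_
            simp only [ihT hy]
        have e1 := hsum F (hsub hx)
        have e2 := bOps_add (S := S) isOpen_cornerBox hR.contDiffOn
          (ContDiffOn.sum fun q (_ : q ∈ F) => (haC q).mul (hplC q)) L (hsub hx)
        simp only [] at e1 e2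
        rw [← e1, ← e2]
        refine bOps_congr isOpen_cornerBox (fun y _ => ?_) L (hsub hx)
        simp [hpe]
      have hrem : x j ^ N * ∏ i ∈ S.erase j, x i ^ (-M) ≤ weight S m x := by
        have h1 : ∏ i ∈ S.erase j, x i ^ (-M) ≤ ∏ _i ∈ S.erase j, x j ^ (-|M|) := by
          refine Finset.prod_le_prod (fun i hi => ?_) fun i hi => ?_
          · exact Real.rpow_nonneg (hx0 x hx i (Finset.mem_of_mem_erase hi)).le _
          · have hi' := Finset.mem_of_mem_erase hi
            calc x i ^ (-M) ≤ x i ^ (-|M|) :=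
                  Real.rpow_le_rpow_of_exponent_ge (hx0 x hx i hi') (hx1 x hx i hi')
                    (neg_le_neg (le_abs_self M))
              _ ≤ x j ^ (-|M|) := Real.rpow_le_rpow_of_nonpos hxj (hmin i hi')
                    (neg_nonpos.2 (abs_nonneg M))
        have h2 : x j ^ (∑ i ∈ S, |m i|) ≤ weight S m x := by
          rw [Real.rpow_sum_of_pos hxj]
          refine Finset.prod_le_prod (fun i _ => Real.rpow_nonneg hxj.le _) fun i hi => ?_
          calc x j ^ |m i| ≤ x i ^ |m i| :=
                Real.rpow_le_rpow hxj.le (hmin i hi) (abs_nonneg _)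
            _ ≤ x i ^ m i := Real.rpow_le_rpow_of_exponent_ge (hx0 x hx i hi) (hx1 x hx i hi)
                    (le_abs_self _)
        calc _ ≤ x j ^ N * ∏ _i ∈ S.erase j, x j ^ (-|M|) :=
              mul_le_mul_of_nonneg_left h1 (Real.rpow_nonneg hxj.le _)
          _ = x j ^ (∑ i ∈ S, |m i|) := by
              rw [Finset.prod_const, ← Real.rpow_natCast, ← Real.rpow_mul hxj.le,
                ← Real.rpow_add hxj, hN]
              congr 1; ring
          _ ≤ _ := h2
      rw [hsplit, add_mul, Finset.sum_mul]
      refine (norm_add_le _ _).trans (add_le_add ?_ ((norm_sum_le _ _).trans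
        (Finset.sum_le_sum fun q hq => ?_)))
      · have h3 := hK0 x (hsub hx)
        have h4 : 0 ≤ x j ^ N * ∏ i ∈ S.erase j, x i ^ (-M) :=
          mul_nonneg (Real.rpow_nonneg hxj.le _) (Finset.prod_nonneg fun i hi =>
            Real.rpow_nonneg (hx0 x hx i (Finset.mem_of_mem_erase hi)).le _)
        calc _ ≤ K0 * (x j ^ N * ∏ i ∈ S.erase j, x i ^ (-M)) := h3
          _ ≤ |K0| * (x j ^ N * ∏ i ∈ S.erase j, x i ^ (-M)) :=
            mul_le_mul_of_nonneg_right (le_abs_self _) h4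
          _ ≤ _ := mul_le_mul_of_nonneg_left hrem (abs_nonneg _)
      · exact (hKT q hq x hx).trans (mul_le_mul_of_nonneg_right (le_abs_self _) hw)
    choose! K hK0 hK using main
    refine ⟨∑ j ∈ S, K j, fun x hx => ?_⟩
    obtain ⟨j, hj, hmin⟩ := S.exists_min_image (fun i => x i) hne
    exact (hK j hj x hx hmin).trans (mul_le_mul_of_nonneg_right
      (Finset.single_le_sum (fun i hi => hK0 i hi) hj) (weight_nonneg hx0 m x hx))

/-- The number of logarithmic powers that accompany the exponent `z` in an index set. -/
def logMult (E : Set (ℂ × ℕ)) (z : ℂ) : ℕ := {p : ℕ | (z, p) ∈ E}.ncard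

/-- The logarithmic exponents at z form a finite initial segment of ℕ, which its cardinality
determines. -/
theorem IsIndexSet.mem_iff_lt_logMult {E : Set (ℂ × ℕ)} (hE : IsIndexSet E) (z : ℂ) (p : ℕ) :
    (z, p) ∈ E ↔ p < logMult E z := by
  have hfin : {p : ℕ | (z, p) ∈ E}.Finite := by
    refine ((hE.finite_left (z.re + 1)).image Prod.snd).subset fun p hp => ⟨(z, p), ⟨hp, ?_⟩, rfl⟩
    simp
  obtain ⟨k, hk⟩ : ∃ k, {p : ℕ | (z, p) ∈ E} = Iio k := by
    rcases {p : ℕ | (z, p) ∈ E}.eq_empty_or_nonempty with h | h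
    · exact ⟨0, by rw [h]; ext; simp⟩
    · obtain ⟨b, hb, hmax⟩ := hfin.exists_maximalFor id _ h
      refine ⟨b + 1, ?_⟩
      ext p
      constructor
      · intro hp
        have := hmax hp
        simp only [id] at this
        simp only [mem_Iio]
        by_contra h2
        have := this (by omega)
        omega
      · intro hp
        exact hE.lower z b p hb (Nat.lt_succ_iff.1 hp)
  have h1 : logMult E z = k := by
    rw [logMult, hk, ← Nat.card_coe_set_eq]
    simp
  rw [h1]
  exact Set.ext_iff.1 hk p

theorem IsNiceLocal.isPhg (h𝓔 : ∀ j ∈ S, IsIndexSet (𝓔 j)) (hc : ∀ j ∈ S, c j = 0)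
    (hε : ε' < ε) (hε1 : ε' ≤ 1) (hu : IsNiceLocal 𝓔 c ε S u) :
    IsPhg S (cornerBox S c ε') (fun j => logMult (𝓔 j)) u := by
  refine ⟨?_, fun m L hL => ?_⟩
  · rw [IsNiceLocal] at hu
    exact hu.1.mono (cornerBox_mono subset_rfl hε.le)
  · refine hu.bound (fun j hj N => (h𝓔 j hj).finite_left N) hc hε hε1 m L
      fun j hj q hq hqm => ?_
    exact (((h𝓔 j hj).mem_iff_lt_logMult q.1 q.2).1 hq).trans_le (hL j hj q.1 hqm)

theorem IsIndexSet.logMult_shift {E : Set (ℂ × ℕ)} (hE : IsIndexSet E) (z : ℂ) :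
    logMult E z ≤ logMult E (z + 1) := by
  by_contra h
  have h1 := (hE.mem_iff_lt_logMult z _).2 (not_le.1 h)
  exact lt_irrefl _ ((hE.mem_iff_lt_logMult (z + 1) _).1 (hE.shift _ _ h1))

theorem IsIndexSet.logMult_finite {E : Set (ℂ × ℕ)} (hE : IsIndexSet E) (N : ℝ) :
    {z | logMult E z ≠ 0 ∧ z.re ≤ N}.Finite := by
  refine ((hE.finite_left (N + 1)).image Prod.fst).subset fun z hz => ⟨(z, 0), ⟨?_, ?_⟩, rfl⟩
  · exact (hE.mem_iff_lt_logMult z 0).2 (Nat.pos_of_ne_zero hz.1)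
  · have := hz.2
    simp only []
    linarith

end Nice

/-! ### Integration by parts with respect to the b-measure -/

section IntegrationByParts

variable {n : ℕ} {S : Finset (Fin n)} {c : EuclideanSpace ℝ (Fin n)} {ε r : ℝ}
  {m : Fin n → ℝ}

/-- The density `∏_{j ∈ S} (x j)⁻¹` of the b-measure. -/
def bInv (S : Finset (Fin n)) (x : EuclideanSpace ℝ (Fin n)) : ℂ :=
  ∏ j ∈ S, ((x j : ℝ) : ℂ)⁻¹

theorem continuousOn_bInv : ContinuousOn (bInv S) (cornerBox S c ε) := by
  refine continuousOn_finsetProd _ fun j hj => ?_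
  refine ContinuousOn.inv₀ (contDiff_coordC j).continuous.continuousOn fun x hx => ?_
  exact_mod_cast (cornerBox_pos x hx j hj).ne'

theorem norm_bInv : ∀ x ∈ cornerBox S c ε, ‖bInv S x‖ = weight S (fun _ => -1) x := by
  intro x hx
  simp only [bInv, weight, norm_prod, norm_inv, Complex.norm_real]
  refine Finset.prod_congr rfl fun j hj => ?_
  rw [Real.rpow_neg_one, Real.norm_of_nonneg (cornerBox_pos x hx j hj).le]

theorem measurableSet_cornerBox : MeasurableSet (cornerBox S c ε) :=
  isOpen_cornerBox.measurableSet

theorem integrableOn_weight (hε : 0 < ε) (hc : ∀ j ∈ S, c j = 0) (hm : ∀ j ∈ S, -1 < m j) :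
    IntegrableOn (weight S m) (cornerBox S c ε) := by
  classical
  -- On the box the weight is a product of functions of one variable, each integrable by itself.
  set φ : Fin n → ℝ → ℝ := fun i => if i ∈ S then (Ioo 0 ε).indicator fun t => t ^ m i
    else (Ioo (c i - ε) (c i + ε)).indicator fun _ => 1 with hφ
  have h1 : ∀ i, Integrable (φ i) := by
    intro i
    simp only [hφ]
    split_ifs with hi
    · rw [integrable_indicator_iff measurableSet_Ioo,
        intervalIntegral.integrableOn_Ioo_rpow_iff hε]
      exact hm i hi
    · rw [integrable_indicator_iff measurableSet_Ioo]
      exact integrableOn_const (by simp)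
  have h2 : Integrable (fun x : Fin n → ℝ => ∏ i, φ i (x i)) := Integrable.fintype_prod h1
  have h3 : Integrable (fun x : EuclideanSpace ℝ (Fin n) => ∏ i, φ i (x i)) :=
    (PiLp.volume_preserving_ofLp (Fin n)).integrable_comp_of_integrable h2
  refine (integrableOn_congr_fun ?_ measurableSet_cornerBox).1 h3.integrableOn
  intro x hx
  have h4 : ∀ i, φ i (x i) = if i ∈ S then x i ^ m i else 1 := by
    intro i
    simp only [hφ]
    split_ifs with hi
    · exact indicator_of_mem (show x i ∈ Ioo 0 ε from
        ⟨cornerBox_pos x hx i hi, cornerBox_lt hc x hx i hi⟩) _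
    · have := abs_lt.1 (hx i).1
      exact indicator_of_mem (show x i ∈ Ioo (c i - ε) (c i + ε) from
        ⟨by linarith [this.1], by linarith [this.2]⟩) _
  simp only [h4, weight]
  rw [Finset.prod_ite_mem]
  simp

theorem integrableOn_mul_bInv (hε : 0 < ε) (hc : ∀ j ∈ S, c j = 0) (hm : ∀ j ∈ S, 0 < m j)
    {g : EuclideanSpace ℝ (Fin n) → ℂ} (hg : ContinuousOn g (cornerBox S c ε)) {K : ℝ}
    (hK : ∀ x ∈ cornerBox S c ε, ‖g x‖ ≤ K * weight S m x) :
    IntegrableOn (fun x => g x * bInv S x) (cornerBox S c ε) := by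
  have h1 := (integrableOn_weight hε hc (m := fun j => m j + -1)
    (fun j hj => by linarith [hm j hj])).const_mul K
  refine Integrable.mono' h1 ((hg.mul continuousOn_bInv).aestronglyMeasurable
    measurableSet_cornerBox) ?_
  refine (ae_restrict_iff' measurableSet_cornerBox).2 (Eventually.of_forall fun x hx => ?_)
  rw [norm_mul, norm_bInv x hx, weight_add cornerBox_pos _ _ x hx, ← mul_assoc]
  exact mul_le_mul_of_nonneg_right (hK x hx) (weight_nonneg cornerBox_pos _ x hx)

/-- Integration by parts: the integral of a `b`-derivative with respect to the b-measure vanishes. -/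
theorem integral_bDeriv_eq_zero (hε : 0 < ε) (hc : ∀ j ∈ S, c j = 0) (hm : ∀ j ∈ S, 0 < m j)
    (hr : r < ε) {i : Fin n} (hi : i ∈ S → 2 ≤ m i) {h : EuclideanSpace ℝ (Fin n) → ℂ}
    (hd : ContDiffOn ℝ 1 h (cornerBox S c ε)) {K K' : ℝ}
    (hK : ∀ x ∈ cornerBox S c ε, ‖h x‖ ≤ K * weight S m x)
    (hK' : ∀ x ∈ cornerBox S c ε, ‖bDeriv S i h x‖ ≤ K' * weight S m x)
    (hsupp : ∀ x ∈ cornerBox S c ε, (∃ i, r < |x i - c i|) → h x = 0) :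
    ∫ x in cornerBox S c ε, bDeriv S i h x * bInv S x = 0 := by
  classical
  set B := cornerBox S c ε with hBdef
  have hB : IsOpen B := isOpen_cornerBox
  have hpos : ∀ x ∈ B, ∀ j ∈ S, 0 < x j := cornerBox_pos
  -- The coefficient of D_i cancels the factor x_i⁻¹ of the b-measure. What remains does not depend
  -- on x_i, so the integrand is an ordinary partial derivative.
  have hinv : ∀ x ∈ B, bCoef S i x * bInv S x = bInv (S.erase i) x := by
    intro x hx
    by_cases his : i ∈ S
    · simp only [bCoef, his, if_true, bInv]
      rw [← Finset.mul_prod_erase S _ his, ← mul_assoc, mul_inv_cancel₀, one_mul]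
      exact Complex.ofReal_ne_zero.2 (hpos x hx i his).ne'
    · simp [bCoef, his]
  have hdC : ContinuousOn (fun x => fderiv ℝ h x (EuclideanSpace.single i 1)) B :=
    (hd.continuousOn_fderiv_of_isOpen hB le_rfl).clm_apply continuousOn_const
  have hbC : ContinuousOn (bDeriv S i h) B := (contDiff_bCoef i).continuous.continuousOn.mul hdC
  have hI' : IntegrableOn (fun x => bDeriv S i h x * bInv S x) B :=
    integrableOn_mul_bInv hε hc hm hbC hK'
  set F : EuclideanSpace ℝ (Fin n) → ℂ := B.indicator fun x => h x * bInv (S.erase i) x with hF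
  set F' : EuclideanSpace ℝ (Fin n) → ℂ := B.indicator fun x => bDeriv S i h x * bInv S x with hF'
  have hFi : Integrable F := by
    rw [hF, integrable_indicator_iff hB.measurableSet]
    have h1 : IntegrableOn (fun x => (bCoef S i x * h x) * bInv S x) B := by
      refine integrableOn_mul_bInv (K := (‖c‖ + ε + 1) * K) hε hc hm
        ((contDiff_bCoef i).continuous.continuousOn.mul hd.continuousOn) fun x hx => ?_
      rw [norm_mul, mul_assoc]
      have h2 : ‖bCoef S i x‖ ≤ ‖c‖ + ε + 1 := by
        have := cornerBox_bdd x hx i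
        unfold bCoef
        split_ifs
        · rw [Complex.norm_real, Real.norm_eq_abs]; linarith
        · rw [norm_one]; linarith [norm_nonneg c]
      exact mul_le_mul h2 (hK x hx) (norm_nonneg _) ((norm_nonneg _).trans h2)
    refine (integrableOn_congr_fun ?_ hB.measurableSet).1 h1
    intro x hx
    simp only []
    rw [← hinv x hx]; ring
  have hF'i : Integrable F' := by
    rw [hF', integrable_indicator_iff hB.measurableSet]
    exact hI'
  have hline : ∀ (x : EuclideanSpace ℝ (Fin n)) (t : ℝ) (k : Fin n), k ≠ i →
      (x + t • EuclideanSpace.single i (1 : ℝ)) k = x k := by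
    intro x t k hk; simp [hk]
  have hlinei : ∀ (x : EuclideanSpace ℝ (Fin n)) (t : ℝ),
      (x + t • EuclideanSpace.single i (1 : ℝ)) i = x i + t := by
    intro x t; simp
  have hbl : ∀ (x : EuclideanSpace ℝ (Fin n)) (t : ℝ),
      bInv (S.erase i) (x + t • EuclideanSpace.single i (1 : ℝ)) = bInv (S.erase i) x := by
    intro x t
    exact Finset.prod_congr rfl fun k hk => by rw [hline x t k (Finset.ne_of_mem_erase hk)]
  have hcont : ∀ x : EuclideanSpace ℝ (Fin n),
      Continuous fun t : ℝ => x + t • EuclideanSpace.single i (1 : ℝ) := by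
    intro x; fun_prop
  -- The extension of the integrand by zero is differentiable along lines at every point. Outside
  -- the box there are three cases: another coordinate keeps the whole line outside; x_i lies beyond
  -- the outer boundary, near which h vanishes; or x_i ≤ 0, where the weight exponent m_i ≥ 2 makes
  -- the extension O(t²).
  have hderiv : ∀ x, HasLineDerivAt ℝ F (F' x) x (EuclideanSpace.single i 1) := by
    intro x
    unfold HasLineDerivAt
    have h00 : x + (0 : ℝ) • EuclideanSpace.single i (1 : ℝ) = x := by simp
    by_cases hx : x ∈ B
    · have hev : ∀ᶠ t : ℝ in 𝓝 0, x + t • EuclideanSpace.single i (1 : ℝ) ∈ B :=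
        (hcont x).continuousAt.eventually_mem (hB.mem_nhds (by rw [h00]; exact hx))
      have h1 : HasDerivAt (fun t : ℝ => h (x + t • EuclideanSpace.single i (1 : ℝ)))
          (fderiv ℝ h x (EuclideanSpace.single i 1)) 0 := by
        have h2 : HasFDerivAt h (fderiv ℝ h x) x :=
          ((hd.contDiffAt (hB.mem_nhds hx)).differentiableAt (by simp)).hasFDerivAt
        exact h2.hasLineDerivAt _
      have h3 := h1.mul_const (bInv (S.erase i) x)
      have h4 : F' x = fderiv ℝ h x (EuclideanSpace.single i 1) * bInv (S.erase i) x := by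
        rw [hF', indicator_of_mem hx, ← hinv x hx, bDeriv_apply]; ring
      rw [h4]
      refine h3.congr_of_eventuallyEq ?_
      filter_upwards [hev] with t ht
      rw [hF, indicator_of_mem ht, hbl]
    · have hF'0 : F' x = 0 := by rw [hF', indicator_of_notMem hx]
      rw [hF'0]
      by_cases hk : ∃ k, k ≠ i ∧ ¬(|x k - c k| < ε ∧ (k ∈ S → 0 < x k))
      · obtain ⟨k, hki, hk⟩ := hk
        have : (fun t : ℝ => F (x + t • EuclideanSpace.single i (1 : ℝ))) = fun _ => 0 := by
          ext t
          rw [hF, indicator_of_notMem]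
          intro h
          have := h k
          rw [hline x t k hki] at this
          exact hk this
        rw [this]
        exact hasDerivAt_const _ _
      · push Not at hk
        by_cases hxi : ε ≤ |x i - c i|
        · have hev : ∀ᶠ t : ℝ in 𝓝 0, r < |x i + t - c i| := by
            have : Continuous fun t : ℝ => |x i + t - c i| := by fun_prop
            refine this.continuousAt.eventually (lt_mem_nhds ?_)
            simp only [add_zero]; linarith
          refine (hasDerivAt_const (0 : ℝ) (0 : ℂ)).congr_of_eventuallyEq ?_
          filter_upwards [hev] with t ht
          by_cases hmem : x + t • EuclideanSpace.single i (1 : ℝ) ∈ B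
          · rw [hF, indicator_of_mem hmem, hsupp _ hmem ⟨i, by rw [hlinei]; exact ht⟩, zero_mul]
          · rw [hF, indicator_of_notMem hmem]
        · push Not at hxi
          have hiS : i ∈ S ∧ x i ≤ 0 := by
            by_contra hcon
            apply hx
            intro k
            rcases eq_or_ne k i with rfl | hki
            · exact ⟨hxi, fun hkS => by
                by_contra h0; exact hcon ⟨hkS, not_lt.1 h0⟩⟩
            · exact hk k hki
          have hbig : (fun t : ℝ => F (x + t • EuclideanSpace.single i (1 : ℝ))) =O[𝓝 0]
              fun t => ‖t - 0‖ ^ 2 := by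
            set D : ℝ := |K| * weight (S.erase i) m x * ‖bInv (S.erase i) x‖
            refine Asymptotics.IsBigO.of_bound |D| ?_
            filter_upwards [Metric.ball_mem_nhds (0 : ℝ) one_pos] with t ht
            rw [Metric.mem_ball, dist_zero_right, Real.norm_eq_abs] at ht
            by_cases hmem : x + t • EuclideanSpace.single i (1 : ℝ) ∈ B
            · have ht0 : 0 < x i + t := by
                rw [← hlinei x t]; exact hpos _ hmem i hiS.1
              have ht1 : x i + t ≤ t := by linarith [hiS.2]
              have ht2 : 0 < t := ht0.trans_le ht1
              have h5 : weight S m (x + t • EuclideanSpace.single i (1 : ℝ)) =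
                  (x i + t) ^ m i * weight (S.erase i) m x := by
                rw [weight_erase hiS.1, hlinei]
                congr 1
                exact Finset.prod_congr rfl fun k hk => by
                  rw [hline x t k (Finset.ne_of_mem_erase hk)]
              have h6 : (x i + t) ^ m i ≤ t ^ 2 := by
                calc (x i + t) ^ m i ≤ t ^ m i := Real.rpow_le_rpow ht0.le ht1 (hm i hiS.1).le
                  _ ≤ t ^ (2 : ℝ) := Real.rpow_le_rpow_of_exponent_ge ht2 (abs_lt.1 ht).2.le
                        (hi hiS.1)
                  _ = t ^ 2 := Real.rpow_two t
              have h7 : 0 ≤ weight (S.erase i) m x := Finset.prod_nonneg fun k hkS =>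
                Real.rpow_nonneg ((hk k (Finset.ne_of_mem_erase hkS)).2
                  (Finset.mem_of_mem_erase hkS)).le _
              rw [hF, indicator_of_mem hmem, hbl, norm_mul, sub_zero, norm_pow, norm_norm,
                Real.norm_eq_abs, sq_abs]
              calc ‖h (x + t • EuclideanSpace.single i (1 : ℝ))‖ * ‖bInv (S.erase i) x‖
                  ≤ (|K| * ((x i + t) ^ m i * weight (S.erase i) m x)) * ‖bInv (S.erase i) x‖ := by
                    refine mul_le_mul_of_nonneg_right ?_ (norm_nonneg _)
                    rw [← h5]
                    exact (hK _ hmem).trans (mul_le_mul_of_nonneg_right (le_abs_self K)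
                      (weight_nonneg hpos _ _ hmem))
                _ = D * (x i + t) ^ m i := by simp only [D]; ring
                _ ≤ |D| * t ^ 2 := mul_le_mul (le_abs_self D) h6
                      (Real.rpow_nonneg ht0.le _) (abs_nonneg _)
            · rw [hF, indicator_of_notMem hmem, norm_zero]
              positivity
          have := (hbig.hasFDerivAt (𝕜 := ℝ) one_lt_two).hasDerivAt
          simpa using this
  -- Integration by parts on the whole space against the constant function 1.
  have key := integral_bilinear_hasLineDerivAt_right_eq_neg_left_of_integrable
    (μ := volume) (f := F) (f' := F') (g := fun _ => (1 : ℂ)) (g' := fun _ => (0 : ℂ))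
    (v := EuclideanSpace.single i (1 : ℝ)) (B := ContinuousLinearMap.mul ℝ ℂ)
    (by simpa using hF'i) (by simp) (by simpa using hFi)
    (fun x _ => hderiv x) (fun x _ => by
      unfold HasLineDerivAt; exact hasDerivAt_const _ _)
  simp only [ContinuousLinearMap.mul_apply', mul_zero, integral_zero, mul_one] at key
  rw [← integral_indicator hB.measurableSet]
  exact neg_eq_zero.1 key.symm

end IntegrationByParts

/-! ### Push-forward of integrable b-densities in a corner box -/

section MeasureLemma

variable {X Y : Type*} [MeasurableSpace X] [MeasurableSpace Y] {μ : Measure X} {ν : Measure Y}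
  {f : X → ℝ} {f' : Y → ℝ} {h : X → ℂ} {h' : Y → ℂ} {a b : ℝ}

/-- The continuous functions min(1, k dist(t, Uᶜ)) increase to the indicator of U, and dominated
convergence applies. The complement has to be non-empty because `Metric.infDist` to the empty set is
0. -/
theorem tendsto_integral_cutoff (hf : Measurable f) (hh : IntegrableOn h (f ⁻¹' Ioo a b) μ)
    {U : Set ℝ} (hU : IsOpen U) (hUab : U ⊆ Ioo a b) (hne : Uᶜ.Nonempty) :
    Tendsto (fun k : ℕ => ∫ x, ((min 1 (k * Metric.infDist (f x) Uᶜ) : ℝ) : ℂ) * h x ∂μ) atTop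
      (𝓝 (∫ x in f ⁻¹' U, h x ∂μ)) := by
  have hmU : MeasurableSet (f ⁻¹' U) := hf hU.measurableSet
  have hmI : MeasurableSet (f ⁻¹' Ioo a b) := hf measurableSet_Ioo
  rw [← integral_indicator hmU]
  have h0 : ∀ (k : ℕ) (t : ℝ), 0 ≤ min 1 (k * Metric.infDist t Uᶜ) := fun k t =>
    le_min zero_le_one (mul_nonneg (Nat.cast_nonneg k) Metric.infDist_nonneg)
  have hz : ∀ (k : ℕ) (t : ℝ), t ∉ U → min 1 (k * Metric.infDist t Uᶜ) = 0 := fun k t ht => by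
    rw [Metric.infDist_zero_of_mem (show t ∈ Uᶜ from ht)]; simp
  have hψ : ∀ k : ℕ, Continuous fun t : ℝ => min 1 (k * Metric.infDist t Uᶜ) := fun k =>
    continuous_const.min (continuous_const.mul (Metric.continuous_infDist_pt _))
  have hsplit : ∀ k : ℕ, (fun x => ((min 1 (k * Metric.infDist (f x) Uᶜ) : ℝ) : ℂ) * h x) =
      fun x => ((min 1 (k * Metric.infDist (f x) Uᶜ) : ℝ) : ℂ) *
        (f ⁻¹' Ioo a b).indicator h x := by
    intro k
    ext x
    by_cases hx : x ∈ f ⁻¹' Ioo a b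
    · rw [indicator_of_mem hx]
    · rw [hz k (f x) fun hxU => hx (hUab hxU)]; simp
  simp only [hsplit]
  have hInt : Integrable ((f ⁻¹' Ioo a b).indicator h) μ := (integrable_indicator_iff hmI).2 hh
  refine tendsto_integral_of_dominated_convergence
    (fun x => ‖(f ⁻¹' Ioo a b).indicator h x‖) (fun k => ?_) hInt.norm (fun k => ?_) ?_
  · exact ((Complex.continuous_ofReal.comp (hψ k)).measurable.comp hf).aestronglyMeasurable.mul
      hInt.aestronglyMeasurable
  · refine Eventually.of_forall fun x => ?_
    rw [norm_mul, Complex.norm_real, Real.norm_of_nonneg (h0 k _)]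
    exact mul_le_of_le_one_left (norm_nonneg _) (min_le_left _ _)
  · refine Eventually.of_forall fun x => ?_
    by_cases hx : f x ∈ U
    · rw [indicator_of_mem (show x ∈ f ⁻¹' U from hx),
        indicator_of_mem (show x ∈ f ⁻¹' Ioo a b from hUab hx)]
      have hpos : 0 < Metric.infDist (f x) Uᶜ :=
        (hU.isClosed_compl.notMem_iff_infDist_pos hne).1 fun h => h hx
      obtain ⟨k0, hk0⟩ := exists_nat_gt (1 / Metric.infDist (f x) Uᶜ)
      refine tendsto_const_nhds.congr' ?_
      filter_upwards [eventually_ge_atTop k0] with k hk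
      have : 1 ≤ k * Metric.infDist (f x) Uᶜ := by
        rw [div_lt_iff₀ hpos] at hk0
        have : (k0 : ℝ) ≤ k := by exact_mod_cast hk
        nlinarith
      rw [min_eq_left this]; simp
    · rw [indicator_of_notMem (show x ∉ f ⁻¹' U from hx)]
      simp only [hz _ _ hx]
      simp

/-- Two push-forwards that agree on continuous functions agree on Borel sets. -/
theorem setIntegral_preimage_eq (hf : Measurable f) (hf' : Measurable f')
    (hh : IntegrableOn h (f ⁻¹' Ioo a b) μ) (hh' : IntegrableOn h' (f' ⁻¹' Ioo a b) ν)
    (H : ∀ ψ : ℝ → ℝ, Continuous ψ → (∀ t, t ∉ Ioo a b → ψ t = 0) →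
      ∫ x, (ψ (f x) : ℂ) * h x ∂μ = ∫ y, (ψ (f' y) : ℂ) * h' y ∂ν)
    {V : Set ℝ} (hV : MeasurableSet V) (hVab : V ⊆ Ioo a b) :
    ∫ x in f ⁻¹' V, h x ∂μ = ∫ y in f' ⁻¹' V, h' y ∂ν := by
  have open_case : ∀ U : Set ℝ, IsOpen U → U ⊆ Ioo a b →
      ∫ x in f ⁻¹' U, h x ∂μ = ∫ y in f' ⁻¹' U, h' y ∂ν := by
    intro U hU hUab
    have hne : Uᶜ.Nonempty := ⟨a, fun ha => lt_irrefl a (hUab ha).1⟩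
    refine tendsto_nhds_unique (tendsto_integral_cutoff hf hh hU hUab hne) ?_
    refine (tendsto_integral_cutoff hf' hh' hU hUab hne).congr fun k => ?_
    refine (H (fun t => min 1 (k * Metric.infDist t Uᶜ)) ?_ fun t ht => ?_).symm
    · exact continuous_const.min (continuous_const.mul (Metric.continuous_infDist_pt _))
    · rw [Metric.infDist_zero_of_mem (show t ∈ Uᶜ from fun h => ht (hUab h))]; simp
  have key : ∀ V : Set ℝ, MeasurableSet V →
      ∫ x in f ⁻¹' (V ∩ Ioo a b), h x ∂μ = ∫ y in f' ⁻¹' (V ∩ Ioo a b), h' y ∂ν := by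
    -- Dynkin's π-λ theorem starting from the open sets. Intersecting with `Ioo a b` keeps
    -- everything integrable, and complements are taken inside this interval.
    refine MeasurableSpace.induction_on_inter (BorelSpace.measurable_eq (α := ℝ))
      isPiSystem_isOpen ?_ ?_ ?_ ?_
    · simp
    · intro U hU
      exact open_case _ (IsOpen.inter hU isOpen_Ioo) inter_subset_right
    · intro V hV ih
      have e : Vᶜ ∩ Ioo a b = Ioo a b \ (V ∩ Ioo a b) := by ext; simp; tauto
      have h1 := setIntegral_sdiff (hf (hV.inter measurableSet_Ioo)) hh
        (preimage_mono inter_subset_right)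
      have h2 := setIntegral_sdiff (hf' (hV.inter measurableSet_Ioo)) hh'
        (preimage_mono inter_subset_right)
      rw [e, preimage_sdiff, preimage_sdiff, h1, h2, ih, open_case _ isOpen_Ioo subset_rfl]
    · intro A hd hA ih
      rw [iUnion_inter, preimage_iUnion, preimage_iUnion]
      have hd' : Pairwise (Function.onFun Disjoint fun i => A i ∩ Ioo a b) := fun i j hij =>
        (hd hij).mono inter_subset_left inter_subset_left
      have h1 := hasSum_integral_iUnion (μ := μ) (f := h)
        (fun i => hf ((hA i).inter measurableSet_Ioo))
        (fun i j hij => (hd' hij).preimage f)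
        (hh.mono_set (iUnion_subset fun i => preimage_mono inter_subset_right))
      have h2 := hasSum_integral_iUnion (μ := ν) (f := h')
        (fun i => hf' ((hA i).inter measurableSet_Ioo))
        (fun i j hij => (hd' hij).preimage f')
        (hh'.mono_set (iUnion_subset fun i => preimage_mono inter_subset_right))
      exact h1.unique (h2.congr_fun fun i => ih i)
  have := key V hV
  rwa [inter_eq_left.2 hVab] at this

end MeasureLemma

/-! ### Tail integrals and distribution functions -/

section Fubini

variable {X : Type*} [MeasurableSpace X] {μ : Measure X} {f : X → ℝ} {h : X → ℂ}
  {θ : ℝ → ℂ}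

theorem integrable_indicator_lt_prod (hf : Measurable f) (hh : Integrable h μ)
    (hθ : Integrable θ) :
    Integrable ({p : X × ℝ | f p.1 < p.2}.indicator fun p => h p.1 * θ p.2) (μ.prod volume) :=
  (hh.mul_prod hθ).indicator (measurableSet_lt (hf.comp measurable_fst) measurable_snd)

theorem integral_indicator_lt_left (hf : Measurable f) (t : ℝ) :
    ∫ x, ({p : X × ℝ | f p.1 < p.2}.indicator fun p => h p.1 * θ p.2) (x, t) ∂μ =
      θ t * ∫ x in {x | f x < t}, h x ∂μ := by
  rw [← integral_const_mul, ← integral_indicator (measurableSet_lt hf measurable_const)]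
  refine integral_congr_ae (Eventually.of_forall fun x => ?_)
  by_cases hx : f x < t
  · simp [indicator, hx, mul_comm]
  · simp [indicator, hx]

theorem integrable_mul_setIntegral_lt [SFinite μ] (hf : Measurable f) (hh : Integrable h μ)
    (hθ : Integrable θ) : Integrable fun t => θ t * ∫ x in {x | f x < t}, h x ∂μ :=
  (integrable_indicator_lt_prod hf hh hθ).integral_prod_right.congr
    (Eventually.of_forall fun t => integral_indicator_lt_left hf t)

/-- Fubini on the region f x < t: tails of θ are exchanged for the distribution function of h. -/
theorem integral_tail_mul [SFinite μ] (hf : Measurable f) (hh : Integrable h μ) (hθ : Integrable θ) :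
    ∫ x, (∫ t in Ioi (f x), θ t) * h x ∂μ = ∫ t, θ t * ∫ x in {x | f x < t}, h x ∂μ := by
  have h1 := integral_integral_swap (f := fun x t =>
    ({p : X × ℝ | f p.1 < p.2}.indicator fun p => h p.1 * θ p.2) (x, t))
    (integrable_indicator_lt_prod hf hh hθ)
  simp only [integral_indicator_lt_left hf] at h1
  rw [← h1]
  refine integral_congr_ae (Eventually.of_forall fun x => ?_)
  simp only []
  rw [mul_comm, ← integral_const_mul, ← integral_indicator measurableSet_Ioi]
  refine integral_congr_ae (Eventually.of_forall fun t => ?_)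
  by_cases hx : f x < t
  · simp [indicator, hx]
  · simp [indicator, hx]

end Fubini

/-! ### Densities of push-forwards by integration by parts -/

section Push

variable {n : ℕ} {S : Finset (Fin n)} {c : EuclideanSpace ℝ (Fin n)} {ε r : ℝ}
  {m : Fin n → ℝ} {f : EuclideanSpace ℝ (Fin n) → ℝ}
  {κ : Fin n → EuclideanSpace ℝ (Fin n) → ℂ} {g h : EuclideanSpace ℝ (Fin n) → ℂ} {v w : ℝ → ℂ}

/-- The conditions on a corner box and a weight under which we integrate. -/
structure IsBoxWeight (S : Finset (Fin n)) (c : EuclideanSpace ℝ (Fin n)) (ε r : ℝ)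
    (m : Fin n → ℝ) : Prop where
  eps_pos : 0 < ε
  lt_eps : r < ε
  center : ∀ j ∈ S, c j = 0
  weight_pos : ∀ j ∈ S, 0 < m j

/-- Symbols of a given weight, supported away from the outer part of the boundary of the box. -/
structure IsTame (S : Finset (Fin n)) (c : EuclideanSpace ℝ (Fin n)) (ε r : ℝ) (m : Fin n → ℝ)
    (g : EuclideanSpace ℝ (Fin n) → ℂ) : Prop where
  symbol : IsSymbol S (cornerBox S c ε) (weight S m) g
  supp : ∀ x ∈ cornerBox S c ε, (∃ i, r < |x i - c i|) → g x = 0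

/-- A positive function `f` with `D_i f = κ_i f`, where the `κ_i` are smooth up to the boundary. -/
structure IsPhase (S : Finset (Fin n)) (c : EuclideanSpace ℝ (Fin n)) (ε : ℝ)
    (f : EuclideanSpace ℝ (Fin n) → ℝ) (κ : Fin n → EuclideanSpace ℝ (Fin n) → ℂ) : Prop where
  measurable : Measurable f
  contDiffOn : ContDiffOn ℝ ∞ f (cornerBox S c ε)
  pos : ∀ x ∈ cornerBox S c ε, 0 < f x
  smooth : ∀ i, IsSmoothBdd (cornerBox S c ε) (κ i)
  bDeriv_eq : ∀ i, EqOn (bDeriv S i fun x => (f x : ℂ)) (fun x => κ i x * f x) (cornerBox S c ε)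

/-- The `i`-th coordinate direction is transversal to the fibres of the phase. -/
structure IsTransverse (S : Finset (Fin n)) (c : EuclideanSpace ℝ (Fin n)) (ε : ℝ)
    (κ : Fin n → EuclideanSpace ℝ (Fin n) → ℂ) (m : Fin n → ℝ) (i : Fin n) : Prop where
  ne_zero : ∀ x ∈ cornerBox S c ε, κ i x ≠ 0
  smooth_inv : IsSmoothBdd (cornerBox S c ε) fun x => (κ i x)⁻¹
  two_le : i ∈ S → 2 ≤ m i

/-- The (negative of the) adjoint of the vector field `κ_i⁻¹ D_i`, which maps `f` to itself. -/
def adjField (S : Finset (Fin n)) (κ : Fin n → EuclideanSpace ℝ (Fin n) → ℂ) (i : Fin n)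
    (g : EuclideanSpace ℝ (Fin n) → ℂ) : EuclideanSpace ℝ (Fin n) → ℂ :=
  bDeriv S i fun x => (κ i x)⁻¹ * g x

theorem IsTame.const_mul (hg : IsTame S c ε r m g) (a : ℂ) :
    IsTame S c ε r m fun x => a * g x :=
  ⟨hg.symbol.const_mul isOpen_cornerBox a, fun x hx hi => by rw [hg.supp x hx hi, mul_zero]⟩

theorem IsTame.smooth_mul (hg : IsTame S c ε r m g) (hh : IsSmoothBdd (cornerBox S c ε) h) :
    IsTame S c ε r m fun x => h x * g x :=
  ⟨IsSymbol.smooth_mul isOpen_cornerBox cornerBox_bdd hh hg.symbol,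
    fun x hx hi => by rw [hg.supp x hx hi, mul_zero]⟩

theorem bDeriv_eq_zero_of_supp (hg : ∀ x ∈ cornerBox S c ε, (∃ i, r < |x i - c i|) → g x = 0)
    (i : Fin n) :
    ∀ x ∈ cornerBox S c ε, (∃ i, r < |x i - c i|) → bDeriv S i g x = 0 := by
  rintro x hx ⟨k, hk⟩
  have hO : IsOpen (cornerBox S c ε ∩ {x | r < |x k - c k|}) :=
    isOpen_cornerBox.inter (isOpen_lt continuous_const
      (((contDiff_coord k).continuous.sub continuous_const).abs))
  rw [bDeriv_congr (v := fun _ => 0) hO (fun y hy => hg y hy.1 ⟨k, hy.2⟩) i ⟨hx, hk⟩, bDeriv_apply]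
  simp

theorem IsTame.map_bDeriv (hg : IsTame S c ε r m g) (i : Fin n) :
    IsTame S c ε r m (bDeriv S i g) :=
  ⟨hg.symbol.map_bDeriv isOpen_cornerBox i, bDeriv_eq_zero_of_supp hg.supp i⟩

theorem IsTame.adjField {i : Fin n} (hi : IsTransverse S c ε κ m i) (hg : IsTame S c ε r m g) :
    IsTame S c ε r m (adjField S κ i g) :=
  (hg.smooth_mul hi.smooth_inv).map_bDeriv i

theorem IsTame.integrableOn (hb : IsBoxWeight S c ε r m) (hg : IsTame S c ε r m g) :
    IntegrableOn (fun x => g x * bInv S x) (cornerBox S c ε) := by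
  obtain ⟨K, hK⟩ := hg.symbol.bound []
  exact integrableOn_mul_bInv hb.eps_pos hb.center hb.weight_pos
    hg.symbol.contDiffOn.continuousOn hK

/-- Integration by parts along the vector field `κ_i⁻¹ D_i`. -/
theorem integral_adjField (hb : IsBoxWeight S c ε r m) (hf : IsPhase S c ε f κ) {i : Fin n}
    (hi : IsTransverse S c ε κ m i) (hg : IsTame S c ε r m g) {Ψ θ : ℝ → ℝ}
    (hΨ : ∀ s, HasDerivAt Ψ (θ s) s) (hθ : Continuous θ) {P Q : ℝ} (hP : ∀ s, |Ψ s| ≤ P)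
    (hQ : ∀ s, |s * θ s| ≤ Q) :
    ∫ x in cornerBox S c ε, (Ψ (f x) : ℂ) * (adjField S κ i g x * bInv S x) =
      - ∫ x in cornerBox S c ε, ((f x * θ (f x) : ℝ) : ℂ) * (g x * bInv S x) := by
  set B := cornerBox S c ε with hBdef
  have hB : IsOpen B := isOpen_cornerBox
  set G : EuclideanSpace ℝ (Fin n) → ℂ := fun x => (κ i x)⁻¹ * g x with hG
  have hGt : IsTame S c ε r m G := hg.smooth_mul hi.smooth_inv
  have hAt : IsTame S c ε r m (adjField S κ i g) := hg.adjField hi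
  have hP0 : 0 ≤ P := (abs_nonneg _).trans (hP 0)
  have hQ0 : 0 ≤ Q := (abs_nonneg _).trans (hQ 0)
  have hΨ1 : ContDiff ℝ 1 Ψ := by
    rw [contDiff_one_iff_deriv]
    refine ⟨fun s => (hΨ s).differentiableAt, ?_⟩
    rw [show deriv Ψ = θ from funext fun s => (hΨ s).deriv]
    exact hθ
  have hΨf : ContDiffOn ℝ 1 (fun x => (Ψ (f x) : ℂ)) B :=
    Complex.ofRealCLM.contDiff.comp_contDiffOn
      (hΨ1.comp_contDiffOn (hf.contDiffOn.of_le (by simp)))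
  -- Since D_i f = κ_i f, differentiating Ψ(f) produces κ_i f θ(f), and κ_i cancels against the
  -- κ_i⁻¹ in G.
  have hderiv : ∀ x ∈ B, bDeriv S i (fun x => (Ψ (f x) : ℂ) * G x) x =
      (Ψ (f x) : ℂ) * adjField S κ i g x + ((f x * θ (f x) : ℝ) : ℂ) * g x := by
    intro x hx
    have hfx : HasFDerivAt f (fderiv ℝ f x) x :=
      (ContDiffOn.differentiableAt_of_isOpen hf.contDiffOn hB hx).hasFDerivAt
    have h1 : HasFDerivAt (fun x => (f x : ℂ)) (Complex.ofRealCLM.comp (fderiv ℝ f x)) x :=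
      Complex.ofRealCLM.hasFDerivAt.comp x hfx
    have h2 : HasFDerivAt (fun x => (Ψ (f x) : ℂ))
        (Complex.ofRealCLM.comp (θ (f x) • fderiv ℝ f x)) x :=
      Complex.ofRealCLM.hasFDerivAt.comp x ((hΨ (f x)).comp_hasFDerivAt x hfx)
    have h3 := hf.bDeriv_eq i hx
    rw [bDeriv_apply, h1.fderiv] at h3
    have h4 := (h2.mul (ContDiffOn.differentiableAt_of_isOpen hGt.symbol.contDiffOn hB
      hx).hasFDerivAt).fderiv
    have h5 : adjField S κ i g x = bCoef S i x * fderiv ℝ G x (EuclideanSpace.single i 1) := rfl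
    have hk := hi.ne_zero x hx
    have h4' : fderiv ℝ (fun x => (Ψ (f x) : ℂ) * G x) x =
      (Ψ (f x) : ℂ) • fderiv ℝ G x + G x • (Complex.ofRealCLM.comp (θ (f x) • fderiv ℝ f x)) := h4
    rw [bDeriv_apply, h4', h5]
    simp only [ContinuousLinearMap.comp_apply, Complex.ofRealCLM_apply, add_apply, smul_apply,
      smul_eq_mul, Complex.ofReal_mul, hG] at h3 ⊢
    have h6 : (κ i x)⁻¹ * g x * (θ (f x) * (fderiv ℝ f x (EuclideanSpace.single i 1) : ℂ)) *
        bCoef S i x = (f x : ℂ) * θ (f x) * g x := by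
      calc _ = (κ i x)⁻¹ * g x * θ (f x) *
            (bCoef S i x * (fderiv ℝ f x (EuclideanSpace.single i 1) : ℂ)) := by ring
        _ = (κ i x)⁻¹ * g x * θ (f x) * (κ i x * f x) := by rw [h3]
        _ = _ := by field_simp
    rw [mul_add, ← h6]
    ring
  obtain ⟨K1, hK1⟩ := hGt.symbol.bound []
  obtain ⟨K2, hK2⟩ := hAt.symbol.bound []
  obtain ⟨K3, hK3⟩ := hg.symbol.bound []
  have hfm : Measurable f := hf.measurable
  have b1 : ∀ x, ‖(Ψ (f x) : ℂ)‖ ≤ P := fun x => by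
    rw [Complex.norm_real]; exact hP _
  have b2 : ∀ x, ‖((f x * θ (f x) : ℝ) : ℂ)‖ ≤ Q := fun x => by
    rw [Complex.norm_real]; exact hQ _
  have hibp := integral_bDeriv_eq_zero (i := i) (h := fun x => (Ψ (f x) : ℂ) * G x)
    (K := P * K1) (K' := P * K2 + Q * K3) hb.eps_pos hb.center hb.weight_pos hb.lt_eps hi.two_le
    (hΨf.mul (hGt.symbol.contDiffOn.of_le (by simp)))
    (fun x hx => by
      rw [norm_mul, mul_assoc]
      exact mul_le_mul (b1 x) (hK1 x hx) (norm_nonneg _) hP0)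
    (fun x hx => by
      rw [hderiv x hx, add_mul, mul_assoc, mul_assoc]
      refine (norm_add_le _ _).trans ?_
      rw [norm_mul, norm_mul]
      exact add_le_add (mul_le_mul (b1 x) (hK2 x hx) (norm_nonneg _) hP0)
        (mul_le_mul (b2 x) (hK3 x hx) (norm_nonneg _) hQ0))
    (fun x hx hs => by simp only [hGt.supp x hx hs, mul_zero])
  have hi1 : IntegrableOn (fun x => (Ψ (f x) : ℂ) * (adjField S κ i g x * bInv S x)) B := by
    refine Integrable.bdd_mul (c := P) (hAt.integrableOn hb) ?_ (Eventually.of_forall b1)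
    exact (Complex.measurable_ofReal.comp
      (hΨ1.continuous.measurable.comp hfm)).aestronglyMeasurable
  have hi2 : IntegrableOn (fun x => ((f x * θ (f x) : ℝ) : ℂ) * (g x * bInv S x)) B := by
    refine Integrable.bdd_mul (c := Q) (hg.integrableOn hb) ?_ (Eventually.of_forall b2)
    exact (Complex.measurable_ofReal.comp
      (hfm.mul (hθ.measurable.comp hfm))).aestronglyMeasurable
  rw [eq_neg_iff_add_eq_zero, ← integral_add hi1 hi2, ← hibp]
  refine setIntegral_congr_fun hB.measurableSet fun x hx => ?_
  rw [hderiv x hx]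
  ring

/-- The distribution function of the push-forward of the b-density given by `h`. -/
def cumul (S : Finset (Fin n)) (c : EuclideanSpace ℝ (Fin n)) (ε : ℝ)
    (f : EuclideanSpace ℝ (Fin n) → ℝ) (h : EuclideanSpace ℝ (Fin n) → ℂ) (t : ℝ) : ℂ :=
  ∫ x in {x | f x < t}, h x * bInv S x ∂(volume.restrict (cornerBox S c ε))

/-- The push-forward by `f` of the b-density given by `g` is `v(t) dt / t` on `(0, ∞)`. -/
structure IsWeakPush (S : Finset (Fin n)) (c : EuclideanSpace ℝ (Fin n)) (ε : ℝ)
    (f : EuclideanSpace ℝ (Fin n) → ℝ) (g : EuclideanSpace ℝ (Fin n) → ℂ) (v : ℝ → ℂ) : Prop where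
  integrableOn : ∀ a b : ℝ, 0 < a → IntegrableOn (fun t : ℝ => v t * (t : ℂ)⁻¹) (Ioo a b)
  integral_eq : ∀ (ψ : ℝ → ℝ), Continuous ψ → ∀ a b : ℝ, 0 < a → (∀ t, t ∉ Ioo a b → ψ t = 0) →
    ∫ x in cornerBox S c ε, (ψ (f x) : ℂ) * (g x * bInv S x) =
      ∫ t, (ψ t : ℂ) * (v t * (t : ℂ)⁻¹)

theorem IsTame.norm_cumul_le (hb : IsBoxWeight S c ε r m) (hg : IsTame S c ε r m g) (t : ℝ) :
    ‖cumul S c ε f g t‖ ≤ ∫ x in cornerBox S c ε, ‖g x * bInv S x‖ :=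
  (norm_integral_le_integral_norm _).trans
    (setIntegral_le_integral (hg.integrableOn hb).norm (Eventually.of_forall fun _ => norm_nonneg _))

theorem continuous_div_of_supp {ψ : ℝ → ℝ} (hψ : Continuous ψ) {a b : ℝ} (ha : 0 < a)
    (h : ∀ t, t ∉ Ioo a b → ψ t = 0) : Continuous fun t => ψ t * t⁻¹ := by
  rw [continuous_iff_continuousAt]
  intro t
  rcases eq_or_ne t 0 with rfl | ht
  · have h0 : ContinuousAt (fun _ : ℝ => (0 : ℝ)) 0 := continuousAt_const
    refine h0.congr ?_
    filter_upwards [gt_mem_nhds ha] with s hs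
    rw [h s fun hh => lt_asymm hs hh.1, zero_mul]
  · exact hψ.continuousAt.mul (continuousAt_inv₀ ht)

theorem integrable_of_continuous_of_supp {θ : ℝ → ℝ} (hθ : Continuous θ) {a b : ℝ}
    (h : ∀ t, t ∉ Ioo a b → θ t = 0) : Integrable θ := by
  refine hθ.integrable_of_hasCompactSupport (HasCompactSupport.intro (isCompact_Icc (a := a) (b := b))
    fun t ht => h t fun hh => ht (Ioo_subset_Icc_self hh))

/-- For a test function ψ let Ψ(s) = ∫_s^∞ ψ(t) dt/t, so that s Ψ'(s) = -ψ(s). Integration by parts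
replaces ψ(f) g by Ψ(f) times the adjoint field applied to g. Writing Ψ as a tail integral and using
Fubini gives ψ(t)/t against the distribution function. -/
theorem IsTame.isWeakPush_cumul (hb : IsBoxWeight S c ε r m) (hf : IsPhase S c ε f κ) {i : Fin n}
    (hi : IsTransverse S c ε κ m i) (hg : IsTame S c ε r m g) :
    IsWeakPush S c ε f g (cumul S c ε f (PushForward.adjField S κ i g)) := by
  have hA := (hg.adjField hi).integrableOn hb
  refine ⟨fun a b ha => ?_, fun ψ hψ a b ha hab => ?_⟩
  · have hθ : Integrable ((Ioo a b).indicator fun t : ℝ => (t : ℂ)⁻¹) := by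
      rw [integrable_indicator_iff measurableSet_Ioo]
      refine IntegrableOn.mono_set (ContinuousOn.integrableOn_Icc ?_) Ioo_subset_Icc_self
      refine ContinuousOn.inv₀ Complex.continuous_ofReal.continuousOn fun t ht => ?_
      exact_mod_cast (ha.trans_le ht.1).ne'
    have h1 := integrable_mul_setIntegral_lt hf.measurable hA hθ
    rw [← integrable_indicator_iff measurableSet_Ioo]
    refine h1.congr (Eventually.of_forall fun t => ?_)
    by_cases ht : t ∈ Ioo a b
    · simp only [indicator_of_mem ht]
      rw [mul_comm]; rfl
    · simp only [indicator_of_notMem ht, zero_mul]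
  · set θ : ℝ → ℝ := fun t => ψ t * t⁻¹ with hθdef
    have hθ : Continuous θ := continuous_div_of_supp hψ ha hab
    have hθ0 : ∀ t, t ∉ Ioo a b → θ t = 0 := fun t ht => by simp [hθdef, hab t ht]
    have hθi : Integrable θ := integrable_of_continuous_of_supp hθ hθ0
    have hθC : Integrable fun t => (θ t : ℂ) := hθi.ofReal
    set Ψ : ℝ → ℝ := fun s => ∫ t in Ioi s, θ t with hΨdef
    have hΨ : ∀ s, HasDerivAt Ψ (-θ s) s := by
      intro s
      have h1 : Ψ = fun s => Ψ 0 - ∫ t in (0 : ℝ)..s, θ t := by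
        ext s
        rw [← intervalIntegral.integral_Ioi_sub_Ioi' hθi.integrableOn hθi.integrableOn]
        simp only [hΨdef]; ring
      rw [h1]
      have h2 := intervalIntegral.integral_hasDerivAt_right (hθ.intervalIntegrable 0 s)
        hθ.stronglyMeasurable.stronglyMeasurableAtFilter hθ.continuousAt
      simpa using h2.const_sub (Ψ 0)
    have hψθ : ∀ s, s * (-θ s) = -ψ s := by
      intro s
      rcases eq_or_ne s 0 with rfl | hs
      · rw [hab 0 fun hh => lt_asymm ha hh.1]; simp
      · simp only [hθdef]; field_simp
    obtain ⟨Q, hQ⟩ : ∃ Q, ∀ s, ‖ψ s‖ ≤ Q := by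
      obtain ⟨Q, hQ⟩ := (isCompact_Icc (a := a) (b := b)).exists_bound_of_continuousOn hψ.continuousOn
      refine ⟨max Q 0, fun s => ?_⟩
      by_cases hs : s ∈ Ioo a b
      · exact (hQ s (Ioo_subset_Icc_self hs)).trans (le_max_left _ _)
      · rw [hab s hs, norm_zero]; exact le_max_right _ _
    have h3 := integral_adjField (Ψ := Ψ) (θ := fun s => -θ s) (P := ∫ t, ‖θ t‖) (Q := Q)
      hb hf hi hg hΨ hθ.neg (fun s => (norm_integral_le_integral_norm _).trans
        (setIntegral_le_integral hθi.norm (Eventually.of_forall fun _ => norm_nonneg _)))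
      (fun s => by rw [hψθ, abs_neg]; exact hQ s)
    simp only [hψθ, Complex.ofReal_neg, neg_mul, integral_neg, neg_neg] at h3
    rw [← h3]
    have h4 := integral_tail_mul hf.measurable hA hθC
    have h5 : ∀ s, (Ψ s : ℂ) = ∫ t in Ioi s, (θ t : ℂ) := fun s => by
      simp only [hΨdef]; exact integral_ofReal.symm
    simp only [h5]
    refine h4.trans (integral_congr_ae (Eventually.of_forall fun t => ?_))
    simp only [hθdef, cumul]
    push_cast
    ring

theorem IsWeakPush.setIntegral (hb : IsBoxWeight S c ε r m) (hfm : Measurable f)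
    (hg : IsTame S c ε r m g) (hv : IsWeakPush S c ε f g v) {a b : ℝ} (ha : 0 < a)
    {V : Set ℝ} (hV : MeasurableSet V) (hVab : V ⊆ Ioo a b) :
    ∫ x in f ⁻¹' V, g x * bInv S x ∂(volume.restrict (cornerBox S c ε)) =
      ∫ t in V, v t * (t : ℂ)⁻¹ :=
  setIntegral_preimage_eq (f' := id) hfm measurable_id (hg.integrableOn hb).integrableOn
    (hv.integrableOn a b ha) (fun ψ hψ hab => hv.integral_eq ψ hψ a b ha hab) hV hVab

/-- The difference is the mass of f⁻¹[s, t). Thus the distribution function is a primitive of the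
density, which yields its continuity and its derivative. -/
theorem cumul_sub_cumul (hb : IsBoxWeight S c ε r m) (hfm : Measurable f)
    (hg : IsTame S c ε r m g) (hv : IsWeakPush S c ε f g v) {s t : ℝ} (hs : 0 < s) (hst : s ≤ t) :
    cumul S c ε f g t - cumul S c ε f g s = ∫ τ in s..t, v τ * (τ : ℂ)⁻¹ := by
  have h1 := setIntegral_sdiff (μ := volume.restrict (cornerBox S c ε))
    (f := fun x => g x * bInv S x)
    (measurableSet_lt hfm (measurable_const (a := s)))
    ((hg.integrableOn hb).integrableOn (s := {x | f x < t})) (fun x hx => lt_of_lt_of_le hx hst)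
  have h2 : {x | f x < t} \ {x | f x < s} = f ⁻¹' Ico s t := by ext x; simp; tauto
  rw [h2] at h1
  unfold cumul
  -- The endpoint s/2 only provides an open interval around [s, t) that stays away from 0.
  rw [← h1, hv.setIntegral hb hfm hg (a := s / 2) (b := t) (by linarith) measurableSet_Ico
    (fun x hx => ⟨by linarith [hx.1], hx.2⟩), intervalIntegral.integral_of_le hst,
    integral_Ico_eq_integral_Ioc (μ := volume)]

/-- A continuous density of the push-forward. -/
structure IsPush (S : Finset (Fin n)) (c : EuclideanSpace ℝ (Fin n)) (ε : ℝ)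
    (f : EuclideanSpace ℝ (Fin n) → ℝ) (g : EuclideanSpace ℝ (Fin n) → ℂ) (v : ℝ → ℂ) : Prop where
  continuousOn : ContinuousOn v (Ioi 0)
  weak : IsWeakPush S c ε f g v

theorem continuousOn_inv_ofReal : ContinuousOn (fun t : ℝ => (t : ℂ)⁻¹) (Ioi 0) :=
  ContinuousOn.inv₀ Complex.continuous_ofReal.continuousOn fun t ht => by
    exact_mod_cast (ne_of_gt ht : (t : ℝ) ≠ 0)

theorem hasDerivAt_integral_div (hv : ContinuousOn v (Ioi 0)) {s t : ℝ} (hs : 0 < s) (ht : 0 < t) :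
    HasDerivAt (fun t => ∫ τ in s..t, v τ * (τ : ℂ)⁻¹) (v t * (t : ℂ)⁻¹) t := by
  have h1 := hv.mul continuousOn_inv_ofReal
  have hsub : uIcc s t ⊆ Ioi 0 := fun x hx => (lt_min hs ht).trans_le hx.1
  exact intervalIntegral.integral_hasDerivAt_right (h1.mono hsub).intervalIntegrable
    (h1.stronglyMeasurableAtFilter isOpen_Ioi t ht) (h1.continuousAt (Ioi_mem_nhds ht))

/-- Locally it is a constant plus the primitive of a locally integrable density. -/
theorem IsTame.continuousOn_cumul (hb : IsBoxWeight S c ε r m) (hf : IsPhase S c ε f κ) {i : Fin n}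
    (hi : IsTransverse S c ε κ m i) (hg : IsTame S c ε r m g) :
    ContinuousOn (cumul S c ε f g) (Ioi 0) := by
  have hw := hg.isWeakPush_cumul hb hf hi
  intro t0 ht0
  have ht0' : (0 : ℝ) < t0 := ht0
  set s := t0 / 2 with hs
  have hs0 : 0 < s := by simp only [hs]; linarith
  have h1 : ContinuousOn (fun t => ∫ τ in s..t, cumul S c ε f (PushForward.adjField S κ i g) τ *
      (τ : ℂ)⁻¹) (Icc s (t0 + 1)) := by
    have hle : s ≤ t0 + 1 := by simp only [hs]; linarith
    rw [← uIcc_of_le hle]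
    refine intervalIntegral.continuousOn_primitive_interval (μ := volume) ?_
    rw [uIcc_of_le hle]
    exact (hw.integrableOn (s / 2) (t0 + 2) (by linarith)).mono_set fun x hx =>
      ⟨by linarith [hx.1], by linarith [hx.2]⟩
  have h2 : Icc s (t0 + 1) ∈ 𝓝 t0 := Icc_mem_nhds (by simp only [hs]; linarith) (by linarith)
  have h3 := (h1.continuousAt h2).const_add (cumul S c ε f g s)
  refine (h3.congr ?_).continuousWithinAt
  filter_upwards [h2] with t ht
  rw [← cumul_sub_cumul hb hf.measurable hg hw hs0 ht.1]
  ring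

theorem IsTame.isPush_cumul (hb : IsBoxWeight S c ε r m) (hf : IsPhase S c ε f κ) {i : Fin n}
    (hi : IsTransverse S c ε κ m i) (hg : IsTame S c ε r m g) :
    IsPush S c ε f g (cumul S c ε f (PushForward.adjField S κ i g)) :=
  ⟨(hg.adjField hi).continuousOn_cumul hb hf hi, hg.isWeakPush_cumul hb hf hi⟩

/-- Both densities arise by differentiating the same distribution function. -/
theorem IsPush.unique (hb : IsBoxWeight S c ε r m) (hfm : Measurable f)
    (hg : IsTame S c ε r m g) (hv : IsPush S c ε f g v) (hw : IsPush S c ε f g w) :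
    EqOn v w (Ioi 0) := by
  intro t ht
  have ht' : (0 : ℝ) < t := ht
  have hs : 0 < t / 2 := by linarith
  have h1 := hasDerivAt_integral_div hv.continuousOn hs ht'
  have h2 := hasDerivAt_integral_div hw.continuousOn hs ht'
  have h3 : (fun t' => ∫ τ in (t / 2)..t', v τ * (τ : ℂ)⁻¹) =ᶠ[𝓝 t]
      fun t' => ∫ τ in (t / 2)..t', w τ * (τ : ℂ)⁻¹ := by
    filter_upwards [lt_mem_nhds (show t / 2 < t by linarith)] with t' ht'
    rw [← cumul_sub_cumul hb hfm hg hv.weak hs ht'.le, ← cumul_sub_cumul hb hfm hg hw.weak hs ht'.le]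
  have h4 := h1.unique (h2.congr_of_eventuallyEq h3)
  exact mul_right_cancel₀ (inv_ne_zero (by exact_mod_cast ht'.ne')) h4

/-- By uniqueness v is the distribution function of the adjoint field applied to g, and its
derivative is the density of that push-forward. The densities v and w are arbitrary, so they may
have been obtained from a direction other than i. -/
theorem IsPush.hasDerivAt (hb : IsBoxWeight S c ε r m) (hf : IsPhase S c ε f κ) {i : Fin n}
    (hi : IsTransverse S c ε κ m i) (hg : IsTame S c ε r m g) (hv : IsPush S c ε f g v)
    (hw : IsPush S c ε f (adjField S κ i g) w) {t : ℝ} (ht : 0 < t) :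
    HasDerivAt v (w t * (t : ℂ)⁻¹) t := by
  have hs : 0 < t / 2 := by linarith
  have h1 := (hasDerivAt_integral_div hw.continuousOn hs ht).const_add
    (cumul S c ε f (adjField S κ i g) (t / 2))
  refine h1.congr_of_eventuallyEq ?_
  filter_upwards [lt_mem_nhds (show t / 2 < t by linarith)] with t' ht'
  rw [← cumul_sub_cumul hb hf.measurable (hg.adjField hi) hw.weak hs ht'.le,
    IsPush.unique hb hf.measurable hg hv (hg.isPush_cumul hb hf hi) (hs.trans ht')]
  ring

theorem IsPush.congr_left (hv : IsPush S c ε f g v) (hgh : EqOn g h (cornerBox S c ε)) :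
    IsPush S c ε f h v := by
  refine ⟨hv.continuousOn, hv.weak.integrableOn, fun ψ hψ a b ha hab => ?_⟩
  rw [← hv.weak.integral_eq ψ hψ a b ha hab]
  exact setIntegral_congr_fun measurableSet_cornerBox fun x hx => by simp only [hgh hx]

end Push

/-! ### Expansions on the half-line -/

section HalfLine

open Polynomial

variable {g h v w : ℝ → ℂ} {N N' N₀ : ℝ} {ζ : ℂ}

/-- The derivative `t d/dt`. -/
def tDeriv (h : ℝ → ℂ) : ℝ → ℂ := fun s => (s : ℂ) * deriv h s

/-- The operator `t d/dt - ζ`. -/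
def tOp (ζ : ℂ) (h : ℝ → ℂ) : ℝ → ℂ := fun s => tDeriv h s - ζ * h s

/-- The product of the operators `tOp`; the first one in the list is applied first. -/
def tOps (Z : List ℂ) (h : ℝ → ℂ) : ℝ → ℂ := Z.foldl (fun h ζ => tOp ζ h) h

theorem differentiableAt_of_contDiffOn_Ioi (hh : ContDiffOn ℝ ∞ h (Ioi 0)) {t : ℝ} (ht : 0 < t) :
    DifferentiableAt ℝ h t :=
  (hh.contDiffAt (Ioi_mem_nhds ht)).differentiableAt (by simp)

theorem contDiffOn_tDeriv (hh : ContDiffOn ℝ ∞ h (Ioi 0)) : ContDiffOn ℝ ∞ (tDeriv h) (Ioi 0) :=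
  Complex.ofRealCLM.contDiff.contDiffOn.mul (hh.deriv_of_isOpen isOpen_Ioi (by simp))

theorem tDeriv_congr (hgh : EqOn g h (Ioi 0)) : EqOn (tDeriv g) (tDeriv h) (Ioi 0) := by
  intro t ht
  have : g =ᶠ[𝓝 t] h := by filter_upwards [Ioi_mem_nhds ht] with s hs using hgh hs
  simp only [tDeriv, this.deriv_eq]

theorem tDeriv_add (hg : ContDiffOn ℝ ∞ g (Ioi 0)) (hh : ContDiffOn ℝ ∞ h (Ioi 0)) :
    EqOn (tDeriv fun s => g s + h s) (fun s => tDeriv g s + tDeriv h s) (Ioi 0) := by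
  intro t ht
  have := deriv_fun_add (differentiableAt_of_contDiffOn_Ioi hg ht)
    (differentiableAt_of_contDiffOn_Ioi hh ht)
  simp only [tDeriv, this]
  ring

theorem tDeriv_const_mul (hh : ContDiffOn ℝ ∞ h (Ioi 0)) (c : ℂ) :
    EqOn (tDeriv fun s => c * h s) (fun s => c * tDeriv h s) (Ioi 0) := by
  intro t ht
  have := deriv_const_mul c (differentiableAt_of_contDiffOn_Ioi hh ht)
  simp only [tDeriv, this]
  ring

theorem iterate_tDeriv_congr (hgh : EqOn g h (Ioi 0)) (k : ℕ) :
    EqOn (tDeriv^[k] g) (tDeriv^[k] h) (Ioi 0) := by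
  induction k generalizing g h with
  | zero => exact hgh
  | succ k ih => exact ih (tDeriv_congr hgh)

theorem iterate_tDeriv_add (hg : ContDiffOn ℝ ∞ g (Ioi 0)) (hh : ContDiffOn ℝ ∞ h (Ioi 0)) (k : ℕ) :
    EqOn (tDeriv^[k] fun s => g s + h s) (fun s => tDeriv^[k] g s + tDeriv^[k] h s) (Ioi 0) := by
  induction k generalizing g h with
  | zero => exact fun _ _ => rfl
  | succ k ih =>
    exact (iterate_tDeriv_congr (tDeriv_add hg hh) k).trans
      (ih (contDiffOn_tDeriv hg) (contDiffOn_tDeriv hh))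

theorem iterate_tDeriv_const_mul (hh : ContDiffOn ℝ ∞ h (Ioi 0)) (c : ℂ) (k : ℕ) :
    EqOn (tDeriv^[k] fun s => c * h s) (fun s => c * tDeriv^[k] h s) (Ioi 0) := by
  induction k generalizing h with
  | zero => exact fun _ _ => rfl
  | succ k ih =>
    exact (iterate_tDeriv_congr (tDeriv_const_mul hh c) k).trans (ih (contDiffOn_tDeriv hh))

/-- `h` is `O(t^N)` on `(0, 1)` with all its derivatives `t d/dt`. -/
structure IsBigOPow (N : ℝ) (h : ℝ → ℂ) : Prop where
  contDiffOn : ContDiffOn ℝ ∞ h (Ioi 0)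
  bound : ∀ k : ℕ, ∃ C : ℝ, ∀ t ∈ Ioo (0 : ℝ) 1, ‖tDeriv^[k] h t‖ ≤ C * t ^ N

theorem IsBigOPow.congr (hg : IsBigOPow N g) (hgh : EqOn g h (Ioi 0)) : IsBigOPow N h :=
  ⟨hg.contDiffOn.congr fun t ht => (hgh ht).symm, fun k => (hg.bound k).imp fun C hC t ht => by
    rw [← iterate_tDeriv_congr hgh k ht.1]; exact hC t ht⟩

theorem IsBigOPow.add (hg : IsBigOPow N g) (hh : IsBigOPow N h) :
    IsBigOPow N fun s => g s + h s := by
  refine ⟨hg.contDiffOn.add hh.contDiffOn, fun k => ?_⟩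
  obtain ⟨C, hC⟩ := hg.bound k
  obtain ⟨D, hD⟩ := hh.bound k
  refine ⟨C + D, fun t ht => ?_⟩
  rw [iterate_tDeriv_add hg.contDiffOn hh.contDiffOn k ht.1, add_mul]
  exact (norm_add_le _ _).trans (add_le_add (hC t ht) (hD t ht))

theorem IsBigOPow.const_mul (hh : IsBigOPow N h) (c : ℂ) : IsBigOPow N fun s => c * h s := by
  refine ⟨contDiffOn_const.mul hh.contDiffOn, fun k => ?_⟩
  obtain ⟨C, hC⟩ := hh.bound k
  refine ⟨‖c‖ * C, fun t ht => ?_⟩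
  rw [iterate_tDeriv_const_mul hh.contDiffOn c k ht.1, norm_mul, mul_assoc]
  exact mul_le_mul_of_nonneg_left (hC t ht) (norm_nonneg _)

theorem IsBigOPow.sub (hg : IsBigOPow N g) (hh : IsBigOPow N h) :
    IsBigOPow N fun s => g s - h s :=
  (hg.add (hh.const_mul (-1))).congr fun s _ => by ring

theorem isBigOPow_zero : IsBigOPow N fun _ => 0 := by
  refine ⟨contDiffOn_const, fun k => ⟨0, fun t ht => ?_⟩⟩
  have := iterate_tDeriv_const_mul (h := fun _ => 0) contDiffOn_const 0 k ht.1
  simp only [zero_mul] at this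
  simp [this]

theorem IsBigOPow.sum {ι : Type*} (T : Finset ι) {F : ι → ℝ → ℂ}
    (hF : ∀ i ∈ T, IsBigOPow N (F i)) : IsBigOPow N fun s => ∑ i ∈ T, F i s := by
  classical
  induction T using Finset.induction_on with
  | empty => simpa using isBigOPow_zero
  | insert a T ha ih =>
    simp only [Finset.sum_insert ha]
    exact (hF a (by simp)).add (ih fun i hi => hF i (by simp [hi]))

theorem IsBigOPow.tDeriv (hh : IsBigOPow N h) : IsBigOPow N (tDeriv h) :=
  ⟨contDiffOn_tDeriv hh.contDiffOn, fun k => hh.bound (k + 1)⟩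

theorem IsBigOPow.tOp (hh : IsBigOPow N h) (ζ : ℂ) : IsBigOPow N (tOp ζ h) :=
  hh.tDeriv.sub (hh.const_mul ζ)

theorem IsBigOPow.tOps (hh : IsBigOPow N h) (Z : List ℂ) : IsBigOPow N (tOps Z h) := by
  induction Z generalizing h with
  | nil => exact hh
  | cons ζ Z ih => exact ih (hh.tOp ζ)

theorem IsBigOPow.mono (hh : IsBigOPow N h) (hN : N' ≤ N) : IsBigOPow N' h := by
  refine ⟨hh.contDiffOn, fun k => ?_⟩
  obtain ⟨C, hC⟩ := hh.bound k
  refine ⟨|C|, fun t ht => (hC t ht).trans ?_⟩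
  exact mul_le_mul (le_abs_self C) (Real.rpow_le_rpow_of_exponent_ge ht.1 ht.2.le hN)
    (Real.rpow_nonneg ht.1.le _) (abs_nonneg _)

theorem tDeriv_powLog (z : ℂ) (P : ℂ[X]) :
    EqOn (tDeriv (powLog z P)) (powLog z (C z * P + derivative P)) (Ioi 0) := by
  intro t ht
  have ht' : (t : ℂ) ≠ 0 := by exact_mod_cast (ne_of_gt ht : (t : ℝ) ≠ 0)
  rw [tDeriv, (hasDerivAt_powLog z P ht).deriv, mul_inv_cancel_left₀ ht']

theorem isBigOPow_powLog {z : ℂ} (P : ℂ[X]) (hN : N < z.re) : IsBigOPow N (powLog z P) := by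
  refine ⟨contDiffOn_powLog z P, fun k => ?_⟩
  induction k generalizing P with
  | zero =>
    obtain ⟨C, hC⟩ := powLog_bound z P hN
    exact ⟨C, fun t ht => hC t ⟨ht.1, ht.2.le⟩⟩
  | succ k ih =>
    obtain ⟨C, hC⟩ := ih (Polynomial.C z * P + derivative P)
    refine ⟨C, fun t ht => ?_⟩
    have := iterate_tDeriv_congr (tDeriv_powLog z P) k ht.1
    exact (le_of_eq (congrArg _ this)).trans (hC t ht)

/-- `h` is `O(t^{N'})` for all `N' < N`, with all derivatives. -/
def IsBigOPowLT (N : ℝ) (h : ℝ → ℂ) : Prop := ∀ N' < N, IsBigOPow N' h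

theorem IsBigOPowLT.contDiffOn (hh : IsBigOPowLT N h) : ContDiffOn ℝ ∞ h (Ioi 0) :=
  (hh (N - 1) (by linarith)).contDiffOn

theorem contDiffOn_tOp (hh : ContDiffOn ℝ ∞ h (Ioi 0)) (ζ : ℂ) :
    ContDiffOn ℝ ∞ (tOp ζ h) (Ioi 0) :=
  (contDiffOn_tDeriv hh).sub (contDiffOn_const.mul hh)

theorem tOp_congr (hgh : EqOn g h (Ioi 0)) (ζ : ℂ) : EqOn (tOp ζ g) (tOp ζ h) (Ioi 0) :=
  fun t ht => by simp only [tOp, tDeriv_congr hgh ht, hgh ht]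

theorem tOps_congr (hgh : EqOn g h (Ioi 0)) (Z : List ℂ) :
    EqOn (tOps Z g) (tOps Z h) (Ioi 0) := by
  induction Z generalizing g h with
  | nil => exact hgh
  | cons ζ Z ih => exact ih (tOp_congr hgh ζ)

theorem tOps_add (hg : ContDiffOn ℝ ∞ g (Ioi 0)) (hh : ContDiffOn ℝ ∞ h (Ioi 0)) (Z : List ℂ) :
    EqOn (tOps Z fun s => g s + h s) (fun s => tOps Z g s + tOps Z h s) (Ioi 0) := by
  induction Z generalizing g h with
  | nil => exact fun _ _ => rfl
  | cons ζ Z ih =>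
    refine (tOps_congr (fun t ht => ?_) Z).trans (ih (contDiffOn_tOp hg ζ) (contDiffOn_tOp hh ζ))
    simp only [tOp, tDeriv_add hg hh ht]
    ring

theorem tOps_const_mul (hh : ContDiffOn ℝ ∞ h (Ioi 0)) (c : ℂ) (Z : List ℂ) :
    EqOn (tOps Z fun s => c * h s) (fun s => c * tOps Z h s) (Ioi 0) := by
  induction Z generalizing h with
  | nil => exact fun _ _ => rfl
  | cons ζ Z ih =>
    refine (tOps_congr (fun t ht => ?_) Z).trans (ih (contDiffOn_tOp hh ζ))
    simp only [tOp, tDeriv_const_mul hh c ht]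
    ring

theorem tOps_append (Z Z' : List ℂ) : tOps (Z ++ Z') h = tOps Z' (tOps Z h) := by
  simp [tOps]

/-- The operator with ζ = z differentiates the polynomial; any other ζ keeps the degree and
multiplies the leading coefficient by z - ζ ≠ 0. So the degree falls by exactly the number of
occurrences of z. -/
theorem tOps_powLog (z : ℂ) (Z : List ℂ) (P : ℂ[X]) (d : ℕ) (hP : ∀ k, d < k → P.coeff k = 0) :
    ∃ Q : ℂ[X], EqOn (tOps Z (powLog z P)) (powLog z Q) (Ioi 0) ∧
      (∀ k, d < k + Z.count z → Q.coeff k = 0) ∧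
      (P.coeff d ≠ 0 → Z.count z ≤ d → Q.coeff (d - Z.count z) ≠ 0) := by
  induction Z generalizing P d with
  | nil => exact ⟨P, fun _ _ => rfl, by simpa using hP, by simp⟩
  | cons ζ Z ih =>
    have h1 : EqOn (tOp ζ (powLog z P)) (powLog z (C (z - ζ) * P + derivative P)) (Ioi 0) := by
      intro t ht
      have := tDeriv_powLog z P ht
      simp only [tOp, this, powLog, eval_add, eval_mul, eval_C]
      ring
    by_cases hz : ζ = z
    · subst hz
      rcases Nat.eq_zero_or_pos d with rfl | hd
      · have h2 : C (ζ - ζ) * P + derivative P = 0 := by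
          ext k; simp [coeff_derivative, hP (k + 1) (by omega)]
        rw [h2] at h1
        refine ⟨0, ?_, by simp, fun _ h => by simp at h⟩
        have h3 : EqOn (tOp ζ (powLog ζ P)) (fun s => 0 * powLog ζ P s) (Ioi 0) := fun t ht => by
          rw [h1 ht]; simp [powLog]
        refine (tOps_congr h3 Z).trans ((tOps_const_mul (contDiffOn_powLog ζ P) 0 Z).trans
          fun t _ => ?_)
        simp [powLog]
      · obtain ⟨Q, hQ, hQ1, hQ2⟩ := ih (C (ζ - ζ) * P + derivative P) (d - 1) (fun k hk => by
          simp [coeff_derivative, hP (k + 1) (by omega)])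
        refine ⟨Q, (tOps_congr h1 Z).trans hQ, fun k hk => hQ1 k ?_, fun hPd hc => ?_⟩
        · rw [List.count_cons_self] at hk; omega
        · rw [List.count_cons_self] at hc ⊢
          have e : d - (Z.count ζ + 1) = d - 1 - Z.count ζ := by omega
          rw [e]
          refine hQ2 ?_ (by omega)
          have e2 : d - 1 + 1 = d := by omega
          simp only [sub_self, map_zero, zero_mul, zero_add, coeff_derivative, e2]
          refine mul_ne_zero hPd ?_
          exact_mod_cast (by omega : d - 1 + 1 ≠ 0)
    · obtain ⟨Q, hQ, hQ1, hQ2⟩ := ih (C (z - ζ) * P + derivative P) d (fun k hk => by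
          rw [coeff_add, coeff_C_mul, coeff_derivative, hP k hk, hP (k + 1) (by omega)]; simp)
      refine ⟨Q, (tOps_congr h1 Z).trans hQ, fun k hk => hQ1 k ?_, fun hPd hc => ?_⟩
      · rwa [List.count_cons_of_ne hz] at hk
      · rw [List.count_cons_of_ne hz] at hc ⊢
        refine hQ2 ?_ hc
        rw [coeff_add, coeff_C_mul, coeff_derivative, hP (d + 1) (by omega)]
        simp only [zero_mul, add_zero]
        exact mul_ne_zero (sub_ne_zero.2 (Ne.symm hz)) hPd

theorem norm_sub_le_of_norm_deriv_le {φ φ' : ℝ → ℂ} {b b' : ℝ → ℝ}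
    (hφ : ∀ t, 0 < t → HasDerivAt φ (φ' t) t) (hb : ∀ t, 0 < t → HasDerivAt b (b' t) t)
    (h : ∀ t ∈ Ioo (0 : ℝ) 1, ‖φ' t‖ ≤ b' t) {s t : ℝ} (hs : 0 < s) (hst : s ≤ t) (ht : t < 1) :
    ‖φ t - φ s‖ ≤ b t - b s := by
  have hc : ∀ x ∈ Icc s t, 0 < x := fun x hx => hs.trans_le hx.1
  have := image_norm_le_of_norm_deriv_right_le_deriv_boundary' (a := s) (b := t)
    (f := fun x => φ x - φ s) (f' := φ') (B := fun x => b x - b s) (B' := b')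
    (fun x hx => ((hφ x (hc x hx)).continuousAt.sub continuousAt_const).continuousWithinAt)
    (fun x hx => ((hφ x (hs.trans_le hx.1)).sub_const _).hasDerivWithinAt) (by simp)
    (fun x hx => ((hb x (hc x hx)).continuousAt.sub continuousAt_const).continuousWithinAt)
    (fun x hx => ((hb x (hs.trans_le hx.1)).sub_const _).hasDerivWithinAt)
    (fun x hx => h x ⟨hs.trans_le hx.1, hx.2.trans ht⟩)
  exact this ⟨hst, le_rfl⟩

/-- The function `t^{-ζ} h` and its derivative. -/
theorem hasDerivAt_cpow_neg_mul (hh : ContDiffOn ℝ ∞ h (Ioi 0)) (ζ : ℂ) {t : ℝ} (ht : 0 < t) :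
    HasDerivAt (fun s : ℝ => (s : ℂ) ^ (-ζ) * h s) ((t : ℂ)⁻¹ * ((t : ℂ) ^ (-ζ) * tOp ζ h t)) t := by
  have ht' : (t : ℂ) ≠ 0 := by exact_mod_cast ht.ne'
  have h1 := hasDerivAt_powLog (-ζ) 1 ht
  have e : powLog (-ζ) 1 = fun s : ℝ => (s : ℂ) ^ (-ζ) := by ext s; simp [powLog]
  rw [e] at h1
  refine (h1.mul (differentiableAt_of_contDiffOn_Ioi hh ht).hasDerivAt).congr_deriv ?_
  simp only [powLog, tOp, tDeriv, mul_one, derivative_one, add_zero, eval_C]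
  field_simp
  ring

/-- Only h itself has to be estimated: t dh/dt = ζ h + `tOp ζ h` bounds the derivatives inductively.
-/
theorem isBigOPow_of_tOp (hh : ContDiffOn ℝ ∞ h (Ioi 0)) (ho : IsBigOPow N (tOp ζ h)) {K : ℝ}
    (hK : ∀ t ∈ Ioo (0 : ℝ) 1, ‖h t‖ ≤ K * t ^ N) : IsBigOPow N h := by
  refine ⟨hh, fun k => ?_⟩
  induction k with
  | zero => exact ⟨K, hK⟩
  | succ k ih =>
    obtain ⟨C, hC⟩ := ih
    obtain ⟨D, hD⟩ := ho.bound k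
    refine ⟨‖ζ‖ * C + D, fun t ht => ?_⟩
    have e : EqOn (PushForward.tDeriv h) (fun s => ζ * h s + tOp ζ h s) (Ioi 0) := fun s _ => by
      simp only [PushForward.tOp]; ring
    have e2 := iterate_tDeriv_congr e k ht.1
    have e3 := iterate_tDeriv_add (contDiffOn_const (c := ζ) |>.mul hh) ho.contDiffOn k ht.1
    have e4 := iterate_tDeriv_const_mul hh ζ k ht.1
    simp only [] at e3 e4
    rw [Function.iterate_succ_apply, e2, e3, e4, add_mul]
    refine (norm_add_le _ _).trans (add_le_add ?_ (hD t ht))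
    rw [norm_mul, mul_assoc]
    exact mul_le_mul_of_nonneg_left (hC t ht) (norm_nonneg _)

/-- Solving `(t d/dt - ζ) h = O(t^N)` when `Re ζ < N`. -/
theorem exists_limit_of_tOp (hh : ContDiffOn ℝ ∞ h (Ioi 0)) (ho : IsBigOPow N (tOp ζ h))
    (hN : ζ.re < N) : ∃ c : ℂ,
      Tendsto (fun k : ℕ => (((1 / ((k : ℝ) + 2) : ℝ) : ℂ)) ^ (-ζ) * h (1 / ((k : ℝ) + 2))) atTop (𝓝 c) ∧
      ∃ K : ℝ, ∀ t ∈ Ioo (0 : ℝ) 1, ‖h t - c * (t : ℂ) ^ ζ‖ ≤ K * t ^ N := by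
  obtain ⟨K, hK⟩ := ho.bound 0
  set δ := N - ζ.re with hδ
  have hδ0 : 0 < δ := by simp only [hδ]; linarith
  -- The derivative of t^(-ζ) h is O(t^(δ-1)), hence integrable at 0. So t^(-ζ) h has a limit c,
  -- approached at rate t^δ.
  set φ : ℝ → ℂ := fun s => (s : ℂ) ^ (-ζ) * h s with hφ
  set b : ℝ → ℝ := fun s => |K| / δ * s ^ δ with hb
  have hbd : ∀ t, 0 < t → HasDerivAt b (|K| * t ^ (δ - 1)) t := fun t ht => by
    refine ((Real.hasDerivAt_rpow_const (p := δ) (Or.inl ht.ne')).const_mul (|K| / δ)).congr_deriv ?_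
    field_simp
  have hbound : ∀ t ∈ Ioo (0 : ℝ) 1,
      ‖(t : ℂ)⁻¹ * ((t : ℂ) ^ (-ζ) * tOp ζ h t)‖ ≤ |K| * t ^ (δ - 1) := by
    intro t ht
    have h1 : ‖tOp ζ h t‖ ≤ |K| * t ^ N := (hK t ht).trans
      (mul_le_mul_of_nonneg_right (le_abs_self K) (Real.rpow_nonneg ht.1.le _))
    rw [norm_mul, norm_mul, norm_inv, Complex.norm_real, Real.norm_of_nonneg ht.1.le,
      Complex.norm_cpow_eq_rpow_re_of_pos ht.1, Complex.neg_re]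
    have h2 : t ^ (δ - 1) = t⁻¹ * (t ^ (-ζ.re) * t ^ N) := by
      rw [← Real.rpow_add ht.1, ← Real.rpow_neg_one, ← Real.rpow_add ht.1]
      congr 1; simp only [hδ]; ring
    rw [h2]
    have h3 : 0 ≤ t⁻¹ * t ^ (-ζ.re) := mul_nonneg (inv_nonneg.2 ht.1.le) (Real.rpow_nonneg ht.1.le _)
    calc _ = t⁻¹ * t ^ (-ζ.re) * ‖tOp ζ h t‖ := by ring
      _ ≤ t⁻¹ * t ^ (-ζ.re) * (|K| * t ^ N) := mul_le_mul_of_nonneg_left h1 h3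
      _ = _ := by ring
  have hdiff : ∀ s t : ℝ, 0 < s → s ≤ t → t < 1 → ‖φ t - φ s‖ ≤ b t := by
    intro s t hs hst ht
    have h1 := norm_sub_le_of_norm_deriv_le (fun t ht => hasDerivAt_cpow_neg_mul hh ζ ht) hbd
      hbound hs hst ht
    have h2 : 0 ≤ b s := mul_nonneg (div_nonneg (abs_nonneg _) hδ0.le) (Real.rpow_nonneg hs.le _)
    exact h1.trans (by linarith)
  have hbmono : ∀ s t : ℝ, 0 < s → s ≤ t → b s ≤ b t := fun s t hs hst =>
    mul_le_mul_of_nonneg_left (Real.rpow_le_rpow hs.le hst hδ0.le) (div_nonneg (abs_nonneg _) hδ0.le)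
  -- A fixed sequence in (0, 1) tending to 0. Constants c obtained for different N are limits along
  -- the same sequence and therefore agree.
  set σ : ℕ → ℝ := fun k => 1 / ((k : ℝ) + 2) with hσ
  have hσ0 : ∀ k, 0 < σ k := fun k => by simp only [hσ]; positivity
  have hσ1 : ∀ k, σ k < 1 := fun k => by
    simp only [hσ]; rw [div_lt_one (by positivity)]; linarith [(Nat.cast_nonneg k : (0 : ℝ) ≤ k)]
  have hσm : ∀ k l, k ≤ l → σ l ≤ σ k := fun k l hkl => by
    simp only [hσ]
    have : (k : ℝ) ≤ l := by exact_mod_cast hkl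
    gcongr
  have hσlim : Tendsto σ atTop (𝓝 0) := by
    have := tendsto_one_div_add_atTop_nhds_zero_nat (𝕜 := ℝ)
    have h2 := (tendsto_add_atTop_iff_nat (f := fun n : ℕ => 1 / ((n : ℝ) + 1)) 1).2 this
    refine h2.congr fun k => ?_
    simp only [hσ]; push_cast; ring
  have hblim : Tendsto (fun k => b (σ k)) atTop (𝓝 0) := by
    have h1 : ContinuousAt b 0 := by
      refine continuousAt_const.mul (Real.continuousAt_rpow_const 0 δ (Or.inr hδ0.le))
    have h2 : b 0 = 0 := by simp only [hb]; rw [Real.zero_rpow hδ0.ne', mul_zero]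
    have h3 := h1.tendsto.comp hσlim
    rwa [h2] at h3
  have hcauchy : CauchySeq fun k => φ (σ k) := by
    refine cauchySeq_of_le_tendsto_0 (fun k => b (σ k)) (fun k l M hk hl => ?_) hblim
    rw [dist_eq_norm]
    rcases le_total (σ k) (σ l) with h1 | h1
    · rw [norm_sub_rev]
      exact (hdiff _ _ (hσ0 k) h1 (hσ1 l)).trans (hbmono _ _ (hσ0 l) (hσm _ _ hl))
    · exact (hdiff _ _ (hσ0 l) h1 (hσ1 k)).trans (hbmono _ _ (hσ0 k) (hσm _ _ hk))
  obtain ⟨c, hc⟩ := cauchySeq_tendsto_of_complete hcauchy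
  refine ⟨c, hc, |K| / δ, fun t ht => ?_⟩
  have h1 : ‖φ t - c‖ ≤ b t := by
    refine le_of_tendsto (tendsto_const_nhds.sub hc).norm ?_
    filter_upwards [hσlim.eventually (gt_mem_nhds ht.1)] with k hk
    exact hdiff _ _ (hσ0 k) hk.le ht.2
  have ht' : (t : ℂ) ≠ 0 := by exact_mod_cast ht.1.ne'
  have h2 : h t - c * (t : ℂ) ^ ζ = (t : ℂ) ^ ζ * (φ t - c) := by
    simp only [hφ]
    rw [mul_sub, ← mul_assoc, ← Complex.cpow_add _ _ ht', add_neg_cancel, Complex.cpow_zero]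
    ring
  have h3 : t ^ N = t ^ ζ.re * t ^ δ := by
    rw [← Real.rpow_add ht.1]; congr 1; simp only [hδ]; ring
  rw [h2, norm_mul, Complex.norm_cpow_eq_rpow_re_of_pos ht.1, h3]
  calc _ ≤ t ^ ζ.re * b t := mul_le_mul_of_nonneg_left h1 (Real.rpow_nonneg ht.1.le _)
    _ = _ := by simp only [hb]; ring

/-- Solving `(t d/dt - ζ) h = O(t^N)` when `N < Re ζ`. -/
theorem bound_of_tOp_of_lt (hh : ContDiffOn ℝ ∞ h (Ioi 0)) (ho : IsBigOPow N (tOp ζ h))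
    (hN : N < ζ.re) : ∃ K : ℝ, ∀ t ∈ Ioo (0 : ℝ) 1, ‖h t‖ ≤ K * t ^ N := by
  obtain ⟨K, hK⟩ := ho.bound 0
  set δ := ζ.re - N with hδ
  have hδ0 : 0 < δ := by simp only [hδ]; linarith
  set φ : ℝ → ℂ := fun s => (s : ℂ) ^ (-ζ) * h s with hφ
  set b : ℝ → ℝ := fun s => -(|K| / δ) * s ^ (-δ) with hb
  have hbd : ∀ t, 0 < t → HasDerivAt b (|K| * t ^ (-δ - 1)) t := fun t ht => by
    refine ((Real.hasDerivAt_rpow_const (p := -δ) (Or.inl ht.ne')).const_mul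
      (-(|K| / δ))).congr_deriv ?_
    field_simp
  have hbound : ∀ t ∈ Ioo (0 : ℝ) 1,
      ‖(t : ℂ)⁻¹ * ((t : ℂ) ^ (-ζ) * tOp ζ h t)‖ ≤ |K| * t ^ (-δ - 1) := by
    intro t ht
    have h1 : ‖tOp ζ h t‖ ≤ |K| * t ^ N := (hK t ht).trans
      (mul_le_mul_of_nonneg_right (le_abs_self K) (Real.rpow_nonneg ht.1.le _))
    rw [norm_mul, norm_mul, norm_inv, Complex.norm_real, Real.norm_of_nonneg ht.1.le,
      Complex.norm_cpow_eq_rpow_re_of_pos ht.1, Complex.neg_re]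
    have h2 : t ^ (-δ - 1) = t⁻¹ * (t ^ (-ζ.re) * t ^ N) := by
      rw [← Real.rpow_add ht.1, ← Real.rpow_neg_one, ← Real.rpow_add ht.1]
      congr 1; simp only [hδ]; ring
    rw [h2]
    have h3 : 0 ≤ t⁻¹ * t ^ (-ζ.re) := mul_nonneg (inv_nonneg.2 ht.1.le) (Real.rpow_nonneg ht.1.le _)
    calc _ = t⁻¹ * t ^ (-ζ.re) * ‖tOp ζ h t‖ := by ring
      _ ≤ t⁻¹ * t ^ (-ζ.re) * (|K| * t ^ N) := mul_le_mul_of_nonneg_left h1 h3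
      _ = _ := by ring
  have hdiff : ∀ s t : ℝ, 0 < s → s ≤ t → t < 1 → ‖φ t - φ s‖ ≤ b t - b s :=
    fun s t hs hst ht => norm_sub_le_of_norm_deriv_le
      (fun t ht => hasDerivAt_cpow_neg_mul hh ζ ht) hbd hbound hs hst ht
  -- Here the bound for the derivative is not integrable at 0; it is integrated between t and 1/2
  -- instead.
  have hφb : ∀ t ∈ Ioo (0 : ℝ) 1, ‖φ t‖ ≤ ‖φ (1 / 2)‖ + |b (1 / 2)| + |b t| := by
    intro t ht
    have h1 : ‖φ t‖ ≤ ‖φ (1 / 2)‖ + ‖φ t - φ (1 / 2)‖ := by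
      have := norm_add_le (φ (1 / 2)) (φ t - φ (1 / 2))
      simpa using this
    have h2 := le_abs_self (b t)
    have h3 := neg_abs_le (b t)
    have h4 := le_abs_self (b (1 / 2))
    have h5 := neg_abs_le (b (1 / 2))
    rcases le_total t (1 / 2) with h | h
    · have := hdiff t (1 / 2) ht.1 h (by norm_num)
      rw [norm_sub_rev] at this
      linarith
    · have := hdiff (1 / 2) t (by norm_num) h ht.2
      linarith
  refine ⟨‖φ (1 / 2)‖ + |b (1 / 2)| + |K| / δ, fun t ht => ?_⟩
  have ht' : (t : ℂ) ≠ 0 := by exact_mod_cast ht.1.ne'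
  have h2 : h t = (t : ℂ) ^ ζ * φ t := by
    simp only [hφ]
    rw [← mul_assoc, ← Complex.cpow_add _ _ ht', add_neg_cancel, Complex.cpow_zero, one_mul]
  have h3 : t ^ N = t ^ ζ.re * t ^ (-δ) := by
    rw [← Real.rpow_add ht.1]; congr 1; simp only [hδ]; ring
  have h4 : |b t| = |K| / δ * t ^ (-δ) := by
    simp only [hb]
    rw [abs_mul, abs_neg, abs_of_nonneg (div_nonneg (abs_nonneg K) hδ0.le),
      abs_of_nonneg (Real.rpow_nonneg ht.1.le _)]
  have h5 : (1 : ℝ) ≤ t ^ (-δ) := Real.one_le_rpow_of_pos_of_le_one_of_nonpos ht.1 ht.2.le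
    (by linarith)
  rw [h2, norm_mul, Complex.norm_cpow_eq_rpow_re_of_pos ht.1, h3]
  have h6 := hφb t ht
  rw [h4] at h6
  have h7 : 0 ≤ ‖φ (1 / 2)‖ + |b (1 / 2)| := by positivity
  calc _ ≤ t ^ ζ.re * ((‖φ (1 / 2)‖ + |b (1 / 2)|) * t ^ (-δ) + |K| / δ * t ^ (-δ)) := by
        refine mul_le_mul_of_nonneg_left (h6.trans ?_) (Real.rpow_nonneg ht.1.le _)
        nlinarith
    _ = _ := by ring

/-- Solving `(t d/dt - ζ) h = O(t^N)`. -/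
theorem exists_leading_term (hh : IsBigOPowLT N₀ h) (ho : IsBigOPowLT N (tOp ζ h)) :
    ∃ c : ℂ, (c ≠ 0 → N₀ ≤ ζ.re ∧ ζ.re < N) ∧ IsBigOPowLT N fun s => h s - c * powLog ζ 1 s := by
  have hs := hh.contDiffOn
  -- If Re ζ ≥ N, every N' < N lies strictly below Re ζ and no homogeneous solution t^ζ is needed.
  -- The borderline Re ζ = N is harmless because only exponents N' < N are claimed.
  rcases le_or_gt N ζ.re with hN | hN
  · refine ⟨0, by simp, fun N' hN' => ?_⟩
    obtain ⟨K, hK⟩ := bound_of_tOp_of_lt hs (ho N' hN') (hN'.trans_le hN)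
    exact (isBigOPow_of_tOp hs (ho N' hN') hK).congr fun s _ => by simp
  · obtain ⟨c, hc, -⟩ := exists_limit_of_tOp hs (ho ((ζ.re + N) / 2) (by linarith)) (by linarith)
    refine ⟨c, fun hc0 => ⟨?_, hN⟩, fun N' hN' => ?_⟩
    · by_contra hlt
      push Not at hlt
      apply hc0
      -- If Re ζ < N₀, then h is O(t^N1) with N1 > Re ζ, so t^(-ζ) h tends to 0 and c vanishes.
      set N1 := (ζ.re + N₀) / 2 with hN1
      obtain ⟨K, hK⟩ := (hh N1 (by simp only [hN1]; linarith)).bound 0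
      refine tendsto_nhds_unique hc (squeeze_zero_norm
        (a := fun k : ℕ => |K| * (1 / ((k : ℝ) + 2)) ^ (N1 - ζ.re)) (fun k => ?_) ?_)
      · have h0 : (0 : ℝ) < 1 / ((k : ℝ) + 2) := by positivity
        have h1 : 1 / ((k : ℝ) + 2) < 1 := by
          rw [div_lt_one (by positivity)]; linarith [(Nat.cast_nonneg k : (0 : ℝ) ≤ k)]
        rw [norm_mul, Complex.norm_cpow_eq_rpow_re_of_pos h0, Complex.neg_re]
        have h2 : ‖h (1 / ((k : ℝ) + 2))‖ ≤ |K| * (1 / ((k : ℝ) + 2)) ^ N1 := (hK _ ⟨h0, h1⟩).trans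
          (mul_le_mul_of_nonneg_right (le_abs_self K) (Real.rpow_nonneg h0.le _))
        calc _ ≤ (1 / ((k : ℝ) + 2)) ^ (-ζ.re) * (|K| * (1 / ((k : ℝ) + 2)) ^ N1) :=
              mul_le_mul_of_nonneg_left h2 (Real.rpow_nonneg h0.le _)
          _ = _ := by
            rw [sub_eq_add_neg, Real.rpow_add h0]; ring
      · have hpos : 0 < N1 - ζ.re := by simp only [hN1]; linarith
        have h1 : Tendsto (fun k : ℕ => 1 / ((k : ℝ) + 2)) atTop (𝓝 0) := by
          have h2 := (tendsto_add_atTop_iff_nat (f := fun n : ℕ => 1 / ((n : ℝ) + 1)) 1).2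
            (tendsto_one_div_add_atTop_nhds_zero_nat (𝕜 := ℝ))
          refine h2.congr fun k => ?_
          push_cast; ring
        have h3 := (Real.continuousAt_rpow_const 0 (N1 - ζ.re) (Or.inr hpos.le)).tendsto.comp h1
        rw [Real.zero_rpow hpos.ne'] at h3
        simpa using h3.const_mul |K|
    · set N2 := max N' ((ζ.re + N) / 2) with hN2
      have hN2N : N2 < N := max_lt hN' (by linarith)
      obtain ⟨c', hc', K, hK⟩ := exists_limit_of_tOp hs (ho N2 hN2N)
        (lt_of_lt_of_le (by linarith) (le_max_right _ _))
      obtain rfl := tendsto_nhds_unique hc hc'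
      have hpl := contDiffOn_powLog ζ 1
      have e1 : EqOn (tOp ζ fun s => h s - c * powLog ζ 1 s) (tOp ζ h) (Ioi 0) := by
        intro t ht
        have e2 := tOps_add hs (contDiffOn_const (c := -c) |>.mul hpl) [ζ] ht
        have e3 := tOps_const_mul hpl (-c) [ζ] ht
        have e4 := tDeriv_powLog ζ 1 ht
        have e5 : tOps [ζ] (powLog ζ 1) t = 0 := by
          simp only [tOps, List.foldl_cons, List.foldl_nil, tOp, e4, powLog, mul_one,
            derivative_one, add_zero, eval_C, eval_one]
          ring
        have e6 : (fun s => h s - c * powLog ζ 1 s) = fun s => h s + -c * powLog ζ 1 s := by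
          ext s; ring
        simp only [] at e2 e3
        rw [e3, e5, mul_zero, add_zero] at e2
        rw [e6]
        exact e2
      refine IsBigOPow.mono (N := N2) (isBigOPow_of_tOp (K := K) (ζ := ζ)
        (hs.sub (contDiffOn_const.mul hpl)) ((ho N2 hN2N).congr e1.symm) fun t ht => ?_) (le_max_left _ _)
      simpa [powLog] using hK t ht

end HalfLine

/-! ### Expansions obtained from products of operators -/

section HalfLine

open Polynomial

variable {g h v w : ℝ → ℂ} {N N' N₀ : ℝ} {ζ : ℂ}

theorem IsBigOPowLT.congr (hg : IsBigOPowLT N g) (hgh : EqOn g h (Ioi 0)) : IsBigOPowLT N h :=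
  fun N' hN' => (hg N' hN').congr hgh

theorem IsBigOPowLT.add (hg : IsBigOPowLT N g) (hh : IsBigOPowLT N h) :
    IsBigOPowLT N fun s => g s + h s := fun N' hN' => (hg N' hN').add (hh N' hN')

theorem IsBigOPowLT.const_mul (hh : IsBigOPowLT N h) (c : ℂ) : IsBigOPowLT N fun s => c * h s :=
  fun N' hN' => (hh N' hN').const_mul c

theorem IsBigOPowLT.tOps (hh : IsBigOPowLT N h) (Z : List ℂ) : IsBigOPowLT N (tOps Z h) :=
  fun _ hM => (hh _ hM).tOps Z

theorem IsBigOPow.isBigOPowLT (hh : IsBigOPow N h) : IsBigOPowLT N h :=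
  fun _ hM => hh.mono hM.le

theorem isBigOPowLT_powLog {z : ℂ} (P : ℂ[X]) (hN : N ≤ z.re) : IsBigOPowLT N (powLog z P) :=
  fun _ hM => isBigOPow_powLog P (hM.trans_le hN)

/-- The finite sum `∑ c_q t^z (log t)^p`, `q = (z, p)`. -/
def logPoly (a : (ℂ × ℕ) →₀ ℂ) : ℝ → ℂ :=
  fun s => a.sum fun q c => c * powLog q.1 (X ^ q.2) s

theorem logPoly_add (a b : (ℂ × ℕ) →₀ ℂ) (s : ℝ) :
    logPoly (a + b) s = logPoly a s + logPoly b s :=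
  Finsupp.sum_add_index' (by simp) (by intros; ring)

theorem logPoly_single (q : ℂ × ℕ) (c : ℂ) (s : ℝ) :
    logPoly (Finsupp.single q c) s = c * powLog q.1 (X ^ q.2) s :=
  Finsupp.sum_single_index (by simp)

theorem contDiffOn_logPoly (a : (ℂ × ℕ) →₀ ℂ) : ContDiffOn ℝ ∞ (logPoly a) (Ioi 0) :=
  ContDiffOn.sum fun q _ => contDiffOn_const.mul (contDiffOn_powLog q.1 _)

/-- Solving `tOps Z v = O(t^N)`. -/
theorem exists_logPoly_of_tOps (Z : List ℂ) (hv : IsBigOPowLT N₀ v)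
    (ho : IsBigOPowLT N (tOps Z v)) :
    ∃ a : (ℂ × ℕ) →₀ ℂ, (∀ q, a q ≠ 0 → N₀ ≤ q.1.re ∧ q.1.re < N ∧ q.2 < Z.count q.1) ∧
      IsBigOPowLT N fun s => v s - logPoly a s := by
  induction Z using List.reverseRecOn generalizing v with
  | nil => exact ⟨0, by simp, ho.congr fun s _ => by simp [logPoly, tOps]⟩
  | append_singleton Z ζ ih =>
    rw [tOps_append] at ho
    obtain ⟨c, hc, hO⟩ := exists_leading_term (hv.tOps Z) ho
    by_cases hc0 : c = 0
    · subst hc0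
      obtain ⟨a, ha, hA⟩ := ih hv (hO.congr fun s _ => by simp)
      refine ⟨a, fun q hq => ⟨(ha q hq).1, (ha q hq).2.1, (ha q hq).2.2.trans_le ?_⟩, hA⟩
      simp
    · obtain ⟨h1, h2⟩ := hc hc0
      -- The earlier operators map t^ζ (log t)^k to a non-zero multiple of t^ζ, because k is the
      -- number of times ζ occurs among them. Subtracting a suitable multiple of it from v therefore
      -- removes the leading term c t^ζ found above.
      set k := Z.count ζ with hk
      obtain ⟨Q, hQ, hQ0, hQ1⟩ := tOps_powLog ζ Z (X ^ k) k (fun i hi => by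
        rw [coeff_X_pow, if_neg (by omega)])
      have hK : Q.coeff 0 ≠ 0 := by
        have := hQ1 (by simp) le_rfl
        simpa [← hk] using this
      have hQC : Q = C (Q.coeff 0) := by
        ext i
        rcases Nat.eq_zero_or_pos i with rfl | hi
        · simp
        · rw [hQ0 i (by omega), coeff_C, if_neg (by omega)]
      set b := c / Q.coeff 0 with hb
      have hpl := contDiffOn_powLog ζ (X ^ k)
      have hv' : IsBigOPowLT N₀ fun s => v s + -b * powLog ζ (X ^ k) s :=
        hv.add ((isBigOPowLT_powLog _ h1).const_mul _)
      have e : EqOn (fun s => tOps Z v s - c * powLog ζ 1 s)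
          (tOps Z fun s => v s + -b * powLog ζ (X ^ k) s) (Ioi 0) := by
        intro t ht
        have e1 := tOps_add hv.contDiffOn (contDiffOn_const (c := -b) |>.mul hpl) Z ht
        have e2 := tOps_const_mul hpl (-b) Z ht
        have e3 := hQ ht
        simp only [] at e1 e2
        rw [e1, e2, e3]
        have e4 : powLog ζ Q t = Q.coeff 0 * powLog ζ 1 t := by
          conv_lhs => rw [hQC]
          simp [powLog]; ring
        rw [e4, hb]; field_simp; ring
      obtain ⟨a, ha, hA⟩ := ih hv' (hO.congr e)
      refine ⟨a + Finsupp.single (ζ, k) b, fun q hq => ?_, hA.congr fun s _ => ?_⟩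
      · by_cases hq' : a q = 0
        · rw [Finsupp.add_apply, hq', zero_add] at hq
          obtain rfl : (ζ, k) = q := by
            by_contra hne
            exact hq (Finsupp.single_eq_of_ne (Ne.symm hne))
          refine ⟨h1, h2, ?_⟩
          simp [hk]
        · refine ⟨(ha q hq').1, (ha q hq').2.1, (ha q hq').2.2.trans_le ?_⟩
          simp
      · simp only [logPoly_add, logPoly_single]; ring

theorem tOps_logPoly_eq_zero (Z : List ℂ) (a : (ℂ × ℕ) →₀ ℂ)
    (ha : ∀ q, a q ≠ 0 → q.2 < Z.count q.1) : EqOn (tOps Z (logPoly a)) (fun _ => 0) (Ioi 0) := by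
  classical
  induction a using Finsupp.induction with
  | zero =>
    intro t ht
    have h1 := tOps_const_mul (h := fun _ => 0) contDiffOn_const 0 Z ht
    simp only [zero_mul] at h1
    have h2 : logPoly 0 = fun _ => 0 := by ext s; simp [logPoly]
    rw [h2]; exact h1
  | single_add q c a hqa hc ih =>
    intro t ht
    have hsum : ∀ q', (Finsupp.single q c + a) q' = 0 ∨ q'.2 < Z.count q'.1 := fun q' =>
      or_iff_not_imp_left.2 fun h => ha q' h
    have haq : a q = 0 := Finsupp.notMem_support_iff.1 hqa
    have e0 : logPoly (Finsupp.single q c + a)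
        = fun s => c * powLog q.1 (X ^ q.2) s + logPoly a s := by
      ext s; rw [logPoly_add, logPoly_single]
    have hpl := contDiffOn_powLog q.1 (X ^ q.2)
    have e1 := tOps_add (contDiffOn_const (c := c) |>.mul hpl) (contDiffOn_logPoly a) Z ht
    have e2 := tOps_const_mul hpl c Z ht
    have e3 := ih (fun q' hq' => (hsum q').resolve_left (by
      have : q' ≠ q := fun h => hq' (h ▸ haq)
      rw [Finsupp.add_apply, Finsupp.single_eq_of_ne this, zero_add]
      exact hq')) ht
    have hq : q.2 < Z.count q.1 := (hsum q).resolve_left (by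
      rw [Finsupp.add_apply, haq, Finsupp.single_eq_same, add_zero]; exact hc)
    obtain ⟨Q, hQ, hQ0, -⟩ := tOps_powLog q.1 Z (X ^ q.2) q.2 (fun i hi => by
        rw [coeff_X_pow, if_neg (by omega)])
    have hQz : Q = 0 := by ext i; simpa using hQ0 i (by omega)
    have e4 := hQ ht
    simp only [] at e1 e2 e3
    rw [e0, e1, e2, e3, e4, hQz]
    simp [powLog]

/-- `v` has an expansion on the half-line with coefficients supported in `F`. -/
def HasExpansion (F : Set (ℂ × ℕ)) (v : ℝ → ℂ) : Prop :=
  ∃ a : ℂ × ℕ → ℂ, (∀ q ∉ F, a q = 0) ∧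
    (∀ N : ℝ, {q : ℂ × ℕ | a q ≠ 0 ∧ q.1.re ≤ N}.Finite) ∧
    ∀ N : ℝ, IsBigOPow N fun s : ℝ => v s - ∑ᶠ (q : ℂ × ℕ) (_ : q.1.re ≤ N),
      a q * (s : ℂ) ^ q.1 * ((Real.log s : ℝ) : ℂ) ^ q.2

theorem finsum_expansion_eq (a : ℂ × ℕ → ℂ) (N : ℝ) (T : Finset (ℂ × ℕ))
    (hT : ∀ q, a q ≠ 0 → q.1.re ≤ N → q ∈ T) (s : ℝ) :
    ∑ᶠ (q : ℂ × ℕ) (_ : q.1.re ≤ N), a q * (s : ℂ) ^ q.1 * ((Real.log s : ℝ) : ℂ) ^ q.2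
      = ∑ q ∈ T with q.1.re ≤ N, a q * powLog q.1 (X ^ q.2) s := by
  have h1 := finsum_mem_eq_sum_of_inter_support_eq
    (f := fun q : ℂ × ℕ => a q * (s : ℂ) ^ q.1 * ((Real.log s : ℝ) : ℂ) ^ q.2)
    (s := {q : ℂ × ℕ | q.1.re ≤ N}) (t := {q ∈ T | q.1.re ≤ N}) (by
      ext q
      simp only [mem_inter_iff, mem_ofPred_eq, Function.mem_support, Finset.coe_filter]
      constructor
      · rintro ⟨h2, h3⟩
        exact ⟨⟨hT q (fun h => h3 (by simp [h])) h2, h2⟩, h3⟩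
      · rintro ⟨⟨_, h2⟩, h3⟩
        exact ⟨h2, h3⟩)
  refine (Eq.trans ?_ h1).trans (Finset.sum_congr rfl fun q _ => ?_)
  · rfl
  · simp [powLog, mul_assoc]

theorem HasExpansion.isNiceHalfLine {F : Set (ℂ × ℕ)} (hv : HasExpansion F v)
    (hs : ContDiffOn ℝ ∞ v (Ioi 0)) : IsNiceHalfLine F v := by
  obtain ⟨a, h1, h2, h3⟩ := hv
  exact ⟨hs, a, h1, h2, fun N k => (h3 N).bound k⟩

theorem HasExpansion.mono {F F' : Set (ℂ × ℕ)} (hv : HasExpansion F v) (hF : F ⊆ F') :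
    HasExpansion F' v := by
  obtain ⟨a, h1, h2, h3⟩ := hv
  exact ⟨a, fun q hq => h1 q fun h => hq (hF h), h2, h3⟩

theorem hasExpansion_zero {F : Set (ℂ × ℕ)} : HasExpansion F fun _ => 0 :=
  ⟨fun _ => 0, fun _ _ => rfl, by simp, fun N => isBigOPow_zero.congr fun s _ => by simp⟩

theorem HasExpansion.add {F : Set (ℂ × ℕ)} (hv : HasExpansion F v) (hw : HasExpansion F w) :
    HasExpansion F fun s => v s + w s := by
  classical
  obtain ⟨a, h1, h2, h3⟩ := hv
  obtain ⟨b, k1, k2, k3⟩ := hw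
  refine ⟨fun q => a q + b q, fun q hq => by simp [h1 q hq, k1 q hq], fun N => ?_, fun N => ?_⟩
  · refine ((h2 N).union (k2 N)).subset fun q hq => ?_
    by_cases ha : a q = 0
    · exact Or.inr ⟨fun hb => hq.1 (by simp [ha, hb]), hq.2⟩
    · exact Or.inl ⟨ha, hq.2⟩
  · refine ((h3 N).add (k3 N)).congr fun s _ => ?_
    set T := (h2 N).toFinset ∪ (k2 N).toFinset with hTdef
    have hTa : ∀ q, a q ≠ 0 → q.1.re ≤ N → q ∈ T := fun q h h' => by simp [T, h, h']
    have hTb : ∀ q, b q ≠ 0 → q.1.re ≤ N → q ∈ T := fun q h h' => by simp [T, h, h']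
    simp only []
    rw [finsum_expansion_eq a N T hTa, finsum_expansion_eq b N T hTb,
      finsum_expansion_eq (fun q => a q + b q) N T (fun q h h' => by
        by_cases ha : a q = 0
        · exact hTb q (fun hb => h (by simp [ha, hb])) h'
        · exact hTa q ha h')]
    simp only [add_mul, Finset.sum_add_distrib]
    ring

theorem HasExpansion.sum {ι : Type*} (T : Finset ι) {F : Set (ℂ × ℕ)} {v : ι → ℝ → ℂ}
    (hv : ∀ i ∈ T, HasExpansion F (v i)) : HasExpansion F fun s => ∑ i ∈ T, v i s := by
  classical
  induction T using Finset.induction_on with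
  | empty => simpa using hasExpansion_zero
  | insert a T ha ih =>
    simp only [Finset.sum_insert ha]
    exact (hv a (by simp)).add (ih fun i hi => hv i (by simp [hi]))

/-- An expansion exists if suitable products of operators `t d/dt - ζ` improve the decay. -/
theorem hasExpansion_of_tOps {A : ℝ} (ρ : ℂ → ℕ) (hv : IsBigOPowLT A v)
    (ho : ∀ N : ℝ, ∃ Z : List ℂ, (∀ ζ : ℂ, ζ.re < N → Z.count ζ = ρ ζ) ∧
      IsBigOPowLT N (tOps Z v)) :
    HasExpansion {q | q.2 < ρ q.1} v := by
  classical
  -- The expansion is built one unit of decay at a time. A step only adds terms with Re z ≥ A + k,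
  -- so coefficients found earlier never change.
  let P : ℕ → ((ℂ × ℕ) →₀ ℂ) → Prop := fun k b =>
    (∀ q, b q ≠ 0 → A ≤ q.1.re ∧ q.1.re < A + k ∧ q.2 < ρ q.1) ∧
      IsBigOPowLT (A + k) fun s => v s - logPoly b s
  have step : ∀ k b, P k b → ∃ b', P (k + 1) b' ∧ ∀ q : ℂ × ℕ, q.1.re < A + k → b' q = b q := by
    rintro k b ⟨hb1, hb2⟩
    obtain ⟨Z, hZ, hZo⟩ := ho (A + (k + 1 : ℕ))
    have hlt : (A + k : ℝ) < A + (k + 1 : ℕ) := by push_cast; linarith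
    -- The terms already found are annihilated by the new operators, so subtracting them from v does
    -- not affect the decay provided by `ho`.
    have hkill := tOps_logPoly_eq_zero Z b fun q hq => by
      rw [hZ q.1 ((hb1 q hq).2.1.trans hlt)]; exact (hb1 q hq).2.2
    have e : EqOn (tOps Z v) (tOps Z fun s => v s - logPoly b s) (Ioi 0) := by
      intro t ht
      have e1 := tOps_add hv.contDiffOn (contDiffOn_const (c := -1) |>.mul (contDiffOn_logPoly b))
        Z ht
      have e2 := tOps_const_mul (contDiffOn_logPoly b) (-1) Z ht
      have e3 := hkill ht
      simp only [] at e1 e2 e3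
      rw [e2, e3] at e1
      have e4 : (fun s => v s - logPoly b s) = fun s => v s + -1 * logPoly b s := by ext s; ring
      rw [e4, e1]; ring
    obtain ⟨σ, hσ, hσO⟩ := exists_logPoly_of_tOps Z hb2 (hZo.congr e)
    refine ⟨b + σ, ⟨fun q hq => ?_, hσO.congr fun s _ => by simp only [logPoly_add]; ring⟩,
      fun q hq => ?_⟩
    · by_cases hbq : b q = 0
      · rw [Finsupp.add_apply, hbq, zero_add] at hq
        obtain ⟨h1, h2, h3⟩ := hσ q hq
        refine ⟨le_trans (by linarith [(Nat.cast_nonneg k : (0 : ℝ) ≤ k)]) h1, h2, ?_⟩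
        rwa [hZ q.1 h2] at h3
      · obtain ⟨h1, h2, h3⟩ := hb1 q hbq
        exact ⟨h1, h2.trans hlt, h3⟩
    · rw [Finsupp.add_apply]
      by_contra hne
      have : σ q ≠ 0 := fun h => hne (by rw [h, add_zero])
      linarith [(hσ q this).1]
  choose! Φ hΦ using step
  let b : ℕ → (ℂ × ℕ) →₀ ℂ := fun k => Nat.rec 0 (fun k b => Φ k b) k
  have hbP : ∀ k, P k (b k) := by
    intro k
    induction k with
    | zero =>
      refine ⟨fun q hq => absurd rfl hq, fun M hM => (hv M ?_).congr fun s _ => ?_⟩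
      · simpa using hM
      · simp [b, logPoly]
    | succ k ih => exact (hΦ k (b k) ih).1
  have hbs : ∀ (k : ℕ) (q : ℂ × ℕ), q.1.re < A + k → b (k + 1) q = b k q := fun k =>
    (hΦ k (b k) (hbP k)).2
  have hbl : ∀ k l : ℕ, k ≤ l → ∀ q : ℂ × ℕ, q.1.re < A + k → b l q = b k q := by
    intro k l hkl q hq
    induction l, hkl using Nat.le_induction with
    | base => rfl
    | succ l hkl ih =>
      rw [hbs l q (hq.trans_le ?_), ih]
      have : (k : ℝ) ≤ l := by exact_mod_cast hkl
      linarith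
  -- At this index the bound A + k exceeds Re z, so the coefficient at q is final. For Re z < A the
  -- natural floor is 0.
  set a : ℂ × ℕ → ℂ := fun q => b (⌊q.1.re - A⌋₊ + 1) q with ha
  have hfl : ∀ q : ℂ × ℕ, q.1.re < A + (⌊q.1.re - A⌋₊ + 1 : ℕ) := fun q => by
    have := Nat.lt_floor_add_one (q.1.re - A); push_cast; linarith
  have hab : ∀ (k : ℕ) (q : ℂ × ℕ), q.1.re < A + k → a q = b k q := by
    intro k q hq
    rcases le_total k (⌊q.1.re - A⌋₊ + 1) with h | h
    · exact hbl k _ h q hq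
    · exact (hbl _ k h q (hfl q)).symm
  refine ⟨a, fun q hq => ?_, fun N => ?_, fun N => ?_⟩
  · by_contra hne
    exact hq ((hbP (⌊q.1.re - A⌋₊ + 1)).1 q hne).2.2
  · obtain ⟨k, hk⟩ := exists_nat_gt (N - A)
    refine (b k).support.finite_toSet.subset fun q hq => ?_
    rw [Finset.mem_coe, Finsupp.mem_support_iff, ← hab k q (by linarith [hq.2])]
    exact hq.1
  · obtain ⟨k, hk⟩ := exists_nat_gt (N - A)
    have h1 := (hbP k).2 N (by linarith)
    -- The finite sum `b k` may extend beyond N; its surplus terms are O(t^N).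
    have h2 : IsBigOPow N fun s => ∑ q ∈ (b k).support with ¬ q.1.re ≤ N,
        b k q * powLog q.1 (X ^ q.2) s :=
      IsBigOPow.sum _ fun q hq => (isBigOPow_powLog _
        (not_le.1 (Finset.mem_filter.1 hq).2)).const_mul _
    refine (h1.add h2).congr fun s _ => ?_
    simp only []
    rw [finsum_expansion_eq a N (b k).support (fun q hq hqN => by
      rw [Finsupp.mem_support_iff, ← hab k q (by linarith)]; exact hq)]
    have h3 : ∑ q ∈ (b k).support with q.1.re ≤ N, a q * powLog q.1 (X ^ q.2) s
        = ∑ q ∈ (b k).support with q.1.re ≤ N, b k q * powLog q.1 (X ^ q.2) s :=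
      Finset.sum_congr rfl fun q hq => by
        rw [hab k q (by linarith [(Finset.mem_filter.1 hq).2])]
    have h4 := Finset.sum_filter_add_sum_filter_not (b k).support (fun q : ℂ × ℕ => q.1.re ≤ N)
      fun q => b k q * powLog q.1 (X ^ q.2) s
    have h5 : logPoly (b k) s = ∑ q ∈ (b k).support, b k q * powLog q.1 (X ^ q.2) s := rfl
    rw [h3, h5, ← h4]; ring

/-- Multiplication by `t^c`. -/
theorem tOp_cpow_mul (hh : ContDiffOn ℝ ∞ h (Ioi 0)) (c ζ : ℂ) :
    EqOn (tOp (ζ + c) fun s => (s : ℂ) ^ c * h s) (fun s => (s : ℂ) ^ c * tOp ζ h s) (Ioi 0) := by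
  intro t ht
  have h1 := hasDerivAt_cpow_neg_mul hh (-c) ht
  have ht' : (t : ℂ) ≠ 0 := by exact_mod_cast (ne_of_gt ht : (t : ℝ) ≠ 0)
  simp only [neg_neg] at h1
  simp only [tOp, tDeriv, h1.deriv]
  field_simp
  ring

theorem contDiffOn_cpow_mul (hh : ContDiffOn ℝ ∞ h (Ioi 0)) (c : ℂ) :
    ContDiffOn ℝ ∞ (fun s : ℝ => (s : ℂ) ^ c * h s) (Ioi 0) := by
  refine ((contDiffOn_powLog c 1).mul hh).congr fun s _ => ?_
  simp [powLog]

theorem tOps_cpow_mul (hh : ContDiffOn ℝ ∞ h (Ioi 0)) (c : ℂ) (Z : List ℂ) :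
    EqOn (tOps (Z.map (· + c)) fun s => (s : ℂ) ^ c * h s)
      (fun s => (s : ℂ) ^ c * tOps Z h s) (Ioi 0) := by
  induction Z generalizing h with
  | nil => exact fun _ _ => rfl
  | cons ζ Z ih => exact (tOps_congr (tOp_cpow_mul hh c ζ) _).trans (ih (contDiffOn_tOp hh ζ))

/-- The rule t d/dt (t^c h) = t^c (t d/dt + c) h reduces each derivative to the preceding one for
another h. -/
theorem IsBigOPow.cpow_mul (hh : IsBigOPow N h) (c : ℂ) :
    IsBigOPow (N + c.re) fun s => (s : ℂ) ^ c * h s := by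
  refine ⟨contDiffOn_cpow_mul hh.contDiffOn c, fun k => ?_⟩
  induction k generalizing h with
  | zero =>
    obtain ⟨C, hC⟩ := hh.bound 0
    refine ⟨C, fun t ht => ?_⟩
    simp only [Function.iterate_zero, id, norm_mul, Complex.norm_cpow_eq_rpow_re_of_pos ht.1]
    rw [Real.rpow_add ht.1]
    calc _ ≤ t ^ c.re * (C * t ^ N) :=
          mul_le_mul_of_nonneg_left (hC t ht) (Real.rpow_nonneg ht.1.le _)
      _ = _ := by ring
  | succ k ih =>
    obtain ⟨C, hC⟩ := ih (hh.tOp (-c))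
    refine ⟨C, fun t ht => ?_⟩
    have e : EqOn (PushForward.tDeriv fun s => (s : ℂ) ^ c * h s)
        (fun s => (s : ℂ) ^ c * PushForward.tOp (-c) h s) (Ioi 0) := by
      intro t ht
      have := tOp_cpow_mul hh.contDiffOn c (-c) ht
      simp only [PushForward.tOp, neg_add_cancel, zero_mul, sub_zero] at this ⊢
      exact this
    rw [Function.iterate_succ_apply, iterate_tDeriv_congr e k ht.1]
    exact hC t ht

end HalfLine

/-! ### The push-forward of a polyhomogeneous b-density in one chart -/

section LocalPush

variable {n : ℕ} {S : Finset (Fin n)} {c : EuclideanSpace ℝ (Fin n)} {ε r δ : ℝ}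
  {m : Fin n → ℝ} {f a : EuclideanSpace ℝ (Fin n) → ℝ} {α : Fin n → ℕ}
  {κ : Fin n → EuclideanSpace ℝ (Fin n) → ℂ} {g h : EuclideanSpace ℝ (Fin n) → ℂ} {v w : ℝ → ℂ}
  {ρ : Fin n → ℂ → ℕ}

theorem IsPush.add (hb : IsBoxWeight S c ε r m) (hfm : Measurable f) (hg : IsTame S c ε r m g)
    (hh : IsTame S c ε r m h) (hv : IsPush S c ε f g v) (hw : IsPush S c ε f h w) :
    IsPush S c ε f (fun x => g x + h x) (fun t => v t + w t) := by
  refine ⟨hv.continuousOn.add hw.continuousOn, fun a b ha => ?_, fun ψ hψ a b ha hab => ?_⟩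
  · exact ((hv.weak.integrableOn a b ha).add (hw.weak.integrableOn a b ha)).congr
      (Eventually.of_forall fun t => by simp only [Pi.add_apply]; ring)
  · obtain ⟨Q, hQ⟩ : ∃ Q, ∀ s, ‖ψ s‖ ≤ Q := by
      obtain ⟨Q, hQ⟩ := (isCompact_Icc (a := a) (b := b)).exists_bound_of_continuousOn hψ.continuousOn
      refine ⟨max Q 0, fun s => ?_⟩
      by_cases hs : s ∈ Ioo a b
      · exact (hQ s (Ioo_subset_Icc_self hs)).trans (le_max_left _ _)
      · rw [hab s hs, norm_zero]; exact le_max_right _ _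
    have hψc : ∀ s, ‖(ψ s : ℂ)‖ ≤ Q := fun s => by rw [Complex.norm_real]; exact hQ s
    have i1 : ∀ {u}, IsTame S c ε r m u →
        IntegrableOn (fun x => (ψ (f x) : ℂ) * (u x * bInv S x)) (cornerBox S c ε) := fun hu =>
      Integrable.bdd_mul (c := Q) (hu.integrableOn hb)
        (Complex.measurable_ofReal.comp (hψ.measurable.comp hfm)).aestronglyMeasurable
        (Eventually.of_forall fun x => hψc _)
    have i2 : ∀ {u}, IsWeakPush S c ε f g u ∨ IsWeakPush S c ε f h u →
        Integrable fun t => (ψ t : ℂ) * (u t * (t : ℂ)⁻¹) := by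
      intro u hu
      have hu' : IntegrableOn (fun t : ℝ => u t * (t : ℂ)⁻¹) (Ioo a b) :=
        hu.elim (fun h => h.integrableOn a b ha) (fun h => h.integrableOn a b ha)
      have h1 : IntegrableOn (fun t => (ψ t : ℂ) * (u t * (t : ℂ)⁻¹)) (Ioo a b) :=
        Integrable.bdd_mul (c := Q) hu'
          (Complex.measurable_ofReal.comp hψ.measurable).aestronglyMeasurable
          (Eventually.of_forall fun x => hψc _)
      exact h1.integrable_of_forall_notMem_eq_zero fun t ht => by simp [hab t ht]
    have e1 : ∀ x, (ψ (f x) : ℂ) * ((g x + h x) * bInv S x) =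
      (ψ (f x) : ℂ) * (g x * bInv S x) + (ψ (f x) : ℂ) * (h x * bInv S x) := fun x => by ring
    have e2 : ∀ t : ℝ, (ψ t : ℂ) * ((v t + w t) * (t : ℂ)⁻¹) =
      (ψ t : ℂ) * (v t * (t : ℂ)⁻¹) + (ψ t : ℂ) * (w t * (t : ℂ)⁻¹) := fun t => by ring
    simp only [e1, e2]
    rw [integral_add (i1 hg) (i1 hh), integral_add (i2 (Or.inl hv.weak)) (i2 (Or.inr hw.weak)),
      hv.weak.integral_eq ψ hψ a b ha hab, hw.weak.integral_eq ψ hψ a b ha hab]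

theorem IsPush.const_mul (hv : IsPush S c ε f g v) (k : ℂ) :
    IsPush S c ε f (fun x => k * g x) (fun t => k * v t) := by
  refine ⟨continuousOn_const.mul hv.continuousOn, fun a b ha => ?_, fun ψ hψ a b ha hab => ?_⟩
  · exact ((hv.weak.integrableOn a b ha).const_mul k).congr
      (Eventually.of_forall fun t => by ring)
  · have e1 : ∀ x, (ψ (f x) : ℂ) * (k * g x * bInv S x) =
      k * ((ψ (f x) : ℂ) * (g x * bInv S x)) := fun x => by ring
    have e2 : ∀ t : ℝ, (ψ t : ℂ) * (k * v t * (t : ℂ)⁻¹) =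
      k * ((ψ t : ℂ) * (v t * (t : ℂ)⁻¹)) := fun t => by ring
    simp only [e1, e2, integral_const_mul]
    rw [hv.weak.integral_eq ψ hψ a b ha hab]

theorem continuous_zpow_mul_of_supp {ψ : ℝ → ℝ} (hψ : Continuous ψ) {a b : ℝ} (ha : 0 < a)
    (h : ∀ t, t ∉ Ioo a b → ψ t = 0) (k : ℤ) : Continuous fun t => ψ t * t ^ k := by
  rw [continuous_iff_continuousAt]
  intro t
  rcases eq_or_ne t 0 with rfl | ht
  · have h0 : ContinuousAt (fun _ : ℝ => (0 : ℝ)) 0 := continuousAt_const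
    refine h0.congr ?_
    filter_upwards [gt_mem_nhds ha] with s hs
    rw [h s fun hh => lt_asymm hs hh.1, zero_mul]
  · exact hψ.continuousAt.mul (continuousAt_zpow₀ t k (Or.inl ht))

/-- Multiplying a density by a power of the phase. -/
theorem IsPush.zpow_mul (hv : IsPush S c ε f g v) (k : ℤ) :
    IsPush S c ε f (fun x => (f x : ℂ) ^ k * g x) (fun t => (t : ℂ) ^ k * v t) := by
  have hc : ContinuousOn (fun t : ℝ => (t : ℂ) ^ k * v t) (Ioi 0) := by
    refine ContinuousOn.mul (fun t ht => ContinuousAt.continuousWithinAt ?_) hv.continuousOn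
    have ht' : (t : ℂ) ≠ 0 := by exact_mod_cast (ne_of_gt ht : (t : ℝ) ≠ 0)
    exact (continuousAt_zpow₀ (t : ℂ) k (Or.inl ht')).comp
      Complex.continuous_ofReal.continuousAt
  refine ⟨hc, fun a b ha => ?_, fun ψ hψ a b ha hab => ?_⟩
  · refine IntegrableOn.mono_set (ContinuousOn.integrableOn_Icc ?_) Ioo_subset_Icc_self
    exact (hc.mul continuousOn_inv_ofReal).mono fun t ht => ha.trans_le ht.1
  · have := hv.weak.integral_eq (fun t => ψ t * t ^ k) (continuous_zpow_mul_of_supp hψ ha hab k)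
      a b ha fun t ht => by rw [hab t ht, zero_mul]
    push_cast at this
    refine Eq.trans ?_ (this.trans ?_)
    · congr 1; ext x; ring
    · congr 1; ext t; ring

theorem IsTame.tDeriv_cumul (hb : IsBoxWeight S c ε r m) (hf : IsPhase S c ε f κ) {i : Fin n}
    (hi : IsTransverse S c ε κ m i) (hg : IsTame S c ε r m g) :
    ∀ t : ℝ, 0 < t → HasDerivAt (cumul S c ε f (PushForward.adjField S κ i g))
      (cumul S c ε f (PushForward.adjField S κ i (PushForward.adjField S κ i g)) t * (t : ℂ)⁻¹) t :=
  fun _ ht => IsPush.hasDerivAt hb hf hi hg (hg.isPush_cumul hb hf hi)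
    ((hg.adjField hi).isPush_cumul hb hf hi) ht

/-- The derivative is t⁻¹ times a function of the same kind, with g replaced by the adjoint field
applied to g. -/
theorem IsTame.contDiffOn_cumul (hb : IsBoxWeight S c ε r m) (hf : IsPhase S c ε f κ) {i : Fin n}
    (hi : IsTransverse S c ε κ m i) (hg : IsTame S c ε r m g) :
    ContDiffOn ℝ ∞ (cumul S c ε f (PushForward.adjField S κ i g)) (Ioi 0) := by
  have hinv : ContDiffOn ℝ ∞ (fun t : ℝ => (t : ℂ)⁻¹) (Ioi 0) :=
    Complex.ofRealCLM.contDiff.contDiffOn.inv fun t ht =>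
      Complex.ofReal_ne_zero.2 (ne_of_gt ht)
  rw [contDiffOn_infty]
  intro k
  induction k generalizing g with
  | zero => exact contDiffOn_zero.2 (hg.isPush_cumul hb hf hi).continuousOn
  | succ k ih =>
    rw [Nat.cast_succ, contDiffOn_succ_iff_deriv_of_isOpen isOpen_Ioi]
    refine ⟨fun t ht => (hg.tDeriv_cumul hb hf hi t ht).differentiableAt.differentiableWithinAt,
      by simp, ?_⟩
    refine ((ih (hg.adjField hi)).mul (hinv.of_le (by exact_mod_cast le_top))).congr fun t ht => ?_
    exact (hg.tDeriv_cumul hb hf hi t ht).deriv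

/-- A distribution function is bounded by the total mass, and t d/dt only replaces g by the adjoint
field applied to g. -/
theorem IsTame.isBigOPow_cumul (hb : IsBoxWeight S c ε r m) (hf : IsPhase S c ε f κ) {i : Fin n}
    (hi : IsTransverse S c ε κ m i) (hg : IsTame S c ε r m g) :
    IsBigOPow 0 (cumul S c ε f (PushForward.adjField S κ i g)) := by
  refine ⟨hg.contDiffOn_cumul hb hf hi, fun k => ?_⟩
  induction k generalizing g with
  | zero => exact ⟨_, fun t _ => by
      rw [Real.rpow_zero, mul_one]; exact (hg.adjField hi).norm_cumul_le hb t⟩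
  | succ k ih =>
    obtain ⟨C, hC⟩ := ih (hg.adjField hi)
    refine ⟨C, fun t ht => ?_⟩
    have e : EqOn (tDeriv (cumul S c ε f (PushForward.adjField S κ i g)))
        (cumul S c ε f (PushForward.adjField S κ i (PushForward.adjField S κ i g))) (Ioi 0) := by
      intro s hs
      have hs' : (s : ℂ) ≠ 0 := by exact_mod_cast (ne_of_gt hs : (s : ℝ) ≠ 0)
      rw [tDeriv, (hg.tDeriv_cumul hb hf hi s hs).deriv]
      field_simp
    rw [Function.iterate_succ_apply, iterate_tDeriv_congr e k ht.1]
    exact hC t ht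

/-- The logarithmic `b`-derivatives of `a ∏ (x j)^(α j)`. -/
def phaseLog (S : Finset (Fin n)) (α : Fin n → ℕ) (a : EuclideanSpace ℝ (Fin n) → ℝ) (i : Fin n)
    (x : EuclideanSpace ℝ (Fin n)) : ℂ :=
  (if i ∈ S then (α i : ℂ) else 0) + (a x : ℂ)⁻¹ * bDeriv S i (fun x => (a x : ℂ)) x

/-- A phase function `a ∏ (x j)^(α j)` on a corner box without critical points in the
directions relevant for the push-forward. -/
structure IsProductPhase (S : Finset (Fin n)) (c : EuclideanSpace ℝ (Fin n)) (ε : ℝ)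
    (α : Fin n → ℕ) (a f : EuclideanSpace ℝ (Fin n) → ℝ) : Prop where
  measurable : Measurable f
  pos : ∀ x ∈ cornerBox S c ε, 0 < a x
  smooth : IsSmoothBdd (cornerBox S c ε) fun x => (a x : ℂ)
  smooth_inv : IsSmoothBdd (cornerBox S c ε) fun x => (a x : ℂ)⁻¹
  eq : ∀ x ∈ cornerBox S c ε, f x = a x * ∏ j ∈ S, x j ^ α j
  ne_zero : ∀ j ∈ S, 0 < α j → ∀ x ∈ cornerBox S c ε, phaseLog S α a j x ≠ 0
  smooth_inv_log : ∀ j ∈ S, 0 < α j →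
    IsSmoothBdd (cornerBox S c ε) fun x => (phaseLog S α a j x)⁻¹
  transverse : (∃ j ∈ S, 0 < α j) ∨ ∃ i, i ∉ S ∧
    (∀ x ∈ cornerBox S c ε, phaseLog S α a i x ≠ 0) ∧
      IsSmoothBdd (cornerBox S c ε) fun x => (phaseLog S α a i x)⁻¹

theorem IsProductPhase.eqC (hf : IsProductPhase S c ε α a f) :
    ∀ x ∈ cornerBox S c ε, (f x : ℂ) = (a x : ℂ) * monomial S α x := fun x hx => by
  rw [hf.eq x hx]; simp [monomial]

theorem IsProductPhase.isPhase (hf : IsProductPhase S c ε α a f) :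
    IsPhase S c ε f (phaseLog S α a) := by
  have hB : IsOpen (cornerBox S c ε) := isOpen_cornerBox
  have hfC : ContDiffOn ℝ ∞ (fun x => (f x : ℂ)) (cornerBox S c ε) :=
    (hf.smooth.contDiffOn.mul (contDiff_monomial α).contDiffOn).congr hf.eqC
  refine ⟨hf.measurable, ?_, fun x hx => ?_, fun i => ?_, fun i x hx => ?_⟩
  · exact (Complex.reCLM.contDiff.comp_contDiffOn hfC).congr fun x _ => by simp
  · rw [hf.eq x hx]
    exact mul_pos (hf.pos x hx)
      (Finset.prod_pos fun j hj => pow_pos (cornerBox_pos x hx j hj) _)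
  · refine IsSymbol.add hB (isSmoothBdd_const hB _) (hf.smooth_inv.mul hB ?_)
    exact hf.smooth.map_bDeriv hB cornerBox_bdd i
  · have ha : (a x : ℂ) ≠ 0 := by exact_mod_cast (hf.pos x hx).ne'
    have h1 := bDeriv_congr (S := S) hB hf.eqC i hx
    have h2 := bDeriv_mul (S := S) hB hf.smooth.contDiffOn (contDiff_monomial (S := S) α).contDiffOn i hx
    simp only [] at h1 h2 ⊢
    rw [h1, h2, bDeriv_monomial, hf.eqC x hx]
    simp only [phaseLog]
    field_simp
    ring

theorem IsSmoothBdd.pow {B : Set (EuclideanSpace ℝ (Fin n))} (hB : IsOpen B)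
    {u : EuclideanSpace ℝ (Fin n) → ℂ} (hu : IsSmoothBdd B u) (k : ℕ) :
    IsSmoothBdd B fun x => u x ^ k := by
  induction k with
  | zero => simpa using isSmoothBdd_const hB 1
  | succ k ih => simpa only [pow_succ] using ih.mul hB hu

theorem IsPhase.contDiffOn_zpow (hf : IsPhase S c ε f κ) (k : ℤ) :
    ContDiffOn ℝ ∞ (fun x => (f x : ℂ) ^ k) (cornerBox S c ε) := by
  have h1 : ContDiffOn ℝ ∞ (fun x => (f x : ℂ)) (cornerBox S c ε) :=
    Complex.ofRealCLM.contDiff.comp_contDiffOn hf.contDiffOn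
  have h0 : ∀ x ∈ cornerBox S c ε, (f x : ℂ) ≠ 0 := fun x hx => by
    exact_mod_cast (hf.pos x hx).ne'
  rcases k with k | k
  · simpa using h1.pow k
  · simp only [zpow_negSucc]
    exact (h1.pow (k + 1)).inv fun x hx => pow_ne_zero _ (h0 x hx)

theorem IsPhase.bDeriv_zpow (hf : IsPhase S c ε f κ) (k : ℤ) (i : Fin n) :
    EqOn (bDeriv S i fun x => (f x : ℂ) ^ k) (fun x => (k * κ i x) * (f x : ℂ) ^ k)
      (cornerBox S c ε) := by
  intro x hx
  have h0 : (f x : ℂ) ≠ 0 := by exact_mod_cast (hf.pos x hx).ne'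
  have h1 : ContDiffOn ℝ ∞ (fun x => (f x : ℂ)) (cornerBox S c ε) :=
    Complex.ofRealCLM.contDiff.comp_contDiffOn hf.contDiffOn
  have h2 := (ContDiffOn.differentiableAt_of_isOpen h1 isOpen_cornerBox hx).hasFDerivAt
  have h3 := (hasDerivAt_zpow k (f x : ℂ) (Or.inl h0)).comp_hasFDerivAt_of_eq x h2 rfl
  have h5 := hf.bDeriv_eq i hx
  have h6 : fderiv ℝ (fun x => (f x : ℂ) ^ k) x = _ := HasFDerivAt.fderiv h3
  simp only [bDeriv_apply] at h5 ⊢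
  rw [h6]
  simp only [smul_apply, smul_eq_mul]
  calc _ = k * (f x : ℂ) ^ (k - 1) * (bCoef S i x *
        fderiv ℝ (fun x => (f x : ℂ)) x (EuclideanSpace.single i 1)) := by ring
    _ = _ := by rw [h5, zpow_sub_one₀ h0]; field_simp

/-- The weight at which we start: `2` where the phase vanishes and `δ` elsewhere. -/
def startWeight (α : Fin n → ℕ) (δ : ℝ) (j : Fin n) : ℝ := if α j = 0 then δ else 2

theorem IsProductPhase.isTransverse (hf : IsProductPhase S c ε α a f) {j : Fin n} (hj : j ∈ S)
    (hα : 0 < α j) : IsTransverse S c ε (phaseLog S α a) (startWeight α δ) j :=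
  ⟨hf.ne_zero j hj hα, hf.smooth_inv_log j hj hα, fun _ => by simp [startWeight, hα.ne']⟩

theorem IsProductPhase.exists_isTransverse (hf : IsProductPhase S c ε α a f) :
    ∃ i, IsTransverse S c ε (phaseLog S α a) (startWeight α δ) i := by
  rcases hf.transverse with ⟨j, hj, hα⟩ | ⟨i, hi, h1, h2⟩
  · exact ⟨j, hf.isTransverse hj hα⟩
  · exact ⟨i, h1, h2, fun h => absurd h hi⟩

/-- The decay of the push-forward of a density that decays. -/
theorem IsProductPhase.isBigOPow_cumul (hf : IsProductPhase S c ε α a f)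
    (hb : IsBoxWeight S c ε r (startWeight α δ)) {i : Fin n}
    (hi : IsTransverse S c ε (phaseLog S α a) (startWeight α δ) i) (N : ℕ)
    (hg : IsTame S c ε r (fun j => startWeight α δ j + N * α j) g) :
    IsTame S c ε r (startWeight α δ) g ∧
      IsBigOPow N (cumul S c ε f (adjField S (phaseLog S α a) i g)) := by
  have hB : IsOpen (cornerBox S c ε) := isOpen_cornerBox
  have hph := hf.isPhase
  have hpos : ∀ x ∈ cornerBox S c ε, ∀ j ∈ S, 0 < x j := cornerBox_pos
  -- Dividing by f^N uses up exactly the surplus weight N α_j. The push-forward of the quotient is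
  -- bounded, and multiplying back by f^N multiplies it by t^N.
  set g' : EuclideanSpace ℝ (Fin n) → ℂ := fun x => (f x : ℂ) ^ (-N : ℤ) * g x with hg'
  have h1 := isSymbol_of_logDeriv (S := S) hB cornerBox_bdd
    (fun i => (hph.smooth i).const_mul hB ((-N : ℤ) : ℂ)) (hph.contDiffOn_zpow (-N))
    (fun i => hph.bDeriv_zpow (-N) i)
  obtain ⟨K, hK⟩ := (hf.smooth_inv.pow hB N).bound []
  have hwa : ∀ x ∈ cornerBox S c ε, weight S (fun j => startWeight α δ j + N * α j) x =
      weight S (startWeight α δ) x * weight S (fun j => α j) x ^ N := by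
    intro x hx
    rw [weight_add hpos _ _ x hx]
    congr 1
    simp only [weight, ← Finset.prod_pow]
    refine Finset.prod_congr rfl fun j hj => ?_
    rw [mul_comm, Real.rpow_mul_natCast (hpos x hx j hj).le]
  have hg't : IsTame S c ε r (startWeight α δ) g' := by
    refine ⟨(h1.mul hB hg.symbol).mono (C := K) (fun x hx => ?_) fun x hx => ?_, fun x hx hs => ?_⟩
    · exact mul_nonneg (norm_nonneg _) (weight_nonneg hpos _ x hx)
    · have h2 := hK x hx
      have h3 := norm_monomial hpos α x hx
      have h4 := weight_pos hpos (fun j => (α j : ℝ)) x hx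
      have h5 := weight_nonneg hpos (startWeight α δ) x hx
      simp only [bDerivs, List.foldr_nil, mul_one, norm_pow] at h2
      rw [hf.eqC x hx, hwa x hx, zpow_neg, zpow_natCast, mul_pow, mul_inv, norm_mul, norm_inv,
        norm_inv, norm_pow, norm_pow, h3, ← inv_pow, ← norm_inv]
      calc _ = ‖(a x : ℂ)⁻¹‖ ^ N * weight S (startWeight α δ) x *
            ((weight S (fun j => (α j : ℝ)) x ^ N)⁻¹ * weight S (fun j => (α j : ℝ)) x ^ N) := by ring
        _ = ‖(a x : ℂ)⁻¹‖ ^ N * weight S (startWeight α δ) x := by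
          rw [inv_mul_cancel₀ (pow_pos h4 N).ne', mul_one]
        _ ≤ _ := mul_le_mul_of_nonneg_right h2 h5
    · simp only [hg', hg.supp x hx hs, mul_zero]
  have hgg' : EqOn (fun x => (f x : ℂ) ^ (N : ℤ) * g' x) g (cornerBox S c ε) := by
    intro x hx
    have h0 : (f x : ℂ) ≠ 0 := by exact_mod_cast (hph.pos x hx).ne'
    simp only [hg']
    rw [← mul_assoc, ← zpow_add₀ h0]; simp
  have hgt : IsTame S c ε r (startWeight α δ) g := by
    have h2 : IsTame S c ε r (startWeight α δ) fun x => (a x : ℂ) ^ N * (monomial S α x ^ N * g' x) := by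
      refine IsTame.smooth_mul ?_ (hf.smooth.pow hB N)
      refine hg't.smooth_mul (IsSmoothBdd.pow hB ?_ N)
      have : ∀ T : Finset (Fin n), IsSmoothBdd (cornerBox S c ε) (monomial T α) := by
        intro T
        classical
        unfold monomial
        induction T using Finset.induction_on with
        | empty => simpa using isSmoothBdd_const hB 1
        | insert j T hj ih =>
          simp only [Finset.prod_insert hj]
          exact ((isSmoothBdd_coord hB cornerBox_bdd j).pow hB _).mul hB ih
      exact this S
    refine ⟨h2.symbol.congr hB fun x hx => ?_, hg.supp⟩
    simp only [← hgg' hx, hf.eqC x hx, zpow_natCast, mul_pow, mul_assoc]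
  refine ⟨hgt, ?_⟩
  have p1 := ((hg't.isPush_cumul hb hph hi).zpow_mul N).congr_left hgg'
  have p2 := IsPush.unique hb hph.measurable hgt p1 (hgt.isPush_cumul hb hph hi)
  have p3 := (hg't.isBigOPow_cumul hb hph hi).cpow_mul (N : ℂ)
  simp only [Complex.natCast_re, zero_add, Complex.cpow_natCast] at p3
  exact p3.congr p2

end LocalPush

/-! ### Removing roots from the push-forward -/

section LocalPush

variable {n : ℕ} {S : Finset (Fin n)} {c : EuclideanSpace ℝ (Fin n)} {ε r δ : ℝ}
  {m : Fin n → ℝ} {f a : EuclideanSpace ℝ (Fin n) → ℝ} {α : Fin n → ℕ}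
  {κ : Fin n → EuclideanSpace ℝ (Fin n) → ℂ} {g h : EuclideanSpace ℝ (Fin n) → ℂ} {v w : ℝ → ℂ}
  {ρ : Fin n → ℂ → ℕ}

/-- The logarithmic derivative is α_j plus a term with the factor x_j. Hence D_j(α_j κ_j⁻¹ g)
differs from D_j g only by D_j(b x_j g), where the roots at x_j = 0 are shifted. -/
theorem IsProductPhase.exists_eq_one_add (hf : IsProductPhase S c ε α a f) {j : Fin n} (hj : j ∈ S)
    (hα : 0 < α j) : ∃ b, IsSmoothBdd (cornerBox S c ε) b ∧
      ∀ x ∈ cornerBox S c ε, (α j : ℂ) * (phaseLog S α a j x)⁻¹ = 1 + (x j : ℂ) * b x := by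
  have hB : IsOpen (cornerBox S c ε) := isOpen_cornerBox
  refine ⟨fun x => -1 * ((phaseLog S α a j x)⁻¹ * ((a x : ℂ)⁻¹ * bDeriv ∅ j (fun x => (a x : ℂ)) x)),
    ((hf.smooth_inv_log j hj hα).mul hB (hf.smooth_inv.mul hB
      (IsSymbol.map_bDeriv hB hf.smooth j))).const_mul hB _, fun x hx => ?_⟩
  have h0 := hf.ne_zero j hj hα x hx
  have h1 : phaseLog S α a j x = α j + (a x : ℂ)⁻¹ * ((x j : ℂ) * bDeriv ∅ j (fun x => (a x : ℂ)) x) := by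
    simp only [phaseLog, bDeriv_eq_mul (S := S) j, bCoef, hj, if_true]
  have h2 : (α j : ℂ) = phaseLog S α a j x -
      (a x : ℂ)⁻¹ * ((x j : ℂ) * bDeriv ∅ j (fun x => (a x : ℂ)) x) := by rw [h1]; ring
  rw [h2, sub_mul, mul_inv_cancel₀ h0]
  ring

theorem IsPhg.isTame (hg : IsPhg S (cornerBox S c ε) ρ g)
    (hs : ∀ x ∈ cornerBox S c ε, (∃ i, r < |x i - c i|) → g x = 0)
    (h : ∀ j ∈ S, ∀ z : ℂ, z.re ≤ m j → ρ j z = 0) : IsTame S c ε r m g :=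
  ⟨hg.isSymbol isOpen_cornerBox (L := []) fun j hj z hz => by simp [h j hj z hz], hs⟩

/-- Applying the operators `t d/dt - ζ`, one for each root, to the push-forward gives a function
that decays. -/
theorem IsProductPhase.exists_tOps_cumul (hf : IsProductPhase S c ε α a f)
    (hb : IsBoxWeight S c ε r (startWeight α δ)) {i : Fin n}
    (hi : IsTransverse S c ε (phaseLog S α a) (startWeight α δ) i) (N : ℕ)
    (R : Multiset (Fin n × ℂ)) (hg : IsPhg S (cornerBox S c ε) ρ g)
    (hs : ∀ x ∈ cornerBox S c ε, (∃ i, r < |x i - c i|) → g x = 0)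
    (hρ : ∀ j ∈ S, ∀ z, ρ j z ≤ ρ j (z + 1))
    (hfin : ∀ j ∈ S, ∀ N : ℝ, {z | ρ j z ≠ 0 ∧ z.re ≤ N}.Finite)
    (hlow : ∀ j ∈ S, ∀ z : ℂ, z.re ≤ startWeight α δ j → ρ j z = 0)
    (hR : ∀ j z, R.count (j, z) =
      if j ∈ S ∧ z.re ≤ startWeight α δ j + N * α j then ρ j z else 0) :
    ∃ Z : List ℂ, (∀ ζ, Z.count ζ = ∑ j ∈ S with 0 < α j, R.count (j, (α j : ℂ) * ζ)) ∧
      IsBigOPow N (tOps Z (cumul S c ε f (adjField S (phaseLog S α a) i g))) := by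
  classical
  have hB : IsOpen (cornerBox S c ε) := isOpen_cornerBox
  have hpos : ∀ x ∈ cornerBox S c ε, ∀ j ∈ S, 0 < x j := cornerBox_pos
  have hph := hf.isPhase
  induction hk : R.card generalizing R ρ g with
  | zero =>
    obtain rfl := Multiset.card_eq_zero.1 hk
    refine ⟨[], by simp, (hf.isBigOPow_cumul hb hi N (hg.isTame hs fun j hj z hz => ?_)).2⟩
    have := hR j z
    rw [if_pos ⟨hj, hz⟩] at this
    simpa using this.symm
  | succ k ih =>
    have hR0 : R ≠ 0 := fun h => by simp [h] at hk
    obtain ⟨j, z, hjz, hj, hzm, hρz, -, hsh, hup, hRe⟩ := exists_minimal_root hρ hR hR0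
    -- When α_j = 0, the roots counted in R would lie below the starting weight, where there are
    -- none.
    have hαj : 0 < α j := by
      by_contra h0
      obtain h0 : α j = 0 := by omega
      rw [h0] at hzm
      simp only [Nat.cast_zero, mul_zero, add_zero] at hzm
      exact hρz.ne' (hlow j hj z hzm)
    have hαC : (α j : ℂ) ≠ 0 := by exact_mod_cast hαj.ne'
    have htj : IsTransverse S c ε (phaseLog S α a) (startWeight α δ) j := hf.isTransverse hj hαj
    obtain ⟨b, hbs, hbe⟩ := hf.exists_eq_one_add hj hαj
    set κ := phaseLog S α a with hκ
    have hgt : IsTame S c ε r (startWeight α δ) g := hg.isTame hs hlow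
    have hfin' : ∀ j' ∈ S, ∀ N : ℝ, {y | removeRoot ρ (j, z) j' y ≠ 0 ∧ y.re ≤ N}.Finite :=
      fun j' hj' M => (hfin j' hj' M).subset fun y hy =>
        ⟨fun h0 => hy.1 (Nat.le_zero.1 (h0 ▸ removeRoot_le (ρ := ρ) (j, z) j' y)), hy.2⟩
    -- This is α_j times the adjoint field in direction j applied to g, minus z g. It is pushed
    -- forward to α_j (t d/dt - z/α_j) applied to the push-forward of g. The error term lacks the
    -- root z because x_j g does.
    set g1 : EuclideanSpace ℝ (Fin n) → ℂ := fun x =>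
      bOp S (j, z) g x + bDeriv S j (fun x => b x * ((x j : ℂ) * g x)) x with hg1
    have hg1p : IsPhg S (cornerBox S c ε) (removeRoot ρ (j, z)) g1 := by
      refine IsPhg.add hB (hg.bOp hB (j, z) fun j' _ y => le_removeRoot_add _ _ _) ?_
      refine IsPhg.map_bDeriv hB (IsPhg.smooth_mul hB cornerBox_bdd hpos hsh hfin' hbs ?_) j
      refine hg.coord_mul hB hpos hj (fun i _ hij y => ?_) hup
      rw [removeRoot_of_ne fun h => hij (congrArg Prod.fst h)]
    have hg1s : ∀ x ∈ cornerBox S c ε, (∃ i, r < |x i - c i|) → g1 x = 0 := by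
      intro x hx hxs
      have h1 := bDeriv_eq_zero_of_supp hs j x hx hxs
      have h2 := bDeriv_eq_zero_of_supp (g := fun x => b x * ((x j : ℂ) * g x))
        (fun y hy hys => by rw [hs y hy hys]; ring) j x hx hxs
      simp only [hg1, bOp, h1, h2, hs x hx hxs]
      ring
    have hlow1 : ∀ j' ∈ S, ∀ y : ℂ, y.re ≤ startWeight α δ j' → removeRoot ρ (j, z) j' y = 0 :=
      fun j' hj' y hy => Nat.le_zero.1 (hlow j' hj' y hy ▸ removeRoot_le (ρ := ρ) (j, z) j' y)
    obtain ⟨Z, hZ, hZO⟩ := ih (R.erase (j, z)) hg1p hg1s hsh hfin' hlow1 hRe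
      (by rw [Multiset.card_erase_of_mem hjz, hk]; rfl)
    have hg1t : IsTame S c ε r (startWeight α δ) g1 := hg1p.isTame hg1s hlow1
    have hadj : EqOn (fun x => (α j : ℂ) * adjField S κ j g x + -z * g x) g1 (cornerBox S c ε) := by
      intro x hx
      have e1 := bDeriv_const_mul (S := S) hB (htj.smooth_inv.contDiffOn.mul hg.contDiffOn) (α j : ℂ) j hx
      have e2 : EqOn (fun x => (α j : ℂ) * ((κ j x)⁻¹ * g x))
          (fun x => g x + b x * ((x j : ℂ) * g x)) (cornerBox S c ε) := fun y hy => by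
        simp only [← mul_assoc, hbe y hy]; ring
      have e3 := bDeriv_congr (S := S) hB e2 j hx
      have e4 := bDeriv_add (S := S) hB hg.contDiffOn
        (hbs.contDiffOn.mul ((contDiff_coordC j).contDiffOn.mul hg.contDiffOn)) j hx
      simp only [] at e1 e3 e4
      simp only [adjField, hg1, bOp]
      rw [← e1, e3, e4]; ring
    set vg := cumul S c ε f (adjField S κ i g) with hvg
    set w := cumul S c ε f (adjField S κ i (adjField S κ j g)) with hw
    have hpg : IsPush S c ε f g vg := hgt.isPush_cumul hb hph hi
    have hpw : IsPush S c ε f (adjField S κ j g) w := (hgt.adjField htj).isPush_cumul hb hph hi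
    have hp1 := (((hpw.const_mul (α j : ℂ)).add hb hph.measurable
      ((hgt.adjField htj).const_mul _) (hgt.const_mul (-z)) (hpg.const_mul (-z))).congr_left hadj)
    have huniq := IsPush.unique hb hph.measurable hg1t hp1 (hg1t.isPush_cumul hb hph hi)
    have htD : EqOn (tOp (z / α j) vg) (fun t => (α j : ℂ)⁻¹ *
        cumul S c ε f (adjField S κ i g1) t) (Ioi 0) := by
      intro t ht
      have ht' : (t : ℂ) ≠ 0 := Complex.ofReal_ne_zero.2 (ne_of_gt ht)
      have h1 := (IsPush.hasDerivAt hb hph htj hgt hpg hpw ht).deriv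
      have h2 := huniq ht
      simp only [] at h2 ⊢
      rw [← h2, tOp, tDeriv, h1]
      field_simp
      ring
    refine ⟨z / α j :: Z, fun ζ => ?_, ?_⟩
    -- Removing the root (j, z) lowers the count at exactly one index, for ζ = z/α_j only.
    · have hsum : ∀ j' ∈ {j' ∈ S | 0 < α j'}, R.count (j', (α j' : ℂ) * ζ) =
          (R.erase (j, z)).count (j', (α j' : ℂ) * ζ) +
            if j' = j then (if z / α j = ζ then 1 else 0) else 0 := by
        intro j' hj'
        by_cases hjj : j' = j
        · subst hjj
          by_cases hz : z / α j' = ζ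
          · have hz' : (α j' : ℂ) * ζ = z := by rw [← hz]; field_simp
            rw [if_pos rfl, if_pos hz, hz', Multiset.count_erase_self]
            have := Multiset.count_pos.2 hjz
            omega
          · rw [if_pos rfl, if_neg hz, Multiset.count_erase_of_ne, add_zero]
            rintro h
            apply hz
            have := congrArg Prod.snd h
            simp only [] at this
            rw [← this]; field_simp
        · rw [if_neg hjj, add_zero, Multiset.count_erase_of_ne]
          exact fun h => hjj (congrArg Prod.fst h)
      rw [Finset.sum_congr rfl hsum, Finset.sum_add_distrib, ← hZ, Finset.sum_ite_eq', if_pos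
        (Finset.mem_filter.2 ⟨hj, hαj⟩), List.count_cons]
      simp
    · have h1 := tOps_const_mul (hg1t.contDiffOn_cumul hb hph hi) (α j : ℂ)⁻¹ Z
      exact (hZO.const_mul (α j : ℂ)⁻¹).congr ((tOps_congr htD Z).trans h1).symm

/-- Provides a power f^K that raises all exponents in the directions with α_j > 0 above the starting
weight 2. -/
theorem exists_nat_mul_gt_of_finite (hfin : ∀ j ∈ S, ∀ N : ℝ, {z | ρ j z ≠ 0 ∧ z.re ≤ N}.Finite) :
    ∃ K : ℕ, ∀ j ∈ S, ∀ z : ℂ, z.re ≤ 2 - (K : ℝ) → ρ j z = 0 := by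
  have hF : (⋃ j ∈ (S : Set (Fin n)), {z | ρ j z ≠ 0 ∧ z.re ≤ 0}).Finite :=
    S.finite_toSet.biUnion fun j hj => hfin j hj 0
  obtain ⟨b, hb⟩ := (hF.image Complex.re).bddBelow
  obtain ⟨K, hK⟩ := exists_nat_gt (2 - b)
  -- With K + 2 the hypothesis reads Re z ≤ -K ≤ 0, which puts z in the finite set with lower bound
  -- b > 2 - K.
  refine ⟨K + 2, fun j hj z hz => ?_⟩
  by_contra hne
  push_cast at hz
  have hK0 : (0 : ℝ) ≤ K := Nat.cast_nonneg K
  have h2 : z ∈ ⋃ j ∈ (S : Set (Fin n)), {z | ρ j z ≠ 0 ∧ z.re ≤ 0} :=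
    mem_biUnion (Finset.mem_coe.2 hj) ⟨hne, by linarith⟩
  have := hb ⟨z, h2, rfl⟩
  linarith

/-- The push-forward theorem in a chart. -/
theorem IsProductPhase.exists_push (hf : IsProductPhase S c ε α a f) (hε : 0 < ε) (hr : r < ε)
    (hc : ∀ j ∈ S, c j = 0) (hδ : 0 < δ) (hg : IsPhg S (cornerBox S c ε) ρ g)
    (hs : ∀ x ∈ cornerBox S c ε, (∃ i, r < |x i - c i|) → g x = 0)
    (hρ : ∀ j ∈ S, ∀ z, ρ j z ≤ ρ j (z + 1))
    (hfin : ∀ j ∈ S, ∀ N : ℝ, {z | ρ j z ≠ 0 ∧ z.re ≤ N}.Finite)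
    (hlow : ∀ j ∈ S, α j = 0 → ∀ z : ℂ, z.re ≤ δ → ρ j z = 0) :
    ∃ v : ℝ → ℂ, ContDiffOn ℝ ∞ v (Ioi 0) ∧
      HasExpansion {q | q.2 < ∑ j ∈ S with 0 < α j, ρ j ((α j : ℂ) * q.1)} v ∧
      ∀ a b : ℝ, 0 < a → ∀ V ⊆ Ioo a b, MeasurableSet V →
        IntegrableOn (fun x => g x * bInv S x) (f ⁻¹' V) (volume.restrict (cornerBox S c ε)) ∧
        ∫ x in f ⁻¹' V, g x * bInv S x ∂(volume.restrict (cornerBox S c ε)) =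
          ∫ t in V, v t * (t : ℂ)⁻¹ := by
  classical
  have hB : IsOpen (cornerBox S c ε) := isOpen_cornerBox
  have hpos : ∀ x ∈ cornerBox S c ε, ∀ j ∈ S, 0 < x j := cornerBox_pos
  have hph := hf.isPhase
  have hb : IsBoxWeight S c ε r (startWeight α δ) :=
    ⟨hε, hr, hc, fun j _ => by unfold startWeight; split_ifs <;> linarith⟩
  obtain ⟨i, hi⟩ := hf.exists_isTransverse (δ := δ)
  obtain ⟨K, hK⟩ := exists_nat_mul_gt_of_finite hfin
  set ρ' : Fin n → ℂ → ℕ := fun j z => ρ j (z - α j * K) with hρ'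
  -- The b-density of g need not be integrable on the box, that of f^K g is. On the half-line the
  -- factor is undone by t^(-K).
  set g' : EuclideanSpace ℝ (Fin n) → ℂ := fun x => (f x : ℂ) ^ (K : ℤ) * g x with hg'
  have hρs : ∀ j ∈ S, ∀ z, ρ' j z ≤ ρ' j (z + 1) := fun j hj z => by
    have := hρ j hj (z - α j * K)
    simp only [hρ']
    convert this using 2; ring
  have hfin' : ∀ j ∈ S, ∀ N : ℝ, {z | ρ' j z ≠ 0 ∧ z.re ≤ N}.Finite := fun j hj N => by
    refine ((hfin j hj (N - α j * K)).image fun z : ℂ => z + α j * K).subset fun (z : ℂ) hz =>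
      ⟨z - α j * K, ⟨hz.1, ?_⟩, by simp⟩
    have := hz.2
    simp only [Complex.sub_re, Complex.mul_re, Complex.natCast_re, Complex.natCast_im]
    linarith
  have hlow' : ∀ j ∈ S, ∀ z : ℂ, z.re ≤ startWeight α δ j → ρ' j z = 0 := by
    intro j hj z hz
    simp only [hρ']
    by_cases hα : α j = 0
    · rw [startWeight, if_pos hα] at hz
      simpa [hα] using hlow j hj hα z hz
    · rw [startWeight, if_neg hα] at hz
      refine hK j hj _ ?_
      have h1 : (1 : ℝ) ≤ α j := by exact_mod_cast Nat.pos_of_ne_zero hα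
      have h2 : (0 : ℝ) ≤ K := Nat.cast_nonneg K
      simp only [Complex.sub_re, Complex.mul_re, Complex.natCast_re, Complex.natCast_im]
      nlinarith
  have hg'p : IsPhg S (cornerBox S c ε) ρ' g' := by
    have h1 : IsPhg S (cornerBox S c ε) ρ' fun x => monomial S (fun j => α j * K) x * g x :=
      hg.monomial_mul hB hpos _ fun j _ z => by simp [hρ']
    refine (h1.smooth_mul hB cornerBox_bdd hpos hρs hfin' (hf.smooth.pow hB K)).congr hB fun x hx => ?_
    simp only [hg', hf.eqC x hx, zpow_natCast, mul_pow, monomial, pow_mul, Finset.prod_pow]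
    ring
  have hg's : ∀ x ∈ cornerBox S c ε, (∃ i, r < |x i - c i|) → g' x = 0 := fun x hx hxs => by
    simp only [hg', hs x hx hxs, mul_zero]
  have hg't : IsTame S c ε r (startWeight α δ) g' := hg'p.isTame hg's hlow'
  set v' := cumul S c ε f (adjField S (phaseLog S α a) i g') with hv'
  have hv's : ContDiffOn ℝ ∞ v' (Ioi 0) := hg't.contDiffOn_cumul hb hph hi
  have hp := (hg't.isPush_cumul hb hph hi).zpow_mul (-K)
  have hgg' : EqOn (fun x => (f x : ℂ) ^ (-K : ℤ) * g' x) g (cornerBox S c ε) := by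
    intro x hx
    have h0 : (f x : ℂ) ≠ 0 := by exact_mod_cast (hph.pos x hx).ne'
    simp only [hg']
    rw [← mul_assoc, ← zpow_add₀ h0]; simp
  have hp' := hp.congr_left hgg'
  set v : ℝ → ℂ := fun t => (t : ℂ) ^ (-K : ℤ) * v' t with hv
  have hvc : v = fun t : ℝ => (t : ℂ) ^ (-K : ℂ) * v' t := by
    ext t
    simp only [hv]
    rw [← Complex.cpow_intCast]; simp
  refine ⟨v, ?_, ?_, fun a b ha V hVab hV => ?_⟩
  · rw [hvc]; exact contDiffOn_cpow_mul hv's _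
  · refine hasExpansion_of_tOps (A := -K)
      (fun ζ => ∑ j ∈ S with 0 < α j, ρ j ((α j : ℂ) * ζ)) ?_ fun N => ?_
    · have := (hg't.isBigOPow_cumul hb hph hi).cpow_mul (-K : ℂ)
      rw [hvc]
      simp only [zero_add, Complex.neg_re, Complex.natCast_re] at this
      exact this.isBigOPowLT
    -- The final factor t^(-K) costs K orders of decay.
    · obtain ⟨M, hM⟩ := exists_nat_gt (N + K)
      obtain ⟨R, hR⟩ := exists_multiset_roots hfin' fun j => startWeight α δ j + M * α j
      obtain ⟨Z, hZ, hZO⟩ := hf.exists_tOps_cumul hb hi M R hg'p hg's hρs hfin' hlow' hR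
      refine ⟨Z.map (· + (-K : ℂ)), fun ζ hζ => ?_, ?_⟩
      · have h1 : (Z.map (· + (-K : ℂ))).count ζ = Z.count (ζ + K) := by
          have := List.count_map_of_injective Z (· + (-K : ℂ)) (add_left_injective _) (ζ + K)
          simpa using this
        rw [h1, hZ]
        refine Finset.sum_congr rfl fun j hj => ?_
        have hj' := Finset.mem_filter.1 hj
        have h2 : (1 : ℝ) ≤ α j := by exact_mod_cast hj'.2
        have h3 : ((α j : ℂ) * (ζ + K)).re ≤ startWeight α δ j + M * α j := by
          simp only [startWeight, hj'.2.ne', if_false, Complex.mul_re, Complex.natCast_re,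
            Complex.natCast_im, Complex.add_re]
          nlinarith
        rw [hR, if_pos ⟨hj'.1, h3⟩]
        simp only [hρ']; congr 1; ring
      · have h1 := hZO.cpow_mul (-K : ℂ)
        simp only [Complex.neg_re, Complex.natCast_re] at h1
        rw [hvc]
        exact ((h1.congr (tOps_cpow_mul hv's (-K : ℂ) Z).symm).mono (by linarith)).isBigOPowLT
  -- Where a < f < b the factor f^(-K) is bounded, so g inherits integrability there from f^K g.
  · have hint : IntegrableOn (fun x => g x * bInv S x) (f ⁻¹' Ioo a b)
        (volume.restrict (cornerBox S c ε)) := by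
      have h1 := hg't.integrableOn hb
      have h2 : IntegrableOn (fun x => ((f x : ℂ) ^ (-K : ℤ)) * (g' x * bInv S x)) (f ⁻¹' Ioo a b)
          (volume.restrict (cornerBox S c ε)) := by
        refine Integrable.bdd_mul (c := (a ^ K)⁻¹) (IntegrableOn.integrable (h1.integrableOn)) ?_ ?_
        · exact ((Complex.measurable_ofReal.comp hf.measurable).pow_const _).aestronglyMeasurable
        · refine (ae_restrict_iff' (hf.measurable measurableSet_Ioo)).2
            (Eventually.of_forall fun x hx => ?_)
          rw [zpow_neg, zpow_natCast, norm_inv, norm_pow, Complex.norm_real,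
            Real.norm_of_nonneg (ha.trans hx.1).le]
          exact inv_anti₀ (pow_pos ha K) (pow_le_pow_left₀ ha.le hx.1.le K)
      refine h2.congr ?_
      refine ae_restrict_of_ae ((ae_restrict_iff' measurableSet_cornerBox).2
        (Eventually.of_forall fun x hx => ?_))
      simp only [← mul_assoc]
      rw [show (f x : ℂ) ^ (-K : ℤ) * g' x = g x from hgg' hx]
    refine ⟨hint.mono_set (preimage_mono hVab), ?_⟩
    exact setIntegral_preimage_eq (f' := id) hf.measurable measurable_id hint
      (hp'.weak.integrableOn a b ha) (fun ψ hψ hab => hp'.weak.integral_eq ψ hψ a b ha hab) hV hVab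

end LocalPush

/-! ### Phase functions which are smooth up to the boundary -/

section SmoothUpTo

variable {n : ℕ} {S : Finset (Fin n)} {c : EuclideanSpace ℝ (Fin n)} {ε ε' : ℝ}

theorem convex_closedCornerBox : Convex ℝ (closedCornerBox S c ε) := by
  intro x hx y hy s t hs ht hst i
  have h1 := abs_le.1 (hx i).1
  have h2 := abs_le.1 (hy i).1
  obtain rfl : s = 1 - t := by linarith
  refine ⟨abs_le.2 ⟨?_, ?_⟩, fun hi => ?_⟩
  · simp only [PiLp.add_apply, PiLp.smul_apply, smul_eq_mul]
    nlinarith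
  · simp only [PiLp.add_apply, PiLp.smul_apply, smul_eq_mul]
    nlinarith
  · have h3 := (hx i).2 hi
    have h4 := (hy i).2 hi
    simp only [PiLp.add_apply, PiLp.smul_apply, smul_eq_mul]
    positivity

theorem cornerBox_nonempty (hε : 0 < ε) (hc : ∀ j ∈ S, c j = 0) : (cornerBox S c ε).Nonempty := by
  classical
  refine ⟨WithLp.toLp 2 fun i => if i ∈ S then ε / 2 else c i, fun i => ?_⟩
  by_cases hi : i ∈ S
  · simp only [hi, if_true, hc i hi, sub_zero, true_imp_iff]
    rw [abs_of_pos (by linarith)]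
    constructor <;> linarith
  · simp [hi, hε]

theorem uniqueDiffOn_closedCornerBox (hε : 0 < ε) (hc : ∀ j ∈ S, c j = 0) :
    UniqueDiffOn ℝ (closedCornerBox S c ε) := by
  refine uniqueDiffOn_convex convex_closedCornerBox ?_
  exact (cornerBox_nonempty hε hc).mono (interior_maximal cornerBox_subset_closed isOpen_cornerBox)

theorem center_mem_closedCornerBox (hε : 0 ≤ ε) (hc : ∀ j ∈ S, c j = 0) :
    c ∈ closedCornerBox S c ε :=
  fun i => ⟨by simpa using hε, fun hi => (hc i hi).ge⟩

theorem closedCornerBox_mono (h : ε' ≤ ε) : closedCornerBox S c ε' ⊆ closedCornerBox S c ε :=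
  fun _ hx i => ⟨(hx i).1.trans h, (hx i).2⟩

/-- The closed box is compact and convex with non-empty interior, so derivatives within it are well
defined and bounded; inside they are the ordinary ones. -/
theorem isSmoothBdd_of_contDiffOn_closed (hε : 0 < ε) (hc : ∀ j ∈ S, c j = 0)
    {u : EuclideanSpace ℝ (Fin n) → ℂ} (hu : ContDiffOn ℝ ∞ u (closedCornerBox S c ε)) :
    IsSmoothBdd (cornerBox S c ε) u := by
  refine ⟨hu.mono cornerBox_subset_closed, fun l => ?_⟩
  induction l using List.reverseRecOn generalizing u with
  | nil =>
    obtain ⟨K, hK⟩ := (isCompact_closedCornerBox (S := S) (c := c)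
      (ε := ε)).exists_bound_of_continuousOn hu.continuousOn
    exact ⟨K, fun x hx => by simpa [bDerivs] using hK x (cornerBox_subset_closed hx)⟩
  | append_singleton l i ih =>
    have h1 : ContDiffOn ℝ ∞ (fun x => fderivWithin ℝ u (closedCornerBox S c ε) x
        (EuclideanSpace.single i 1)) (closedCornerBox S c ε) :=
      (hu.fderivWithin (uniqueDiffOn_closedCornerBox hε hc) (m := ∞) (by simp)).clm_apply
        contDiffOn_const
    obtain ⟨K, hK⟩ := ih h1
    have h2 : EqOn (bDeriv ∅ i u) (fun x => fderivWithin ℝ u (closedCornerBox S c ε) x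
        (EuclideanSpace.single i 1)) (cornerBox S c ε) := fun x hx => by
      have : closedCornerBox S c ε ∈ 𝓝 x :=
        mem_of_superset (isOpen_cornerBox.mem_nhds hx) cornerBox_subset_closed
      simp [bDeriv_apply, bCoef, fderivWithin_of_mem_nhds this]
    refine ⟨K, fun x hx => ?_⟩
    rw [bDerivs_concat, bDerivs_congr isOpen_cornerBox h2 l hx]
    exact hK x hx

/-- The Euclidean distance is at most the sum of the n coordinate distances, and n η/(n + 1) < η. -/
theorem closedCornerBox_subset_ball {η : ℝ} (hη : 0 < η) :
    closedCornerBox S c (η / (n + 1)) ⊆ Metric.ball c η := by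
  intro x hx
  rw [Metric.mem_ball]
  have h3 : dist x c ≤ ∑ i, |x i - c i| := by
    rw [EuclideanSpace.dist_eq]
    refine Real.sqrt_le_iff.2 ⟨Finset.sum_nonneg fun _ _ => abs_nonneg _, ?_⟩
    simp only [Real.dist_eq]
    exact Finset.sum_sq_le_sq_sum_of_nonneg fun _ _ => abs_nonneg _
  have h4 : ∑ i, |x i - c i| ≤ ∑ _i : Fin n, η / (n + 1) :=
    Finset.sum_le_sum fun i _ => (hx i).1
  rw [Finset.sum_const, Finset.card_univ, Fintype.card_fin, nsmul_eq_mul] at h4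
  have h5 : (n : ℝ) * (η / (n + 1)) < η := by
    rw [mul_div_assoc', div_lt_iff₀ (by positivity)]
    nlinarith
  linarith

theorem exists_closedCornerBox_ne_zero (hc : ∀ j ∈ S, c j = 0) (hε : 0 < ε)
    {u : EuclideanSpace ℝ (Fin n) → ℂ} (hu : ContinuousOn u (closedCornerBox S c ε))
    (h0 : u c ≠ 0) : ∃ ε₁, 0 < ε₁ ∧ ε₁ ≤ ε ∧ ∀ x ∈ closedCornerBox S c ε₁, u x ≠ 0 := by
  have h1 := (hu c (center_mem_closedCornerBox hε.le hc)).eventually_ne h0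
  rw [eventually_nhdsWithin_iff, Metric.eventually_nhds_iff] at h1
  obtain ⟨η, hη, h2⟩ := h1
  exact ⟨min ε (η / (n + 1)), lt_min hε (by positivity), min_le_left _ _, fun x hx =>
    h2 (closedCornerBox_subset_ball hη (closedCornerBox_mono (min_le_right _ _) hx))
      (closedCornerBox_mono (min_le_left _ _) hx)⟩

/-- A function `a ∏ (x j)^(α j)` with `a` positive and smooth up to the boundary is, in small
boxes, a phase function, provided that the derivative of `a` along a face does not vanish if there
are no powers. -/
theorem exists_isProductPhase (hc : ∀ j ∈ S, c j = 0) (hε : 0 < ε)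
    {a f : EuclideanSpace ℝ (Fin n) → ℝ} {α : Fin n → ℕ} (hfm : Measurable f)
    (ha : ContDiffOn ℝ ∞ a (closedCornerBox S c ε)) (ha0 : ∀ x ∈ closedCornerBox S c ε, 0 < a x)
    (hfa : ∀ x ∈ cornerBox S c ε, f x = a x * ∏ j ∈ S, x j ^ α j)
    (htr : (∀ j ∈ S, α j = 0) → ∃ i, i ∉ S ∧
      fderivWithin ℝ a (closedCornerBox S c ε) c (EuclideanSpace.single i 1) ≠ 0) :
    ∃ ε₁, 0 < ε₁ ∧ ∀ ε', 0 < ε' → ε' ≤ ε₁ → IsProductPhase S c ε' α a f := by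
  classical
  have hU := uniqueDiffOn_closedCornerBox (S := S) hε hc
  have hcC : c ∈ closedCornerBox S c ε := center_mem_closedCornerBox hε.le hc
  have haC : ContDiffOn ℝ ∞ (fun x => (a x : ℂ)) (closedCornerBox S c ε) :=
    Complex.ofRealCLM.contDiff.comp_contDiffOn ha
  have haI : ContDiffOn ℝ ∞ (fun x => (a x : ℂ)⁻¹) (closedCornerBox S c ε) :=
    haC.inv fun x hx => Complex.ofReal_ne_zero.2 (ha0 x hx).ne'
  -- The extension of `phaseLog` to the closed box. At the centre its value is α_i for i ∈ S, since
  -- x_i = 0 there, and ∂_i a / a otherwise; if this is not 0, it stays away from 0 on small boxes.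
  set κ : Fin n → EuclideanSpace ℝ (Fin n) → ℂ := fun i x => (if i ∈ S then (α i : ℂ) else 0) +
    (a x : ℂ)⁻¹ * (bCoef S i x * ((fderivWithin ℝ a (closedCornerBox S c ε) x
      (EuclideanSpace.single i 1) : ℝ) : ℂ)) with hκ
  have hκs : ∀ i, ContDiffOn ℝ ∞ (κ i) (closedCornerBox S c ε) := fun i =>
    contDiffOn_const.add (haI.mul ((contDiff_bCoef i).contDiffOn.mul
      (Complex.ofRealCLM.contDiff.comp_contDiffOn ((ha.fderivWithin hU (m := ∞) (by simp)).clm_apply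
        contDiffOn_const))))
  have hκe : ∀ i, ∀ x ∈ cornerBox S c ε, phaseLog S α a i x = κ i x := by
    intro i x hx
    have h1 : closedCornerBox S c ε ∈ 𝓝 x :=
      mem_of_superset (isOpen_cornerBox.mem_nhds hx) cornerBox_subset_closed
    have h2 : HasFDerivAt a (fderiv ℝ a x) x :=
      ((ha.contDiffAt h1).differentiableAt (by simp)).hasFDerivAt
    have h3 : HasFDerivAt (fun x => (a x : ℂ)) (Complex.ofRealCLM.comp (fderiv ℝ a x)) x :=
      Complex.ofRealCLM.hasFDerivAt.comp x h2
    simp only [phaseLog, hκ, bDeriv_apply, h3.fderiv, fderivWithin_of_mem_nhds h1,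
      ContinuousLinearMap.comp_apply, Complex.ofRealCLM_apply]
  have hgood : ∀ i, κ i c ≠ 0 → ∃ ε₁, 0 < ε₁ ∧ ∀ ε', 0 < ε' → ε' ≤ ε₁ →
      (∀ x ∈ cornerBox S c ε', phaseLog S α a i x ≠ 0) ∧
        IsSmoothBdd (cornerBox S c ε') fun x => (phaseLog S α a i x)⁻¹ := by
    intro i hi
    obtain ⟨ε₁, h1, h2, h3⟩ := exists_closedCornerBox_ne_zero hc hε (hκs i).continuousOn hi
    refine ⟨ε₁, h1, fun ε' h4 h5 => ?_⟩
    have h6 : ∀ x ∈ cornerBox S c ε', phaseLog S α a i x = κ i x := fun x hx =>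
      hκe i x (cornerBox_mono subset_rfl (h5.trans h2) hx)
    have h7 : ∀ x ∈ closedCornerBox S c ε', κ i x ≠ 0 := fun x hx =>
      h3 x (closedCornerBox_mono h5 hx)
    refine ⟨fun x hx => ?_, ?_⟩
    · rw [h6 x hx]; exact h7 x (cornerBox_subset_closed hx)
    · refine IsSymbol.congr isOpen_cornerBox (isSmoothBdd_of_contDiffOn_closed h4 hc
        (((hκs i).mono (closedCornerBox_mono (h5.trans h2))).inv h7)) fun x hx => ?_
      simp only [Pi.inv_apply, h6 x hx]
  have hgoodS : ∀ j, ∃ ε₁, 0 < ε₁ ∧ ∀ ε', 0 < ε' → ε' ≤ ε₁ → j ∈ S → 0 < α j →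
      (∀ x ∈ cornerBox S c ε', phaseLog S α a j x ≠ 0) ∧
        IsSmoothBdd (cornerBox S c ε') fun x => (phaseLog S α a j x)⁻¹ := by
    intro j
    by_cases hj : j ∈ S ∧ 0 < α j
    · obtain ⟨ε₁, h1, h2⟩ := hgood j (by
        simp only [hκ, hj.1, if_true, bCoef, hc j hj.1, Complex.ofReal_zero, zero_mul, mul_zero,
          add_zero]
        exact_mod_cast hj.2.ne')
      exact ⟨ε₁, h1, fun ε' h3 h4 _ _ => h2 ε' h3 h4⟩
    · exact ⟨1, one_pos, fun ε' _ _ h3 h4 => absurd ⟨h3, h4⟩ hj⟩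
  have hT : ∃ ε₁, 0 < ε₁ ∧ ∀ ε', 0 < ε' → ε' ≤ ε₁ → (∃ j ∈ S, 0 < α j) ∨ ∃ i, i ∉ S ∧
      (∀ x ∈ cornerBox S c ε', phaseLog S α a i x ≠ 0) ∧
        IsSmoothBdd (cornerBox S c ε') fun x => (phaseLog S α a i x)⁻¹ := by
    by_cases hS : ∃ j ∈ S, 0 < α j
    · exact ⟨1, one_pos, fun _ _ _ => Or.inl hS⟩
    · obtain ⟨i, hi, hd⟩ := htr fun j hj => by
        by_contra h
        exact hS ⟨j, hj, Nat.pos_of_ne_zero h⟩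
      obtain ⟨ε₁, h1, h2⟩ := hgood i (by
        simp only [hκ, hi, if_false, bCoef, one_mul, zero_add]
        refine mul_ne_zero (inv_ne_zero (Complex.ofReal_ne_zero.2 (ha0 c hcC).ne')) ?_
        exact Complex.ofReal_ne_zero.2 hd)
      exact ⟨ε₁, h1, fun ε' h3 h4 => Or.inr ⟨i, hi, h2 ε' h3 h4⟩⟩
  choose η hη0 hη using hgoodS
  obtain ⟨ε₂, hε₂, hT'⟩ := hT
  obtain ⟨ε₃, hε₃, hmin⟩ : ∃ ε₃, 0 < ε₃ ∧ ∀ j, ε₃ ≤ η j := by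
    rcases isEmpty_or_nonempty (Fin n) with h | h
    · exact ⟨1, one_pos, fun j => h.elim j⟩
    · obtain ⟨j0, hj0⟩ := Finite.exists_min η
      exact ⟨η j0, hη0 j0, hj0⟩
  refine ⟨min ε (min ε₂ ε₃), lt_min hε (lt_min hε₂ hε₃), fun ε' h0 h1 => ?_⟩
  have h2 : ε' ≤ ε := h1.trans (min_le_left _ _)
  have h3 : ε' ≤ ε₂ := h1.trans ((min_le_right _ _).trans (min_le_left _ _))
  have h4 : ε' ≤ ε₃ := h1.trans ((min_le_right _ _).trans (min_le_right _ _))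
  have hsub : cornerBox S c ε' ⊆ cornerBox S c ε := cornerBox_mono subset_rfl h2
  exact ⟨hfm, fun x hx => ha0 x (cornerBox_subset_closed (hsub hx)),
    isSmoothBdd_of_contDiffOn_closed h0 hc (haC.mono (closedCornerBox_mono h2)),
    isSmoothBdd_of_contDiffOn_closed h0 hc (haI.mono (closedCornerBox_mono h2)),
    fun x hx => hfa x (hsub hx), fun j hj hα => (hη j ε' h0 (h4.trans (hmin j)) hj hα).1,
    fun j hj hα => (hη j ε' h0 (h4.trans (hmin j)) hj hα).2, hT' ε' h0 h3⟩

end SmoothUpTo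

/-! ### Manifolds with corners -/

section Manifold

local notation "𝓠" => modelWithCornersEuclideanQuadrant

variable {n : ℕ} {W : Type u} [TopologicalSpace W] [ChartedSpace (EuclideanQuadrant n) W]
  {w y : W} {j : Fin n}

theorem range_corners : range (𝓠 n) = {x | ∀ i, 0 ≤ x i} := range_euclideanQuadrant n

theorem interior_range_corners : interior (range (𝓠 n)) = {x | ∀ i, 0 < x i} := by
  rw [range_corners]; exact interior_euclideanQuadrant n 2 0

theorem coord_mem_range (w y : W) : coord (n := n) w y ∈ range (𝓠 n) := mem_range_self _

theorem coord_nonneg (w y : W) (i : Fin n) : 0 ≤ coord (n := n) w y i := by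
  have := coord_mem_range (n := n) w y
  rw [range_corners] at this
  exact this i

theorem mem_boundaryIndices : j ∈ boundaryIndices n w ↔ coord (n := n) w w j = 0 := by
  simp [boundaryIndices]

theorem center_eq_zero : ∀ j ∈ boundaryIndices n w, coord (n := n) w w j = 0 :=
  fun _ hj => mem_boundaryIndices.1 hj

theorem center_pos (h : j ∉ boundaryIndices n w) : 0 < coord (n := n) w w j :=
  lt_of_le_of_ne (coord_nonneg w w j) fun h' => h (mem_boundaryIndices.2 h'.symm)

theorem continuousAt_coord (h : y ∈ (extChartAt (𝓠 n) w).source) (i : Fin n) :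
    ContinuousAt (fun z => coord (n := n) w z i) y :=
  (contDiff_coord i).continuous.continuousAt.comp (continuousAt_extChartAt' h)

/-- Being an interior point does not depend on the chart, so the chart around w may be used at y. -/
theorem mem_interior_iff [IsManifold (𝓠 n) ∞ W] (hy : y ∈ (extChartAt (𝓠 n) w).source) :
    y ∈ (𝓠 n).interior W ↔ ∀ i, 0 < coord (n := n) w y i := by
  have h1 := (𝓠 n).isInteriorPoint_iff_of_mem_atlas (n := ∞) (by simp)
    (chart_mem_atlas (EuclideanQuadrant n) w) (x := y) (by rwa [extChartAt_source] at hy)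
  refine h1.trans ⟨fun h => ?_, fun h => ?_⟩
  · have h2 := interior_mono (extChartAt_target_subset_range (I := 𝓠 n) w) h
    rw [interior_range_corners] at h2
    exact h2
  · have h2 : coord (n := n) w y ∈ interior (range (𝓠 n)) := by rwa [interior_range_corners]
    have h3 := extChartAt_target_mem_nhdsWithin' (I := 𝓠 n) hy
    rw [mem_interior_iff_mem_nhds] at h2 ⊢
    exact (nhdsWithin_eq_nhds.2 h2 ▸ h3 : _ ∈ 𝓝 (coord (n := n) w y))

/-- Small boxes around `w` are contained in the chart. -/
theorem exists_closedCornerBox_subset {N : Set W} (hN : N ∈ 𝓝 w) :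
    ∃ ε, 0 < ε ∧ ∀ ε' ≤ ε, closedCornerBox (boundaryIndices n w) (coord w w) ε' ⊆
      (extChartAt (𝓠 n) w).target ∩ (extChartAt (𝓠 n) w).symm ⁻¹' N ∩ range (𝓠 n) := by
  have h1 : (extChartAt (𝓠 n) w).symm ⁻¹' N ∈ 𝓝[range (𝓠 n)] coord w w := by
    have := map_extChartAt_symm_nhdsWithin_range (I := 𝓠 n) w
    rw [← this] at hN
    exact hN
  have h2 := inter_mem (extChartAt_target_mem_nhdsWithin (I := 𝓠 n) w) h1
  obtain ⟨η, hη, h3⟩ := Metric.mem_nhdsWithin_iff.1 h2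
  -- Coordinates that are positive at w must remain non-negative on the box.
  obtain ⟨ε₁, hε₁, h4⟩ : ∃ ε₁, 0 < ε₁ ∧ ∀ i ∉ boundaryIndices n w, ε₁ ≤ coord (n := n) w w i := by
    have h5 : ∀ i, ∃ e, 0 < e ∧ (i ∉ boundaryIndices n w → e ≤ coord (n := n) w w i) := fun i => by
      by_cases h : i ∈ boundaryIndices n w
      · exact ⟨1, one_pos, fun h' => absurd h h'⟩
      · exact ⟨_, center_pos h, fun _ => le_rfl⟩
    choose e he he' using h5
    rcases isEmpty_or_nonempty (Fin n) with h | h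
    · exact ⟨1, one_pos, fun j => h.elim j⟩
    · obtain ⟨j0, hj0⟩ := Finite.exists_min e
      exact ⟨e j0, he j0, fun i hi => (hj0 i).trans (he' i hi)⟩
  refine ⟨min ε₁ (η / (n + 1)), lt_min hε₁ (by positivity), fun ε' hε' x hx => ?_⟩
  have hr : x ∈ range (𝓠 n) := by
    rw [range_corners]
    intro i
    by_cases hi : i ∈ boundaryIndices n w
    · exact (hx i).2 hi
    · have h6 := (abs_le.1 (hx i).1).1
      have h7 := h4 i hi
      have h8 := hε'.trans (min_le_left _ _)
      linarith
  exact ⟨h3 ⟨closedCornerBox_subset_ball hη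
    (closedCornerBox_mono (hε'.trans (min_le_right _ _)) hx), hr⟩, hr⟩

/-- Near `w` there are points in the interior of each local face. -/
theorem exists_point_of_face {N : Set W} (hN : N ∈ 𝓝 w) {T : Finset (Fin n)}
    (hT : T ⊆ boundaryIndices n w) :
    ∃ y ∈ N, y ∈ (extChartAt (𝓠 n) w).source ∧ ∀ i, coord (n := n) w y i = 0 ↔ i ∈ T := by
  classical
  obtain ⟨ε, hε, h⟩ := exists_closedCornerBox_subset (n := n) hN
  set x : EuclideanSpace ℝ (Fin n) := WithLp.toLp 2 fun i =>
    if i ∈ T then 0 else if i ∈ boundaryIndices n w then ε else coord (n := n) w w i with hx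
  have hxi : ∀ i, x i = if i ∈ T then 0 else if i ∈ boundaryIndices n w then ε else
    coord (n := n) w w i := fun i => rfl
  have hxB : x ∈ closedCornerBox (boundaryIndices n w) (coord w w) ε := by
    intro i
    rw [hxi]
    by_cases hiT : i ∈ T
    · simp [hiT, center_eq_zero i (hT hiT), hε.le]
    · by_cases hi : i ∈ boundaryIndices n w
      · simp [hiT, hi, center_eq_zero i hi, abs_of_pos hε, hε.le]
      · simp [hiT, hi, hε.le]
  obtain ⟨⟨h1, h2⟩, h3⟩ := h ε le_rfl hxB
  refine ⟨(extChartAt (𝓠 n) w).symm x, h2, (extChartAt (𝓠 n) w).map_target h1, fun i => ?_⟩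
  have h4 : coord (n := n) w ((extChartAt (𝓠 n) w).symm x) = x := (extChartAt (𝓠 n) w).right_inv h1
  rw [h4, hxi]
  by_cases hiT : i ∈ T
  · simp [hiT]
  · by_cases hi : i ∈ boundaryIndices n w
    · simp [hiT, hi, hε.ne']
    · simp [hiT, hi, (center_pos hi).ne']

/-- The path in direction of the `k`-th coordinate that starts at `y`. -/
def coordPath (n : ℕ) {W : Type u} [TopologicalSpace W] [ChartedSpace (EuclideanQuadrant n) W]
    (y : W) (k : Fin n) (s : ℝ) : W :=
  (extChartAt (𝓠 n) y).symm (coord (n := n) y y + s • EuclideanSpace.single k (1 : ℝ))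

theorem add_smul_single_mem_range (y : W) (k : Fin n) {s : ℝ} (hs : 0 ≤ s) :
    coord (n := n) y y + s • EuclideanSpace.single k (1 : ℝ) ∈ range (𝓠 n) := by
  rw [range_corners]
  intro i
  have h1 := coord_nonneg (n := n) y y i
  rcases eq_or_ne i k with rfl | h
  · simp; linarith
  · simpa [h] using h1

theorem hasDerivAt_add_smul_single (x : EuclideanSpace ℝ (Fin n)) (k : Fin n) :
    HasDerivAt (fun s : ℝ => x + s • EuclideanSpace.single k (1 : ℝ))
      (EuclideanSpace.single k 1) 0 := by
  simpa using ((hasDerivAt_id (0 : ℝ)).smul_const (EuclideanSpace.single k (1 : ℝ))).const_add x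

theorem tendsto_line (y : W) (k : Fin n) :
    Tendsto (fun s : ℝ => coord (n := n) y y + s • EuclideanSpace.single k (1 : ℝ)) (𝓝[≥] 0)
      (𝓝[range (𝓠 n)] coord y y) := by
  refine tendsto_nhdsWithin_iff.2 ⟨?_, ?_⟩
  · have := (hasDerivAt_add_smul_single (coord (n := n) y y) k).continuousAt.tendsto
    simp only [zero_smul, add_zero] at this
    exact this.mono_left nhdsWithin_le_nhds
  · filter_upwards [self_mem_nhdsWithin] with s hs using add_smul_single_mem_range y k hs

theorem tendsto_coordPath (y : W) (k : Fin n) :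
    Tendsto (coordPath n y k) (𝓝[≥] 0) (𝓝 y) := by
  have h2 := map_extChartAt_symm_nhdsWithin_range (I := 𝓠 n) y
  have h3 : Tendsto (extChartAt (𝓠 n) y).symm (𝓝[range (𝓠 n)] coord y y) (𝓝 y) := h2.le
  exact h3.comp (tendsto_line y k)

theorem coord_coordPath (y : W) (k : Fin n) : ∀ᶠ s in 𝓝[≥] (0 : ℝ),
    coord (n := n) y (coordPath n y k s) = coord y y + s • EuclideanSpace.single k (1 : ℝ) := by
  filter_upwards [(tendsto_line y k).eventually (extChartAt_target_mem_nhdsWithin (I := 𝓠 n) y)]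
    with s hs using (extChartAt (𝓠 n) y).right_inv hs

/-- At a point `y` of the relative interior of a local hypersurface, only one coordinate around `y`
vanishes, and it is comparable with the coordinate that defines the hypersurface. -/
theorem boundaryIndices_eq_singleton [IsManifold (𝓠 n) ∞ W]
    (hy : y ∈ (extChartAt (𝓠 n) w).source)
    (hj : coord (n := n) w y j = 0) (hpos : ∀ i, i ≠ j → 0 < coord (n := n) w y i) :
    ∃ j', boundaryIndices n y = {j'} ∧ ∃ d ≠ 0,
      HasDerivWithinAt (fun s => coord (n := n) w (coordPath n y j' s) j) d (Ici 0) 0 := by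
  have : IsManifold (𝓠 n) 1 W := IsManifold.of_le (n := ∞) (by simp)
  set T := tangentCoordChange (𝓠 n) y w y with hT
  have hyy := mem_extChartAt_source (I := 𝓠 n) y
  have hder : ∀ k, HasDerivWithinAt (fun s => coord (n := n) w (coordPath n y k s) j)
      ((T (EuclideanSpace.single k 1)) j) (Ici 0) 0 := by
    intro k
    have h1 := hasFDerivWithinAt_tangentCoordChange (I := 𝓠 n) (x := y) (y := w) (z := y) ⟨hyy, hy⟩
    have h2 := (hasDerivAt_add_smul_single (coord (n := n) y y) k).hasDerivWithinAt (s := Ici 0)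
    have h3 := HasFDerivWithinAt.comp_hasDerivWithinAt_of_eq (0 : ℝ) h1 h2
      (fun s hs => add_smul_single_mem_range y k hs) (by simp; rfl)
    exact (EuclideanSpace.proj (𝕜 := ℝ) j).hasFDerivAt.comp_hasDerivWithinAt (0 : ℝ) h3
  -- If another boundary coordinate l keeps vanishing along the path in direction k, the path avoids
  -- the interior. In the chart around w this forces the j-th coordinate to stay 0.
  have hzero : ∀ k, (∃ l ∈ boundaryIndices n y, l ≠ k) → (T (EuclideanSpace.single k 1)) j = 0 := by
    rintro k ⟨l, hl, hlk⟩
    have h1 : (fun s => coord (n := n) w (coordPath n y k s) j) =ᶠ[𝓝[≥] 0] fun _ => 0 := by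
      have h2 : ∀ᶠ z in 𝓝 y, ∀ i, i ≠ j → 0 < coord (n := n) w z i := by
        rw [eventually_all]
        intro i
        by_cases hi : i = j
        · exact Eventually.of_forall fun _ h => absurd hi h
        · filter_upwards [(continuousAt_coord hy i).eventually (lt_mem_nhds (hpos i hi))] with z hz _
            using hz
      filter_upwards [coord_coordPath y k, (tendsto_coordPath y k).eventually h2,
        (tendsto_coordPath y k).eventually (extChartAt_source_mem_nhds' (I := 𝓠 n) hy),
        (tendsto_coordPath y k).eventually (extChartAt_source_mem_nhds (I := 𝓠 n) y)]
        with s hs1 hs2 hs3 hs4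
      have h5 : coordPath n y k s ∉ (𝓠 n).interior W := by
        rw [mem_interior_iff hs4]
        intro h6
        have h7 := h6 l
        rw [hs1] at h7
        simp [hlk, center_eq_zero l hl] at h7
      rw [mem_interior_iff hs3] at h5
      by_contra h0
      refine h5 fun i => ?_
      rcases eq_or_ne i j with rfl | hi
      · exact lt_of_le_of_ne (coord_nonneg _ _ _) (Ne.symm h0)
      · exact hs2 i hi
    have h2 : HasDerivWithinAt (fun _ : ℝ => (0 : ℝ)) ((T (EuclideanSpace.single k 1)) j) (Ici 0) 0 :=
      (hder k).congr_of_eventuallyEq_of_mem h1.symm (mem_Ici.2 le_rfl)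
    exact (uniqueDiffWithinAt_Ici (0 : ℝ)).eq_deriv _ h2 (hasDerivWithinAt_const _ _ _)
  -- The derivative of the change of coordinates is invertible, so its j-th row is not zero.
  have hrow : ∃ k, (T (EuclideanSpace.single k 1)) j ≠ 0 := by
    by_contra! hall
    have h1 : ∀ v : EuclideanSpace ℝ (Fin n), (T v) j = 0 := by
      intro v
      have h2 : v = ∑ k, v k • EuclideanSpace.single k (1 : ℝ) := by
        ext i; simp [Finset.sum_apply, Pi.single_apply]
      rw [h2, map_sum]
      simp [hall]
    have h3 := tangentCoordChange_comp (I := 𝓠 n) (w := w) (x := y) (y := w) (z := y)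
      (v := EuclideanSpace.single j 1) ⟨⟨hy, hyy⟩, hy⟩
    rw [tangentCoordChange_self hy] at h3
    have h4 := h1 (tangentCoordChange (𝓠 n) w y y (EuclideanSpace.single j 1))
    rw [hT, h3] at h4
    simp at h4
  have hne : (boundaryIndices n y).Nonempty := by
    by_contra h
    rw [Finset.not_nonempty_iff_eq_empty] at h
    have h1 : y ∈ (𝓠 n).interior W := (mem_interior_iff hyy).2 fun i => center_pos (by simp [h])
    have h2 := (mem_interior_iff hy).1 h1 j
    exact h2.ne' hj
  obtain ⟨k, hk⟩ := hrow
  have hall : ∀ l ∈ boundaryIndices n y, l = k := fun l hl => by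
    by_contra hlk
    exact hk (hzero k ⟨l, hl, hlk⟩)
  refine ⟨k, Finset.eq_singleton_iff_unique_mem.2 ⟨?_, hall⟩, _, hk, hder k⟩
  obtain ⟨l, hl⟩ := hne
  exact hall l hl ▸ hl

end Manifold

/-! ### Boundary hypersurfaces and orders of vanishing -/

section Manifold

local notation "𝓠" => modelWithCornersEuclideanQuadrant

variable {n : ℕ} {W : Type u} [TopologicalSpace W] [ChartedSpace (EuclideanQuadrant n) W]
  {w y : W} {j : Fin n} {G G' : Set W} {f : W → ℝ} {α : Fin n → ℕ}

theorem eventually_coord_pos (w : W) : ∀ᶠ y in 𝓝 w, ∀ i, i ∉ boundaryIndices n w →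
    0 < coord (n := n) w y i := by
  rw [eventually_all]
  intro i
  by_cases hi : i ∈ boundaryIndices n w
  · exact Eventually.of_forall fun _ h => absurd hi h
  · filter_upwards [(continuousAt_coord (mem_extChartAt_source (I := 𝓠 n) w) i).eventually
      (lt_mem_nhds (center_pos hi))] with z hz _ using hz

/-- The orders of vanishing in two product forms agree. -/
theorem eq_of_mul_pow_eq {A B u : ℝ → ℝ} {A₀ B₀ d : ℝ} {p q : ℕ} (hA : Tendsto A (𝓝[>] 0) (𝓝 A₀))
    (hB : Tendsto B (𝓝[>] 0) (𝓝 B₀)) (hA0 : A₀ ≠ 0) (hB0 : B₀ ≠ 0) (hd : d ≠ 0)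
    (hu : Tendsto (fun s => u s / s) (𝓝[>] 0) (𝓝 d))
    (h : ∀ᶠ s in 𝓝[>] 0, A s * s ^ p = B s * u s ^ q) : p = q := by
  have hid : Tendsto (fun s : ℝ => s) (𝓝[>] 0) (𝓝 0) := tendsto_nhdsWithin_of_tendsto_nhds tendsto_id
  have hBu := hB.mul (hu.pow q)
  have hne : B₀ * d ^ q ≠ 0 := mul_ne_zero hB0 (pow_ne_zero _ hd)
  rcases lt_trichotomy p q with hpq | hpq | hpq
  · exfalso
    refine hA0 (tendsto_nhds_unique (hA.congr' ?_) (?_ : Tendsto (fun s => B s * (u s / s) ^ q *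
      s ^ (q - p)) (𝓝[>] 0) (𝓝 0)))
    · filter_upwards [h, self_mem_nhdsWithin] with s hs hs0
      have hs0' : s ≠ 0 := ne_of_gt hs0
      have e : s ^ q = s ^ p * s ^ (q - p) := by rw [← pow_add]; congr 1; omega
      have hp := pow_ne_zero p hs0'
      have hq := pow_ne_zero q hs0'
      rw [div_pow]
      have : A s * s ^ q = B s * u s ^ q * s ^ (q - p) := by rw [e, ← mul_assoc, hs]
      field_simp
      linarith
    · have := hBu.mul (hid.pow (q - p))
      rwa [zero_pow (by omega), mul_zero] at this
  · exact hpq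
  · exfalso
    refine hne (tendsto_nhds_unique (hBu.congr' ?_) (?_ : Tendsto (fun s => A s *
      s ^ (p - q)) (𝓝[>] 0) (𝓝 0)))
    · filter_upwards [h, self_mem_nhdsWithin] with s hs hs0
      have hs0' : s ≠ 0 := ne_of_gt hs0
      have e : s ^ p = s ^ q * s ^ (p - q) := by rw [← pow_add]; congr 1; omega
      have hq := pow_ne_zero q hs0'
      rw [e] at hs
      rw [div_pow]
      field_simp
      linarith
    · have := hA.mul (hid.pow (p - q))
      rwa [zero_pow (by omega), mul_zero] at this

theorem coordPath_zero (y : W) (k : Fin n) : coordPath n y k 0 = y := by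
  simp only [coordPath, zero_smul, add_zero]
  exact extChartAt_to_inv (I := 𝓠 n) y

/-- Follow f along the path that leaves y in its only boundary direction. The product form at y
gives a multiple of s^(α' j'), the one at w a multiple of s^(α j), because the j-th coordinate
around w is comparable with s. -/
theorem IsProductForm.eventually_exponent_eq [IsManifold (𝓠 n) ∞ W] (hα : IsProductForm f w α) :
    ∀ᶠ y in 𝓝 w, ∀ j, coord (n := n) w y j = 0 → (∀ i, i ≠ j → 0 < coord (n := n) w y i) →
      ∀ α' : Fin n → ℕ, IsProductForm f y α' → ∃ j', boundaryIndices n y = {j'} ∧ α' j' = α j := by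
  classical
  obtain ⟨a, ⟨U, hU, ha⟩, ha0, heq⟩ := hα
  have hac := ha.continuousOn.continuousAt hU
  filter_upwards [eventually_eventually_nhds.2 heq, eventually_mem_nhds_iff.2 hU,
    hac.eventually_ne ha0, extChartAt_source_mem_nhds (I := 𝓠 n) w, eventually_coord_pos (n := n) w]
    with y h1 h2 h3 h4 h5 j hj hpos α' hα'
  obtain ⟨a', ⟨U', hU', ha'⟩, ha0', heq'⟩ := hα'
  obtain ⟨j', hj', d, hd, hder⟩ := boundaryIndices_eq_singleton h4 hj hpos
  refine ⟨j', hj', ?_⟩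
  have hjS : j ∈ boundaryIndices n w := by
    by_contra h
    exact (h5 j h).ne' hj
  have hpath : Tendsto (coordPath n y j') (𝓝[>] 0) (𝓝 y) :=
    (tendsto_coordPath y j').mono_left (nhdsWithin_mono _ Ioi_subset_Ici_self)
  set u : ℝ → ℝ := fun s => coord (n := n) w (coordPath n y j' s) j with hu
  have hu0 : u 0 = 0 := by simp only [hu, coordPath_zero]; exact hj
  have hslope : Tendsto (fun s => u s / s) (𝓝[>] 0) (𝓝 d) := by
    have := (hasDerivWithinAt_iff_tendsto_slope' (self_notMem_Ioi)).1
      (hder.mono Ioi_subset_Ici_self)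
    refine this.congr fun s => ?_
    change slope u 0 s = u s / s
    rw [slope_def_field, hu0, sub_zero, sub_zero]
  have hA : Tendsto (fun s => a' (coordPath n y j' s)) (𝓝[>] 0) (𝓝 (a' y)) :=
    (ha'.continuousOn.continuousAt hU').tendsto.comp hpath
  have hB : Tendsto (fun s => a (coordPath n y j' s) *
      ∏ k ∈ (boundaryIndices n w).erase j, coord (n := n) w (coordPath n y j' s) k ^ α k) (𝓝[>] 0)
      (𝓝 (a y * ∏ k ∈ (boundaryIndices n w).erase j, coord (n := n) w y k ^ α k)) :=
    ((ha.continuousOn.continuousAt h2).tendsto.comp hpath).mul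
      (tendsto_finsetProd _ fun k _ => ((continuousAt_coord h4 k).tendsto.comp hpath).pow _)
  have hB0 : a y * ∏ k ∈ (boundaryIndices n w).erase j, coord (n := n) w y k ^ α k ≠ 0 :=
    mul_ne_zero h3 (Finset.prod_ne_zero_iff.2 fun k hk =>
      pow_ne_zero _ (hpos k (Finset.ne_of_mem_erase hk)).ne')
  refine eq_of_mul_pow_eq hA hB ha0' hB0 hd hslope ?_
  filter_upwards [hpath.eventually h1, hpath.eventually heq',
    (coord_coordPath y j').filter_mono (nhdsWithin_mono _ Ioi_subset_Ici_self)] with s k1 k2 k3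
  have hcj : coord (n := n) y y j' = 0 := center_eq_zero j' (by simp [hj'])
  rw [hj', Finset.prod_singleton, k3] at k2
  simp only [PiLp.add_apply, hcj, PiLp.smul_apply, PiLp.single_apply, if_true, smul_eq_mul,
    mul_one, zero_add] at k2
  rw [← k2, k1, ← Finset.mul_prod_erase _ _ hjS]
  ring

theorem IsLocalFace.mem_boundaryIndices (h : IsLocalFace G w j) : j ∈ boundaryIndices n w :=
  PushForward.mem_boundaryIndices.2 (h.2.self_of_nhds.1 h.1)

/-- Near `w` there are points in the relative interior of a local face. -/
theorem IsLocalFace.exists_point (h : IsLocalFace G w j) {p : W → Prop} (hp : ∀ᶠ y in 𝓝 w, p y) :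
    ∃ y, p y ∧ y ∈ G ∧ y ∈ (extChartAt (𝓠 n) w).source ∧ coord (n := n) w y j = 0 ∧
      ∀ i, i ≠ j → 0 < coord (n := n) w y i := by
  obtain ⟨y, ⟨hy1, hy2⟩, hy3, hy4⟩ := exists_point_of_face (n := n) (hp.and h.2)
    (T := {j}) (by simpa using h.mem_boundaryIndices)
  have h0 : coord (n := n) w y j = 0 := (hy4 j).2 (by simp)
  exact ⟨y, hy1, hy2.2 h0, hy3, h0, fun i hi => lt_of_le_of_ne (coord_nonneg _ _ _) fun h =>
    hi (by simpa using (hy4 i).1 h.symm)⟩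

/-- At a point in the relative interior of the local face only one coordinate vanishes. -/
theorem IsLocalFace.unique_index {j' : Fin n} (h : IsLocalFace G w j) (h' : IsLocalFace G w j') :
    j = j' := by
  obtain ⟨y, hy, hyG, -, -, hpos⟩ := h.exists_point h'.2
  by_contra hne
  exact (hpos j' (Ne.symm hne)).ne' (hy.1 hyG)

/-- A connected set remains connected when a point of its closure is added. So the closure of a
component of the codimension-one stratum meets that stratum only in the component itself. -/
theorem mem_connectedComponentIn_of_mem_closure {X : Type*} [TopologicalSpace X] {F : Set X}
    {x z : X} (hx : x ∈ F) (hz : z ∈ F) (h : z ∈ closure (connectedComponentIn F x)) :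
    z ∈ connectedComponentIn F x := by
  have h1 : IsPreconnected (insert z (connectedComponentIn F x)) :=
    isPreconnected_connectedComponentIn.subset_closure (subset_insert _ _)
      (insert_subset h subset_closure)
  exact h1.subset_connectedComponentIn (mem_insert_of_mem _ (mem_connectedComponentIn hx))
    (insert_subset hz (connectedComponentIn_subset _ _)) (mem_insert _ _)

/-- The two hypersurfaces share a point of codimension one and thus come from the same component. -/
theorem IsBhs.eq_of_isLocalFace [IsManifold (𝓠 n) ∞ W] (hG : IsBhs n G) (hG' : IsBhs n G')
    (h : IsLocalFace G w j) (h' : IsLocalFace G' w j) : G = G' := by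
  obtain ⟨x, hx, rfl⟩ := hG
  obtain ⟨x', hx', rfl⟩ := hG'
  obtain ⟨y, hy, hyG, hys, hyj, hpos⟩ := h.exists_point h'.2
  obtain ⟨j', hj', -⟩ := boundaryIndices_eq_singleton hys hyj hpos
  have hy1 : y ∈ {v : W | (boundaryIndices n v).card = 1} := by simp [hj']
  have e1 := connectedComponentIn_eq (mem_connectedComponentIn_of_mem_closure
    (F := {v : W | (boundaryIndices n v).card = 1}) hx hy1 hyG)
  have e2 := connectedComponentIn_eq (mem_connectedComponentIn_of_mem_closure
    (F := {v : W | (boundaryIndices n v).card = 1}) hx' hy1 (hy.2 hyj))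
  rw [e1, e2]

/-- The order of vanishing at a hypersurface is the exponent in all product forms. -/
theorem vanishingOrder_eq [IsManifold (𝓠 n) ∞ W] (hf : IsBMap n f) (hG : IsBhs n G)
    (h : IsLocalFace G w j) (hα : IsProductForm f w α) : vanishingOrder n f G = α j := by
  obtain ⟨x, hx, rfl⟩ := hG
  choose A hA using hf.2
  set F : Set W := {v : W | (boundaryIndices n v).card = 1} with hF
  -- At a point of codimension one the sum has a single term, the exponent there. It is locally
  -- constant along the stratum, hence constant on the component.
  let ex : W → ℕ := fun y => ∑ i ∈ boundaryIndices n y, A y i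
  have hconst : ∀ y ∈ connectedComponentIn F x, ∀ z ∈ connectedComponentIn F x, ex y = ex z := by
    intro y hy z hz
    refine isPreconnected_connectedComponentIn.induction₂ (fun y z => ex y = ex z) (fun y hy => ?_)
      (fun _ _ _ _ _ _ h1 h2 => h1.trans h2) (fun _ _ _ _ h => h.symm) hy hz
    have hyF : y ∈ F := connectedComponentIn_subset _ _ hy
    obtain ⟨j, hj⟩ := Finset.card_eq_one.1 hyF
    filter_upwards [nhdsWithin_le_nhds (hA y).eventually_exponent_eq,
      nhdsWithin_le_nhds (extChartAt_source_mem_nhds (I := 𝓠 n) y),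
      nhdsWithin_le_nhds (eventually_coord_pos (n := n) y), self_mem_nhdsWithin] with z h1 h2 h3 h4
    have hzF : z ∈ F := connectedComponentIn_subset _ _ h4
    obtain ⟨k, hk⟩ := Finset.card_eq_one.1 hzF
    have hpos : ∀ i, i ≠ j → 0 < coord (n := n) y z i := fun i hi => h3 i (by simp [hj, hi])
    have hzj : coord (n := n) y z j = 0 := by
      by_contra h0
      have h5 : z ∈ (𝓠 n).interior W := (mem_interior_iff h2).2 fun i => by
        rcases eq_or_ne i j with rfl | hi
        · exact lt_of_le_of_ne (coord_nonneg _ _ _) (Ne.symm h0)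
        · exact hpos i hi
      have h6 := (mem_interior_iff (mem_extChartAt_source (I := 𝓠 n) z)).1 h5 k
      exact h6.ne' (center_eq_zero k (by simp [hk]))
    obtain ⟨j', h5, h6⟩ := h1 j hzj hpos (A z) (hA z)
    simp only [ex, hj, h5, Finset.sum_singleton, h6]
  have hval : ∀ (w : W) (α : Fin n → ℕ) (j : Fin n), IsProductForm f w α →
      IsLocalFace (closure (connectedComponentIn F x)) w j → α j = ex x := by
    intro w α j hα h
    obtain ⟨y, hy, hyG, hys, hyj, hpos⟩ := h.exists_point hα.eventually_exponent_eq
    obtain ⟨j', h5, h6⟩ := hy j hyj hpos (A y) (hA y)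
    have hyF : y ∈ F := by simp [hF, h5]
    rw [← hconst y (mem_connectedComponentIn_of_mem_closure hx hyF hyG) x
      (mem_connectedComponentIn hx)]
    simp only [ex, h5, Finset.sum_singleton, h6]
  have hset : {k | ∃ (w : W) (α : Fin n → ℕ) (j : Fin n), IsProductForm f w α ∧
      IsLocalFace (closure (connectedComponentIn F x)) w j ∧ k = α j} = {α j} := by
    ext k
    simp only [mem_ofPred_eq, mem_singleton_iff]
    constructor
    · rintro ⟨w', α', j', h1, h2, rfl⟩
      rw [hval w' α' j' h1 h2, hval w α j hα h]
    · rintro rfl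
      exact ⟨w, α, j, hα, h, rfl⟩
  rw [vanishingOrder, hset, csInf_singleton]

/-- The function `a` in a product form of a b-map is positive. -/
theorem product_form_pos {a : W → ℝ} (hf : ∀ w, 0 ≤ f w) (hac : ContinuousAt a w) (ha0 : a w ≠ 0)
    (heq : ∀ᶠ y in 𝓝 w, f y = a y * ∏ j ∈ boundaryIndices n w, coord w y j ^ α j) : 0 < a w := by
  refine lt_of_le_of_ne (le_of_not_gt fun hneg => ?_) ha0.symm
  obtain ⟨y, ⟨hy1, hy2⟩, -, hy4⟩ := exists_point_of_face (n := n)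
    (heq.and (hac.eventually (gt_mem_nhds hneg))) (T := ∅) (by simp)
  have hp : 0 < ∏ j ∈ boundaryIndices n w, coord (n := n) w y j ^ α j :=
    Finset.prod_pos fun j _ => pow_pos (lt_of_le_of_ne (coord_nonneg _ _ _) fun h => by
      simpa using (hy4 j).1 h.symm) _
  have h1 := hf y
  rw [hy1] at h1
  exact absurd h1 (not_le.2 (mul_neg_of_neg_of_pos hy2 hp))

end Manifold

/-! ### Fibrations in coordinates around a point -/

section Manifold

local notation "𝓠" => modelWithCornersEuclideanQuadrant

variable {n : ℕ} {W : Type u} [TopologicalSpace W] [ChartedSpace (EuclideanQuadrant n) W]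
  {w y : W} {j : Fin n} {G G' : Set W} {f : W → ℝ} {α : Fin n → ℕ}

theorem contDiffOn_comp_extChartAt_symm [IsManifold (𝓠 n) ∞ W] {a : W → ℝ} {U : Set W}
    (ha : ContMDiffOn (𝓠 n) 𝓘(ℝ, ℝ) ∞ a U) {B : Set (EuclideanSpace ℝ (Fin n))}
    (hB : B ⊆ (extChartAt (𝓠 n) w).target ∩ (extChartAt (𝓠 n) w).symm ⁻¹' U) :
    ContDiffOn ℝ ∞ (fun x => a ((extChartAt (𝓠 n) w).symm x)) B := by
  rw [← contMDiffOn_iff_contDiffOn]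
  exact ha.comp ((contMDiffOn_extChartAt_symm w).mono fun x hx => (hB hx).1) fun x hx => (hB hx).2

theorem IsProductForm.continuousAt (hα : IsProductForm f w α) : ContinuousAt f w := by
  obtain ⟨a, ⟨U, hU, ha⟩, ha0, heq⟩ := hα
  have h1 : ContinuousAt (fun y => a y * ∏ j ∈ boundaryIndices n w, coord (n := n) w y j ^ α j) w :=
    (ha.continuousOn.continuousAt hU).mul (tendsto_finsetProd _ fun k _ =>
      (continuousAt_coord (mem_extChartAt_source (I := 𝓠 n) w) k).pow _)
  exact h1.congr (heq.mono fun y hy => hy.symm)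

theorem IsBMap.continuous (hf : IsBMap n f) : Continuous f :=
  continuous_iff_continuousAt.2 fun w => (hf.2 w).choose_spec.continuousAt

/-- A fibration has no critical points along the faces. -/
theorem IsFibrationOverPos.exists_deriv_ne_zero [IsManifold (𝓠 n) ∞ W]
    (hfib : IsFibrationOverPos n f) (hw : 0 < f w) {a : EuclideanSpace ℝ (Fin n) → ℝ} {ε : ℝ}
    (hε : 0 < ε) (ha : DifferentiableWithinAt ℝ a
      (closedCornerBox (boundaryIndices n w) (coord w w) ε) (coord w w))
    (hfa : ∀ᶠ y in 𝓝 w, f y = a (coord w y)) : ∃ i, i ∉ boundaryIndices n w ∧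
      fderivWithin ℝ a (closedCornerBox (boundaryIndices n w) (coord w w) ε) (coord w w)
        (EuclideanSpace.single i 1) ≠ 0 := by
  obtain ⟨m, L, _, _, _, U, Φ, hU, htU, -, hsrc, htgt, -, hΦs, hΦf⟩ := hfib (f w) hw
  have hws : w ∈ Φ.source := hsrc rfl
  have hw1 : (Φ w).1 = f w := hΦf w hws
  set l := (Φ w).2 with hl
  have hwl : (f w, l) = Φ w := by rw [← hw1]
  -- A smooth section of f through w: f(γ(s)) = s.
  set γ : ℝ → W := fun s => Φ.symm (s, l) with hγ
  have hγw : γ (f w) = w := by simp only [hγ, hwl, Φ.left_inv hws]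
  have hγs : ContMDiffAt 𝓘(ℝ, ℝ) (𝓠 n) ∞ γ (f w) := by
    have h1 : ContMDiffAt (𝓘(ℝ, ℝ).prod (𝓠 m)) (𝓠 n) ∞ Φ.symm (f w, l) := by
      refine hΦs.contMDiffAt ?_
      rw [hwl]
      exact Φ.open_target.mem_nhds (Φ.map_source hws)
    exact h1.comp (f w) (contMDiffAt_id.prodMk contMDiffAt_const)
  have hx : ContDiffAt ℝ ∞ (fun s => coord (n := n) w (γ s)) (f w) := by
    rw [← contMDiffAt_iff_contDiffAt]
    have h2 : ContMDiffAt (𝓠 n) 𝓘(ℝ, EuclideanSpace ℝ (Fin n)) ∞ (extChartAt (𝓠 n) w) (γ (f w)) := by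
      rw [hγw]; exact contMDiffAt_extChartAt
    exact h2.comp (f w) hγs
  obtain ⟨d, hd⟩ : ∃ d, HasDerivAt (fun s => coord (n := n) w (γ s)) d (f w) :=
    ⟨_, (hx.differentiableAt (by simp)).hasDerivAt⟩
  set C := closedCornerBox (boundaryIndices n w) (coord (n := n) w w) ε with hC
  have hγt : Tendsto γ (𝓝 (f w)) (𝓝 w) := by
    have := hγs.continuousAt.tendsto
    rwa [hγw] at this
  have hmem : ∀ᶠ s in 𝓝 (f w), coord (n := n) w (γ s) ∈ C := by
    have h1 : ∀ᶠ y in 𝓝 w, ∀ i, |coord (n := n) w y i - coord (n := n) w w i| < ε := by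
      rw [eventually_all]
      intro i
      have h2 := ((continuousAt_coord (mem_extChartAt_source (I := 𝓠 n) w) i).sub
        (continuousAt_const (y := coord (n := n) w w i))).abs.tendsto
      simp only [Pi.sub_apply, sub_self, abs_zero] at h2
      exact h2.eventually (gt_mem_nhds hε)
    filter_upwards [hγt.eventually h1] with s hs i
    exact ⟨(hs i).le, fun _ => coord_nonneg _ _ _⟩
  have hcomp : HasDerivAt (fun s => a (coord (n := n) w (γ s)))
      (fderivWithin ℝ a C (coord (n := n) w w) d) (f w) := by
    have h1 := HasFDerivWithinAt.comp_hasDerivWithinAt_of_eq (f w) (s := {s | coord w (γ s) ∈ C})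
      ha.hasFDerivWithinAt hd.hasDerivWithinAt (fun s hs => hs) (by rw [hγw])
    exact h1.hasDerivAt hmem
  have hone : HasDerivAt (fun s => a (coord (n := n) w (γ s))) 1 (f w) := by
    refine (hasDerivAt_id (f w)).congr_of_eventuallyEq ?_
    have h1 : ∀ᶠ s in 𝓝 (f w), s ∈ U := hU.mem_nhds htU
    filter_upwards [hγt.eventually hfa, h1] with s hs hsU
    have h2 : (s, l) ∈ Φ.target := by rw [htgt]; exact ⟨hsU, mem_univ _⟩
    have h3 := hΦf (γ s) (Φ.map_target h2)
    simp only [hγ, Φ.right_inv h2] at h3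
    rw [← hs]; exact h3.symm
  have hd1 := hcomp.unique hone
  -- Along γ these coordinates are non-negative and vanish at w, so they have a minimum there. The
  -- velocity is tangent to the face, and since f grows at speed 1 some tangential derivative of a
  -- is non-zero.
  have hdS : ∀ i ∈ boundaryIndices n w, d i = 0 := by
    intro i hi
    have h1 : HasDerivAt (fun s => coord (n := n) w (γ s) i) (d i) (f w) :=
      (EuclideanSpace.proj (𝕜 := ℝ) i).hasFDerivAt.comp_hasDerivAt (f w) hd
    have h2 : IsLocalMin (fun s => coord (n := n) w (γ s) i) (f w) :=
      Eventually.of_forall fun s => by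
        simp only [hγw, center_eq_zero i hi]; exact coord_nonneg _ _ _
    exact h2.hasDerivAt_eq_zero h1
  by_contra! hall
  have h2 : d = ∑ k, d k • EuclideanSpace.single k (1 : ℝ) := by
    ext i; simp [Finset.sum_apply, Pi.single_apply]
  rw [h2, map_sum] at hd1
  refine zero_ne_one ((Finset.sum_eq_zero fun k _ => ?_).symm.trans hd1)
  by_cases hk : k ∈ boundaryIndices n w
  · simp [hdS k hk]
  · simp [hall k hk]

/-- In the coordinates around a point, a b-map that is a fibration is a phase function. -/
theorem exists_isProductPhase_chart [IsManifold (𝓠 n) ∞ W] (hf : IsBMap n f)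
    (hfib : IsFibrationOverPos n f) (w : W) :
    ∃ (α : Fin n → ℕ) (a F : EuclideanSpace ℝ (Fin n) → ℝ) (ε : ℝ), IsProductForm f w α ∧ 0 < ε ∧
      closedCornerBox (boundaryIndices n w) (coord w w) ε ⊆ (extChartAt (𝓠 n) w).target ∧
      (∀ x ∈ cornerBox (boundaryIndices n w) (coord w w) ε, F x = f ((extChartAt (𝓠 n) w).symm x)) ∧
      ∀ ε', 0 < ε' → ε' ≤ ε → IsProductPhase (boundaryIndices n w) (coord w w) ε' α a F := by
  classical
  obtain ⟨α, hα⟩ := hf.2 w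
  obtain ⟨a, ⟨U, hU, ha⟩, ha0, heq⟩ := id hα
  set S := boundaryIndices n w with hS
  set c := coord (n := n) w w with hc
  set e := extChartAt (𝓠 n) w with he
  have hac := ha.continuousOn.continuousAt hU
  have hapos : 0 < a w := product_form_pos hf.1 hac ha0 heq
  have hN : {y | y ∈ U ∧ 0 < a y ∧ f y = a y * ∏ j ∈ S, coord (n := n) w y j ^ α j} ∈ 𝓝 w := by
    filter_upwards [hU, hac.eventually (lt_mem_nhds hapos), heq] with y h1 h2 h3 using ⟨h1, h2, h3⟩
  obtain ⟨ε₀, hε₀, hbox⟩ := exists_closedCornerBox_subset (n := n) hN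
  have hbox := hbox ε₀ le_rfl
  -- Extending by zero makes the phase measurable on the whole space.
  set F : EuclideanSpace ℝ (Fin n) → ℝ := (cornerBox S c ε₀).piecewise (fun x => f (e.symm x)) 0
    with hF
  have hFm : Measurable F := by
    refine ContinuousOn.measurable_piecewise (hf.continuous.comp_continuousOn
      ((continuousOn_extChartAt_symm w).mono fun x hx => ?_)) continuousOn_const
      isOpen_cornerBox.measurableSet
    exact (hbox (cornerBox_subset_closed hx)).1.1
  have hFe : ∀ x ∈ cornerBox S c ε₀, F x = f (e.symm x) := fun x hx => by
    simp only [hF, piecewise_eq_of_mem _ _ _ hx]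
  have haB : ContDiffOn ℝ ∞ (fun x => a (e.symm x)) (closedCornerBox S c ε₀) :=
    contDiffOn_comp_extChartAt_symm ha fun x hx => ⟨(hbox hx).1.1, (hbox hx).1.2.1⟩
  have hccl : c ∈ closedCornerBox S c ε₀ := center_mem_closedCornerBox hε₀.le center_eq_zero
  obtain ⟨ε₁, hε₁, hph⟩ := exists_isProductPhase (S := S) (c := c) (f := F) (α := α)
    center_eq_zero hε₀ hFm haB (fun x hx => (hbox hx).1.2.2.1) (fun x hx => by
      have h1 := hbox (cornerBox_subset_closed hx)
      rw [hFe x hx, h1.1.2.2.2]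
      have h2 : coord (n := n) w (e.symm x) = x := e.right_inv h1.1.1
      rw [h2]) (fun h0 => by
      have h1 : ∀ᶠ y in 𝓝 w, f y = a y := by
        filter_upwards [heq] with y hy
        rw [hy, Finset.prod_eq_one fun j hj => by rw [h0 j hj, pow_zero], mul_one]
      refine hfib.exists_deriv_ne_zero (by rw [h1.self_of_nhds]; exact hapos) hε₀
        (haB.differentiableOn (by simp) c hccl) ?_
      filter_upwards [h1, extChartAt_source_mem_nhds (I := 𝓠 n) w] with y hy hys
      rw [hy]
      exact congrArg a (e.left_inv hys).symm)
  refine ⟨α, fun x => a (e.symm x), F, min ε₀ ε₁, hα, lt_min hε₀ hε₁,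
    fun x hx => (hbox (closedCornerBox_mono (min_le_left _ _) hx)).1.1,
    fun x hx => hFe x (cornerBox_mono subset_rfl (min_le_left _ _) hx),
    fun ε' h1 h2 => hph ε' h1 (h2.trans (min_le_right _ _))⟩

end Manifold

/-! ### Complex measures with locally equal set integrals -/

section Transfer

variable {X : Type*} [MeasurableSpace X] {ν ν' : Measure X} {p h θ : X → ℂ} {C : ℝ}

/-- Linearity extends the equality from sets to simple functions, dominated convergence to bounded
measurable functions. -/
theorem integral_bdd_mul_eq_of_setIntegral_eq (hp : Integrable p ν) (hh : Integrable h ν')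
    (H : ∀ A, MeasurableSet A → ∫ x in A, p x ∂ν = ∫ x in A, h x ∂ν')
    (hθ : StronglyMeasurable θ) (hC : ∀ x, ‖θ x‖ ≤ C) :
    ∫ x, θ x * p x ∂ν = ∫ x, θ x * h x ∂ν' := by
  have hC' : 0 ≤ max C 0 := le_max_right _ _
  have hsimple : ∀ s : SimpleFunc X ℂ, ∫ x, s x * p x ∂ν = ∫ x, s x * h x ∂ν' := by
    have hint : ∀ {q : X → ℂ} {μ : Measure X}, Integrable q μ → ∀ s : SimpleFunc X ℂ,
        Integrable (fun x => s x * q x) μ := fun hq s => by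
      obtain ⟨D, hD⟩ := s.exists_forall_norm_le
      exact hq.bdd_mul (c := D) s.stronglyMeasurable.aestronglyMeasurable (Eventually.of_forall hD)
    intro s
    induction s using SimpleFunc.induction with
    | @const c A hA =>
      have h1 : ∀ (q : X → ℂ) (x : X), (SimpleFunc.piecewise A hA (SimpleFunc.const X c)
          (SimpleFunc.const X 0)) x * q x = A.indicator (fun x => c * q x) x := fun q x => by
        by_cases hx : x ∈ A <;> simp [hx]
      simp only [h1]
      rw [integral_indicator hA, integral_indicator hA, integral_const_mul, integral_const_mul, H A hA]
    | @add f g _ hf hg =>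
      simp only [SimpleFunc.coe_add, Pi.add_apply, add_mul]
      rw [integral_add (hint hp f) (hint hp g), integral_add (hint hh f) (hint hh g), hf, hg]
  have hlim : ∀ {q : X → ℂ} {μ : Measure X}, Integrable q μ → Tendsto
      (fun k => ∫ x, hθ.approxBounded (max C 0) k x * q x ∂μ) atTop (𝓝 (∫ x, θ x * q x ∂μ)) := by
    intro q μ hq
    refine tendsto_integral_of_dominated_convergence (fun x => max C 0 * ‖q x‖) (fun k => ?_)
      (hq.norm.const_mul _) (fun k => Eventually.of_forall fun x => ?_)
      (Eventually.of_forall fun x => ?_)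
    · exact (SimpleFunc.stronglyMeasurable _).aestronglyMeasurable.mul hq.aestronglyMeasurable
    · rw [norm_mul]
      exact mul_le_mul_of_nonneg_right (hθ.norm_approxBounded_le hC' k x) (norm_nonneg _)
    · exact (hθ.tendsto_approxBounded_of_norm_le ((hC x).trans (le_max_left _ _))).mul_const _
  refine tendsto_nhds_unique (hlim hp) ((hlim hh).congr fun k => (hsimple _).symm)

/-- If set integrals agree on an exhaustion, then so do integrals against bounded functions, and
integrability may be checked on one side. -/
theorem integral_mul_eq_of_setIntegral_eq {K : ℕ → Set X} {B : Set X}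
    (hK : ∀ k, MeasurableSet (K k)) (hKB : ∀ k, K k ⊆ B) (hB : MeasurableSet B)
    (hcov : ∀ x ∈ B, ∀ᶠ k in atTop, x ∈ K k) (hp : ∀ k, IntegrableOn p (K k) ν)
    (hh : ∀ k, IntegrableOn h (K k) ν')
    (H : ∀ k, ∀ A ⊆ K k, MeasurableSet A → ∫ x in A, p x ∂ν = ∫ x in A, h x ∂ν')
    (hθ : Measurable θ) (hC : ∀ x, ‖θ x‖ ≤ C) (hθh : IntegrableOn (fun x => θ x * h x) B ν') :
    IntegrableOn (fun x => θ x * p x) B ν ∧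
      ∫ x in B, θ x * p x ∂ν = ∫ x in B, θ x * h x ∂ν' := by
  have hmul : ∀ k (σ : X → ℂ) (D : ℝ), Measurable σ → (∀ x, ‖σ x‖ ≤ D) →
      ∫ x in K k, σ x * p x ∂ν = ∫ x in K k, σ x * h x ∂ν' := fun k σ D hσ hD =>
    integral_bdd_mul_eq_of_setIntegral_eq (hp k) (hh k) (fun A hA => by
      rw [Measure.restrict_restrict hA, Measure.restrict_restrict hA]
      exact H k _ inter_subset_right (hA.inter (hK k))) hσ.stronglyMeasurable hD
  have hθp : ∀ k, IntegrableOn (fun x => θ x * p x) (K k) ν := fun k =>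
    (hp k).bdd_mul (c := C) hθ.aestronglyMeasurable (Eventually.of_forall hC)
  -- Testing with the conjugate phase of θ p turns the L¹ norm on K k into an integral against a
  -- bounded function, which may be evaluated on the side of h.
  have hbound : ∀ k, ∫ x in K k, ‖θ x * p x‖ ∂ν ≤ ∫ x in B, ‖θ x * h x‖ ∂ν' := by
    intro k
    obtain ⟨p', hp', hpp'⟩ := (hp k).aestronglyMeasurable
    set σ : X → ℂ := fun x => (starRingEnd ℂ) (θ x * p' x) / (‖θ x * p' x‖ : ℂ) with hσ
    have hσm : Measurable σ := by
      have h1 : Measurable fun x => θ x * p' x := hθ.mul hp'.measurable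
      exact (Complex.continuous_conj.measurable.comp h1).div
        (Complex.measurable_ofReal.comp h1.norm)
    have hσ1 : ∀ x, ‖σ x‖ ≤ 1 := fun x => by
      simp only [hσ, norm_div, RCLike.norm_conj, Complex.norm_real, norm_norm]
      exact div_self_le_one _
    have hσe : ∀ x, σ x * (θ x * p' x) = (‖θ x * p' x‖ : ℂ) := fun x => by
      simp only [hσ]
      rcases eq_or_ne (θ x * p' x) 0 with h0 | h0
      · simp [h0]
      · have h1 : (‖θ x * p' x‖ : ℂ) ≠ 0 := Complex.ofReal_ne_zero.2 (norm_ne_zero_iff.2 h0)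
        rw [div_mul_eq_mul_div, Complex.conj_mul', div_eq_iff h1, sq]
    have h1 := hmul k (fun x => σ x * θ x) C (hσm.mul hθ) fun x => by
      rw [norm_mul]
      exact (mul_le_of_le_one_left (norm_nonneg _) (hσ1 x)).trans (hC x)
    have h2 : ∫ x in K k, σ x * θ x * p x ∂ν = ((∫ x in K k, ‖θ x * p x‖ ∂ν : ℝ) : ℂ) := by
      refine Eq.trans (integral_congr_ae ?_)
        (integral_ofReal (𝕜 := ℂ) (f := fun x => ‖θ x * p x‖))
      filter_upwards [hpp'] with x hx
      rw [hx, mul_assoc, hσe]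
      rfl
    have h3 : 0 ≤ ∫ x in K k, ‖θ x * p x‖ ∂ν := integral_nonneg fun _ => norm_nonneg _
    have h4 : ‖∫ x in K k, σ x * θ x * p x ∂ν‖ = ∫ x in K k, ‖θ x * p x‖ ∂ν := by
      rw [h2, Complex.norm_real, Real.norm_of_nonneg h3]
    rw [← h4, h1]
    refine (norm_integral_le_integral_norm _).trans ?_
    refine (integral_mono_of_nonneg (g := fun x => ‖θ x * h x‖)
      (Eventually.of_forall fun _ => norm_nonneg _) (hθh.mono_set (hKB k)).norm
      (Eventually.of_forall fun x => ?_)).trans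
      (setIntegral_mono_set hθh.norm (Eventually.of_forall fun _ => norm_nonneg _)
        (Eventually.of_forall (hKB k)))
    simp only []
    rw [mul_assoc, norm_mul]
    exact mul_le_of_le_one_left (norm_nonneg _) (hσ1 x)
  have hcover : ∀ {μ : Measure X}, AECover (μ.restrict B) atTop K := fun {μ} =>
    ⟨(ae_restrict_iff' hB).2 (Eventually.of_forall hcov), hK⟩
  have hres : ∀ (μ : Measure X) k, (μ.restrict B).restrict (K k) = μ.restrict (K k) := fun μ k => by
    rw [Measure.restrict_restrict (hK k), inter_eq_left.2 (hKB k)]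
  have hint : Integrable (fun x => θ x * p x) (ν.restrict B) := by
    refine hcover.integrable_of_integral_norm_bounded (∫ x in B, ‖θ x * h x‖ ∂ν') (fun k => ?_)
      (Eventually.of_forall fun k => ?_)
    · rw [IntegrableOn, hres]; exact hθp k
    · rw [hres]; exact hbound k
  refine ⟨hint, ?_⟩
  have l1 := hcover.integral_tendsto_of_countably_generated hint
  have l2 := hcover.integral_tendsto_of_countably_generated hθh.integrable
  simp only [hres] at l1 l2
  exact tendsto_nhds_unique l1 (l2.congr fun k => (hmul k θ C hθ hC).symm)

end Transfer

/-! ### Compact exhaustion of corner boxes -/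

section Exhaust

variable {n : ℕ} {S : Finset (Fin n)} {c : EuclideanSpace ℝ (Fin n)} {ε : ℝ}

/-- An exhaustion of a corner box by compact sets. -/
def compactBox (S : Finset (Fin n)) (c : EuclideanSpace ℝ (Fin n)) (ε : ℝ) (k : ℕ) :
    Set (EuclideanSpace ℝ (Fin n)) :=
  {x | ∀ i, |x i - c i| ≤ ε - 1 / ((k : ℝ) + 1) ∧ (i ∈ S → 1 / ((k : ℝ) + 1) ≤ x i)}

theorem compactBox_subset (k : ℕ) : compactBox S c ε k ⊆ cornerBox S c ε := fun x hx i => by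
  have h1 : 0 < 1 / ((k : ℝ) + 1) := by positivity
  exact ⟨(hx i).1.trans_lt (by linarith), fun hi => h1.trans_le ((hx i).2 hi)⟩

theorem isCompact_compactBox (k : ℕ) : IsCompact (compactBox S c ε k) := by
  refine (isCompact_closedCornerBox (S := S) (c := c) (ε := ε)).of_isClosed_subset ?_
    ((compactBox_subset k).trans cornerBox_subset_closed)
  have : compactBox S c ε k = ⋂ i, {x | |x i - c i| ≤ ε - 1 / ((k : ℝ) + 1) ∧
      (i ∈ S → 1 / ((k : ℝ) + 1) ≤ x i)} := by
    ext x; simp [compactBox]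
  rw [this]
  refine isClosed_iInter fun i => ?_
  have hi : Continuous fun x : EuclideanSpace ℝ (Fin n) => x i := (contDiff_coord i).continuous
  by_cases h : i ∈ S
  · simp only [h, true_imp_iff]
    exact (isClosed_le (hi.sub continuous_const).abs continuous_const).inter
      (isClosed_le continuous_const hi)
  · simp only [h, false_imp_iff, and_true]
    exact isClosed_le (hi.sub continuous_const).abs continuous_const

theorem eventually_mem_compactBox {x : EuclideanSpace ℝ (Fin n)} (hx : x ∈ cornerBox S c ε) :
    ∀ᶠ k : ℕ in atTop, x ∈ compactBox S c ε k := by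
  have hlim := tendsto_one_div_add_atTop_nhds_zero_nat (𝕜 := ℝ)
  have h : ∀ i, ∀ᶠ k : ℕ in atTop, |x i - c i| ≤ ε - 1 / ((k : ℝ) + 1) ∧
      (i ∈ S → 1 / ((k : ℝ) + 1) ≤ x i) := by
    intro i
    have h1 : 0 < ε - |x i - c i| := by linarith [(hx i).1]
    by_cases hi : i ∈ S
    · filter_upwards [hlim.eventually (gt_mem_nhds h1), hlim.eventually (gt_mem_nhds ((hx i).2 hi))]
        with k hk1 hk2 using ⟨by linarith, fun _ => hk2.le⟩
    · filter_upwards [hlim.eventually (gt_mem_nhds h1)] with k hk1 using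
        ⟨by linarith, fun h => absurd h hi⟩
  exact eventually_all.2 h

end Exhaust

/-! ### From coordinates to the manifold -/

section ChartTransfer

local notation "𝓠" => modelWithCornersEuclideanQuadrant

variable {n : ℕ} {W : Type u} [TopologicalSpace W] [ChartedSpace (EuclideanQuadrant n) W]
  {w : W} {S : Finset (Fin n)} {c : EuclideanSpace ℝ (Fin n)} {ε ε' C : ℝ}
  {u : EuclideanSpace ℝ (Fin n) → ℂ} {θ : W → ℂ}

theorem isOpen_image_extChartAt_symm {B : Set (EuclideanSpace ℝ (Fin n))} (hB : IsOpen B)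
    (hBt : B ⊆ (extChartAt (𝓠 n) w).target) : IsOpen ((extChartAt (𝓠 n) w).symm '' B) := by
  rw [PartialEquiv.symm_image_eq_source_inter_preimage _ hBt]
  exact (continuousOn_extChartAt w).isOpen_inter_preimage (isOpen_extChartAt_source w) hB

/-- A density given in local coordinates may be integrated in local coordinates. -/
theorem integral_mul_val_eq_of_chart [T2Space W] [MeasurableSpace W] [BorelSpace W]
    {μ : CDensity W} (hsub : cornerBox S c ε ⊆ (extChartAt (𝓠 n) w).target)
    (hu : ContinuousOn u (cornerBox S c ε))
    (hμ : ∀ K ⊆ cornerBox S c ε, IsCompact K → ∀ B ⊆ K, MeasurableSet B →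
        IntegrableOn μ.val ((extChartAt (𝓠 n) w).symm '' B) μ.ref ∧
        ∫ y in (extChartAt (𝓠 n) w).symm '' B, μ.val y ∂μ.ref
          = ∫ x in B, u x * ∏ j ∈ S, ((x j : ℝ) : ℂ)⁻¹)
    (hε : ε' ≤ ε) (hθ : Measurable θ) (hC : ∀ y, ‖θ y‖ ≤ C)
    (hint : IntegrableOn (fun x => θ ((extChartAt (𝓠 n) w).symm x) * (u x * bInv S x))
      (cornerBox S c ε')) :
    IntegrableOn (fun y => θ y * μ.val y) ((extChartAt (𝓠 n) w).symm '' cornerBox S c ε') μ.ref ∧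
      ∫ y in (extChartAt (𝓠 n) w).symm '' cornerBox S c ε', θ y * μ.val y ∂μ.ref =
        ∫ x in cornerBox S c ε', θ ((extChartAt (𝓠 n) w).symm x) * (u x * bInv S x) := by
  classical
  set e := extChartAt (𝓠 n) w with he
  set B := cornerBox S c ε' with hBdef
  have hBo : IsOpen B := isOpen_cornerBox
  have hBε : B ⊆ cornerBox S c ε := cornerBox_mono subset_rfl hε
  have hBt : B ⊆ e.target := hBε.trans hsub
  have hec : ContinuousOn e.symm B := (continuousOn_extChartAt_symm w).mono hBt
  have hinj : InjOn e.symm B := e.symm.injOn.mono hBt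
  have hBW : IsOpen (e.symm '' B) := isOpen_image_extChartAt_symm hBo hBt
  have hBWm := hBW.measurableSet
  have haem : AEMeasurable e.symm (volume.restrict B) := hec.aemeasurable hBo.measurableSet
  -- Lebesgue measure on the box is moved to W, so that both densities live on the same space.
  set ν := Measure.map e.symm (volume.restrict B) with hν
  have hfin : IsFiniteMeasure (volume.restrict B) := by
    refine ⟨?_⟩
    rw [Measure.restrict_apply_univ]
    exact (measure_mono cornerBox_subset_closed).trans_lt isCompact_closedCornerBox.measure_lt_top
  have hνres : ν.restrict (e.symm '' B) = ν := by
    refine Measure.restrict_eq_self_of_ae_mem ?_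
    rw [hν]
    exact (ae_map_iff (p := fun y => y ∈ e.symm '' B) haem hBWm).2
      ((ae_restrict_iff' hBo.measurableSet).2 (Eventually.of_forall fun x hx =>
        mem_image_of_mem _ hx))
  set h : W → ℂ := fun y => u (e y) * bInv S (e y) with hh
  have hhc : ContinuousOn h (e.symm '' B) := by
    have h1 : ContinuousOn (fun x => u x * bInv S x) B := (hu.mono hBε).mul continuousOn_bInv
    refine h1.comp ((continuousOn_extChartAt w).mono ?_) ?_
    · rintro _ ⟨x, hx, rfl⟩
      exact e.map_target (hBt hx)
    · rintro _ ⟨x, hx, rfl⟩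
      rwa [e.right_inv (hBt hx)]
  have hhm : AEStronglyMeasurable h ν := by
    have := hhc.aestronglyMeasurable (μ := ν) hBWm
    rwa [hνres] at this
  have hhe : ∀ x ∈ B, h (e.symm x) = u x * bInv S x := fun x hx => by
    simp only [hh, e.right_inv (hBt hx)]
  have hθh : AEStronglyMeasurable (fun y => θ y * h y) ν := hθ.aestronglyMeasurable.mul hhm
  have hθhi : Integrable (fun y => θ y * h y) ν := by
    rw [hν, integrable_map_measure hθh haem]
    exact hint.congr ((ae_restrict_iff' hBo.measurableSet).2 (Eventually.of_forall fun x hx => by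
      simp only [Function.comp, hhe x hx]))
  obtain ⟨h1, h2⟩ := integral_mul_eq_of_setIntegral_eq (ν := μ.ref) (ν' := ν) (p := μ.val) (h := h)
    (K := fun k => e.symm '' compactBox S c ε' k) (B := e.symm '' B)
    (fun k => ((isCompact_compactBox k).image_of_continuousOn
      (hec.mono (compactBox_subset k))).isClosed.measurableSet)
    (fun k => image_mono (compactBox_subset k)) hBWm
    (by
      rintro _ ⟨x, hx, rfl⟩
      exact (eventually_mem_compactBox hx).mono fun k hk => mem_image_of_mem _ hk)
    (fun k => (hμ _ ((compactBox_subset k).trans hBε) (isCompact_compactBox k) _ subset_rfl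
      (isCompact_compactBox k).measurableSet).1)
    (fun k => (hhc.mono (image_mono (compactBox_subset k))).integrableOn_compact
      ((isCompact_compactBox k).image_of_continuousOn (hec.mono (compactBox_subset k))))
    (fun k A hA hAm => by
      set B' := B ∩ e.symm ⁻¹' A with hB'
      have hB'K : B' ⊆ compactBox S c ε' k := by
        rintro x ⟨hx, hxA⟩
        obtain ⟨x', hx', hxx⟩ := hA hxA
        rwa [← hinj (compactBox_subset k hx') hx hxx]
      have hB'm : MeasurableSet B' := by
        -- The inverse chart is known to be continuous only on B; a measurable extension is needed
        -- for preimages.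
        have h3 : Measurable (B.piecewise e.symm fun _ => w) :=
          hec.measurable_piecewise continuousOn_const hBo.measurableSet
        have h4 : B' = B ∩ (B.piecewise e.symm fun _ => w) ⁻¹' A := by
          ext x
          simp only [hB', mem_inter_iff, mem_preimage]
          refine and_congr_right fun hx => ?_
          rw [piecewise_eq_of_mem _ _ _ hx]
        rw [h4]
        exact hBo.measurableSet.inter (h3 hAm)
      have hAe : A = e.symm '' B' := by
        ext y
        constructor
        · intro hy
          obtain ⟨x, hx, rfl⟩ := hA hy
          exact ⟨x, ⟨compactBox_subset k hx, hy⟩, rfl⟩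
        · rintro ⟨x, hx, rfl⟩
          exact hx.2
      have h5 := (hμ _ ((compactBox_subset k).trans hBε) (isCompact_compactBox k) _ hB'K hB'm).2
      rw [← hAe] at h5
      rw [h5, hν, setIntegral_map hAm hhm haem,
        Measure.restrict_restrict₀ (haem.nullMeasurableSet_preimage hAm), inter_comm]
      refine setIntegral_congr_fun hB'm fun x hx => ?_
      simp only [hhe x hx.1, bInv])
    hθ hC (by rw [IntegrableOn, hνres]; exact hθhi)
  refine ⟨h1, h2.trans ?_⟩
  rw [hνres, hν, integral_map haem hθh]
  refine setIntegral_congr_fun hBo.measurableSet fun x hx => ?_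
  simp only [hhe x hx]

end ChartTransfer

/-! ### The index set of the push-forward -/

section IndexSets

local notation "𝓠" => modelWithCornersEuclideanQuadrant

/-- Used to distribute a number of logarithmic factors over several index sets within their
capacities. -/
theorem exists_le_sum_eq {ι : Type*} (A : Finset ι) (m : ι → ℕ) {k : ℕ} (hk : k ≤ ∑ i ∈ A, m i) :
    ∃ r : ι → ℕ, (∀ i, r i ≤ m i) ∧ ∑ i ∈ A, r i = k := by
  classical
  induction A using Finset.induction_on generalizing k with
  | empty => exact ⟨fun _ => 0, fun _ => Nat.zero_le _, by simpa using (Nat.le_zero.1 (by simpa using hk)).symm⟩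
  | insert a A ha ih =>
    rw [Finset.sum_insert ha] at hk
    obtain ⟨r, hr, hrs⟩ := ih (k := k - m a) (by omega)
    refine ⟨Function.update r a (min k (m a)), fun i => ?_, ?_⟩
    · rcases eq_or_ne i a with rfl | h
      · simp
      · simpa [h] using hr i
    · have h1 : ∑ i ∈ A, Function.update r a (min k (m a)) i = k - m a := by
        rw [← hrs]
        exact Finset.sum_congr rfl fun i hi =>
          Function.update_of_ne (ne_of_mem_of_not_mem hi ha) _ _
      rw [Finset.sum_insert ha, Function.update_self, h1]
      omega

/-- Membership in an extended union in terms of numbers of factors. -/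
theorem mem_extUnionFamily_of_sum {ι : Type*} {A : Set ι} {E : ι → Set (ℂ × ℕ)} {z : ℂ} {p : ℕ}
    {T : Finset ι} (hT : (T : Set ι) ⊆ A) {r : ι → ℕ}
    (hr : ∀ i ∈ T, 0 < r i → (z, r i - 1) ∈ E i) (hsum : ∑ i ∈ T, r i = p + 1) :
    (z, p) ∈ extUnionFamily A E := by
  classical
  have h1 : ∑ i ∈ T with 0 < r i, (r i - 1 + 1) = p + 1 := by
    rw [← hsum, Finset.sum_filter]
    refine Finset.sum_congr rfl fun i _ => ?_
    split_ifs <;> omega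
  -- The number r_i stands for p_i + 1, and r_i = 0 means that the i-th index set is not used.
  refine ⟨{i ∈ T | 0 < r i}, ?_, fun i hi => hT (Finset.mem_filter.1 hi).1, fun i => r i - 1,
    fun i hi => hr i (Finset.mem_filter.1 hi).1 (Finset.mem_filter.1 hi).2, h1.symm⟩
  by_contra h
  rw [Finset.not_nonempty_iff_eq_empty] at h
  rw [h] at h1
  simp at h1

theorem extUnionFamily_lower {ι : Type*} {A : Set ι} {E : ι → Set (ℂ × ℕ)}
    (hE : ∀ i ∈ A, ∀ (z : ℂ) (p q : ℕ), (z, p) ∈ E i → q ≤ p → (z, q) ∈ E i) {z : ℂ} {p q : ℕ}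
    (h : (z, p) ∈ extUnionFamily A E) (hq : q ≤ p) : (z, q) ∈ extUnionFamily A E := by
  obtain ⟨T, -, hT, P, hP, hsum⟩ := h
  obtain ⟨r, hr, hrs⟩ := exists_le_sum_eq T (fun i => P i + 1) (k := q + 1) (by
    rw [← hsum]; simpa using hq)
  refine mem_extUnionFamily_of_sum hT (r := r) (fun i hi hri => ?_) hrs
  refine hE i (hT hi) z (P i) _ (hP i hi) ?_
  have := hr i
  omega

theorem IsIndexSet.shift_nat {F : Set (ℂ × ℕ)} (hF : IsIndexSet F) {z : ℂ} {p : ℕ}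
    (h : (z, p) ∈ F) (k : ℕ) : (z + k, p) ∈ F := by
  induction k with
  | zero => simpa using h
  | succ k ih =>
    have := hF.shift _ _ ih
    rw [add_assoc] at this
    exact_mod_cast this

theorem isIndexSet_empty : IsIndexSet ∅ :=
  ⟨fun N => by simp, fun _ _ _ h => absurd h (notMem_empty _), fun _ _ h => absurd h (notMem_empty _)⟩

/-- The scaled index sets `{(z / e, p)}`. -/
theorem isIndexSet_div {F : Set (ℂ × ℕ)} (hF : IsIndexSet F) {e : ℕ} (he : 0 < e) :
    IsIndexSet ((fun q : ℂ × ℕ => (q.1 / (e : ℂ), q.2)) '' F) := by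
  have heR : (0 : ℝ) < e := by exact_mod_cast he
  have heC : (e : ℂ) ≠ 0 := by exact_mod_cast he.ne'
  refine ⟨fun N => ?_, ?_, ?_⟩
  · refine ((hF.finite_left (N * e)).image fun q : ℂ × ℕ => (q.1 / (e : ℂ), q.2)).subset ?_
    rintro _ ⟨⟨q, hq, rfl⟩, hN⟩
    refine ⟨q, ⟨hq, ?_⟩, rfl⟩
    simp only [Complex.div_natCast_re] at hN
    rwa [div_lt_iff₀ heR] at hN
  · rintro _ p q ⟨⟨z, p'⟩, h, h'⟩ hq
    obtain ⟨rfl, rfl⟩ := Prod.mk.inj h'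
    exact ⟨(z, q), hF.lower z p' q h hq, rfl⟩
  · rintro _ p ⟨⟨z, p'⟩, h, h'⟩
    obtain ⟨rfl, rfl⟩ := Prod.mk.inj h'
    -- A shift of z/e by 1 is a shift of z by e.
    refine ⟨(z + e, p'), hF.shift_nat h e, ?_⟩
    simp only [add_div, div_self heC]

/-- Finiteness of Γ bounds the exponents and the powers of logarithms uniformly, even if there are
infinitely many k: no extended union can use more factors than all of Γ supplies. -/
theorem isIndexSet_iUnion_extUnionFamily {ι κ : Type*} {A : κ → Set ι} {K : Set κ}
    {E : ι → Set (ℂ × ℕ)} {Γ : Set ι} (hΓ : Γ.Finite) (hA : ∀ k ∈ K, A k ⊆ Γ)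
    (hE : ∀ i ∈ Γ, IsIndexSet (E i)) : IsIndexSet (⋃ k ∈ K, extUnionFamily (A k) E) := by
  classical
  refine ⟨fun N => ?_, fun z p q h hq => ?_, fun z p h => ?_⟩
  · have h1 : ∀ i : ι, ∃ b : ℕ, i ∈ Γ → ∀ q ∈ E i, q.1.re < N → q.2 ≤ b := fun i => by
      by_cases hi : i ∈ Γ
      · obtain ⟨b, hb⟩ := (((hE i hi).finite_left N).image Prod.snd).bddAbove
        exact ⟨b, fun _ q hq hN => hb ⟨q, ⟨hq, hN⟩, rfl⟩⟩
      · exact ⟨0, fun h => absurd h hi⟩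
    choose b hb using h1
    have h2 : (⋃ i ∈ Γ, Prod.fst '' {q ∈ E i | q.1.re < N}).Finite :=
      hΓ.biUnion fun i hi => ((hE i hi).finite_left N).image _
    refine (h2.prod (finite_Iic (∑ i ∈ hΓ.toFinset, (b i + 1)))).subset ?_
    rintro ⟨z, p⟩ ⟨hzp, hN⟩
    simp only [mem_iUnion] at hzp
    obtain ⟨k, hk, T, ⟨i, hi⟩, hT, P, hP, hsum⟩ := hzp
    have hTΓ : ∀ i ∈ T, i ∈ Γ := fun i hi => hA k hk (hT hi)
    refine ⟨?_, ?_⟩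
    · simp only [mem_iUnion]
      exact ⟨i, hTΓ i hi, (z, P i), ⟨hP i hi, hN⟩, rfl⟩
    · have h3 : ∑ i ∈ T, (P i + 1) ≤ ∑ i ∈ T, (b i + 1) := Finset.sum_le_sum fun i hi =>
        Nat.succ_le_succ (hb i (hTΓ i hi) _ (hP i hi) hN)
      have h4 : ∑ i ∈ T, (b i + 1) ≤ ∑ i ∈ hΓ.toFinset, (b i + 1) :=
        Finset.sum_le_sum_of_subset fun i hi => by simpa using hTΓ i hi
      simp only [mem_Iic]
      simp only [] at hsum
      omega
  · simp only [mem_iUnion] at h ⊢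
    obtain ⟨k, hk, h⟩ := h
    exact ⟨k, hk, extUnionFamily_lower (fun i hi => (hE i (hA k hk hi)).lower) h hq⟩
  · simp only [mem_iUnion] at h ⊢
    obtain ⟨k, hk, T, hne, hT, P, hP, hsum⟩ := h
    exact ⟨k, hk, T, hne, hT, P, fun i hi => (hE i (hA k hk (hT hi))).shift _ _ (hP i hi), hsum⟩

variable {n : ℕ} {W : Type u} [TopologicalSpace W] [ChartedSpace (EuclideanQuadrant n) W]
  {w : W} {j : Fin n} {G : Set W} {f : W → ℝ} {α : Fin n → ℕ} {E : Set W → Set (ℂ × ℕ)}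

theorem isIndexSet_pushIndexSet (hE : ∀ G : Set W, IsBhs n G → IsIndexSet (E G))
    (hfin : {G : Set W | IsBhs n G ∧ 0 < vanishingOrder n f G}.Finite) :
    IsIndexSet (pushIndexSet n f E) :=
  isIndexSet_iUnion_extUnionFamily hfin (fun _ _ _ hG => ⟨hG.1, hG.2.2⟩)
    fun G hG => isIndexSet_div (hE G hG.1) hG.2

theorem localIndexSet_eq [IsManifold (𝓠 n) ∞ W] (hG : IsBhs n G) (h : IsLocalFace G w j) :
    localIndexSet E w j = E G := by
  ext q
  simp only [localIndexSet, mem_iUnion]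
  constructor
  · rintro ⟨G', ⟨h1, h2⟩, h3⟩
    rwa [hG.eq_of_isLocalFace h1 h h2]
  · exact fun h3 => ⟨G, ⟨hG, h⟩, h3⟩

theorem isIndexSet_localIndexSet [IsManifold (𝓠 n) ∞ W]
    (hE : ∀ G : Set W, IsBhs n G → IsIndexSet (E G)) (w : W) (j : Fin n) :
    IsIndexSet (localIndexSet E w j) := by
  by_cases h : ∃ G : Set W, IsBhs n G ∧ IsLocalFace G w j
  · obtain ⟨G, hG, hG'⟩ := h
    rw [localIndexSet_eq hG hG']
    exact hE G hG
  · convert isIndexSet_empty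
    ext q
    simp only [localIndexSet, mem_iUnion, mem_empty_iff_false, iff_false]
    rintro ⟨G, hG, -⟩
    exact h ⟨G, hG⟩

/-- The exponents at the hypersurfaces where `f` does not vanish are bounded below by a positive
number. -/
theorem exists_pos_lower_bound [IsManifold (𝓠 n) ∞ W] (hf : IsBMap n f)
    (hE : ∀ G : Set W, IsBhs n G → IsIndexSet (E G))
    (hint : ∀ G : Set W, IsBhs n G → vanishingOrder n f G = 0 → 0 < indexInf (E G))
    (hα : IsProductForm f w α) :
    ∃ δ : ℝ, 0 < δ ∧ ∀ j, α j = 0 → ∀ z : ℂ, z.re ≤ δ → logMult (localIndexSet E w j) z = 0 := by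
  have h1 : ∀ j, ∃ δ : ℝ, 0 < δ ∧ (α j = 0 → ∀ z : ℂ, z.re ≤ δ →
      logMult (localIndexSet E w j) z = 0) := by
    intro j
    by_cases h : α j = 0 ∧ ∃ G : Set W, IsBhs n G ∧ IsLocalFace G w j
    · obtain ⟨hj, G, hG, hG'⟩ := h
      obtain ⟨δ, h0, hδ⟩ := EReal.lt_iff_exists_real_btwn.1
        (hint G hG ((vanishingOrder_eq hf hG hG' hα).trans hj))
      refine ⟨δ, by exact_mod_cast h0, fun _ z hz => ?_⟩
      by_contra hne
      rw [localIndexSet_eq hG hG'] at hne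
      have h2 := ((hE G hG).mem_iff_lt_logMult z 0).2 (Nat.pos_of_ne_zero hne)
      have h3 : indexInf (E G) ≤ ((z.re : ℝ) : EReal) := iInf₂_le (z, 0) h2
      have h4 := hδ.trans_le h3
      rw [EReal.coe_lt_coe_iff] at h4
      linarith
    · refine ⟨1, one_pos, fun hj z _ => ?_⟩
      by_contra hne
      have h2 := ((isIndexSet_localIndexSet hE w j).mem_iff_lt_logMult z 0).2
        (Nat.pos_of_ne_zero hne)
      simp only [localIndexSet, mem_iUnion] at h2
      obtain ⟨G, hG, -⟩ := h2
      exact h ⟨hj, G, hG⟩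
  choose δ hδ0 hδ using h1
  rcases isEmpty_or_nonempty (Fin n) with h | h
  · exact ⟨1, one_pos, fun j => h.elim j⟩
  · obtain ⟨j0, hj0⟩ := Finite.exists_min δ
    exact ⟨δ j0, hδ0 j0, fun j hj z hz => hδ j hj z (hz.trans (hj0 j))⟩

/-- The exponents that come up at a point belong to the index set of the push-forward. -/
theorem subset_pushIndexSet [IsManifold (𝓠 n) ∞ W] (hf : IsBMap n f)
    (hE : ∀ G : Set W, IsBhs n G → IsIndexSet (E G)) (hα : IsProductForm f w α) :
    {q : ℂ × ℕ | q.2 < ∑ j ∈ boundaryIndices n w with 0 < α j,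
      logMult (localIndexSet E w j) ((α j : ℂ) * q.1)} ⊆ pushIndexSet n f E := by
  classical
  rintro ⟨ζ, p⟩ hp
  -- The p + 1 logarithmic factors are distributed over the coordinates; those with r_j > 0 select
  -- hypersurfaces H j through w.
  obtain ⟨r, hr, hrs⟩ := exists_le_sum_eq _ _ (Nat.succ_le_of_lt hp)
  rw [Nat.succ_eq_add_one] at hrs
  have hmem : ∀ j, 0 < r j → ∃ G : Set W, (IsBhs n G ∧ IsLocalFace G w j) ∧
      ((α j : ℂ) * ζ, r j - 1) ∈ E G := by
    intro j hj
    have h1 := ((isIndexSet_localIndexSet hE w j).mem_iff_lt_logMult ((α j : ℂ) * ζ) (r j - 1)).2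
      (by have := hr j; simp only [] at this; omega)
    simpa only [localIndexSet, mem_iUnion, exists_prop, mem_ofPred_eq] using h1
  choose! H hH hHE using hmem
  set T := {j ∈ boundaryIndices n w | 0 < α j ∧ 0 < r j} with hT
  have hTm : ∀ j ∈ T, 0 < α j ∧ 0 < r j := fun j hj => (Finset.mem_filter.1 hj).2
  have hTs : ∑ j ∈ T, r j = p + 1 := by
    rw [← hrs, hT, Finset.sum_filter, Finset.sum_filter]
    refine Finset.sum_congr rfl fun j _ => ?_
    split_ifs <;> omega
  -- Near w a hypersurface is the zero set of one coordinate only, so different coordinates select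
  -- different hypersurfaces.
  have hinj : ∀ j ∈ T, ∀ j' ∈ T, H j = H j' → j = j' := fun j hj j' hj' h => by
    have h1 := (hH j (hTm j hj).2).2
    rw [h] at h1
    exact h1.unique_index (hH j' (hTm j' hj').2).2
  have hTne : T.Nonempty := by
    by_contra h
    rw [Finset.not_nonempty_iff_eq_empty] at h
    rw [h] at hTs
    simp at hTs
  simp only [pushIndexSet, mem_iUnion]
  -- The face is the intersection of exactly the hypersurfaces that contribute; it is non-empty
  -- because it contains w.
  refine ⟨⋂₀ (H '' T), ⟨⟨w, ?_⟩, H '' T, ?_, ?_, rfl⟩, ?_⟩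
  · rintro _ ⟨j, hj, rfl⟩
    exact (hH j (hTm j hj).2).2.1
  · obtain ⟨j, hj⟩ := hTne
    exact ⟨_, mem_image_of_mem _ hj⟩
  · rintro _ ⟨j, hj, rfl⟩
    exact (hH j (hTm j hj).2).1
  · have hvo : ∀ j ∈ T, vanishingOrder n f (H j) = α j := fun j hj =>
      vanishingOrder_eq hf (hH j (hTm j hj).2).1 (hH j (hTm j hj).2).2 hα
    obtain ⟨r', hr'⟩ : ∃ r' : Set W → ℕ, ∀ j ∈ T, r' (H j) = r j := by
      refine ⟨fun g => ∑ j ∈ T with H j = g, r j, fun j hj => ?_⟩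
      have : {j' ∈ T | H j' = H j} = {j} := by
        ext j'
        simp only [Finset.mem_filter, Finset.mem_singleton]
        exact ⟨fun h => hinj j' h.1 j hj h.2, by rintro rfl; exact ⟨hj, rfl⟩⟩
      simp only [this, Finset.sum_singleton]
    refine mem_extUnionFamily_of_sum (T := T.image H) (r := r') ?_ ?_ ?_
    · intro g hg
      obtain ⟨j, hj, rfl⟩ := Finset.mem_image.1 (Finset.mem_coe.1 hg)
      refine ⟨(hH j (hTm j hj).2).1, sInter_subset_of_mem (mem_image_of_mem _ hj), ?_⟩
      rw [hvo j hj]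
      exact (hTm j hj).1
    · intro g hg _
      obtain ⟨j, hj, rfl⟩ := Finset.mem_image.1 hg
      refine ⟨_, hHE j (hTm j hj).2, ?_⟩
      have : (α j : ℂ) ≠ 0 := by exact_mod_cast (hTm j hj).1.ne'
      simp only [hvo j hj, hr' j hj]
      rw [mul_div_cancel_left₀ _ this]
    · rw [Finset.sum_image fun j hj j' hj' h => hinj j hj j' hj' h, Finset.sum_congr rfl hr', hTs]

end IndexSets

/-! ### Push-forwards of densities supported near a point -/

section Localization

local notation "𝓠" => modelWithCornersEuclideanQuadrant

variable {n : ℕ} {W : Type u} [TopologicalSpace W] [ChartedSpace (EuclideanQuadrant n) W]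

theorem image_cornerBox_subset_interior [IsManifold (𝓠 n) ∞ W] {w : W} {S : Finset (Fin n)} {c : EuclideanSpace ℝ (Fin n)}
    {ε : ℝ} (h : cornerBox S c ε ⊆ (extChartAt (𝓠 n) w).target) :
    (extChartAt (𝓠 n) w).symm '' cornerBox S c ε ⊆ (𝓠 n).interior W := by
  rintro _ ⟨x, hx, rfl⟩
  refine (mem_interior_iff ((extChartAt (𝓠 n) w).map_target (h hx))).2 fun i => ?_
  have h1 : coord (n := n) w ((extChartAt (𝓠 n) w).symm x) = x :=
    (extChartAt (𝓠 n) w).right_inv (h hx)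
  have h2 : x ∈ interior (range (𝓠 n)) := interior_maximal
    (h.trans (extChartAt_target_subset_range (I := 𝓠 n) w)) isOpen_cornerBox hx
  rw [interior_range_corners] at h2
  rw [h1]
  exact h2 i

/-- The points whose coordinates differ by less than `r` from those of `w`. -/
def coordBall (n : ℕ) {W : Type u} [TopologicalSpace W] [ChartedSpace (EuclideanQuadrant n) W]
    (w : W) (r : ℝ) : Set W :=
  (extChartAt (𝓠 n) w).source ∩ ⋂ i : Fin n, {y | |coord w y i - coord w w i| < r}

theorem isOpen_coordBall (w : W) (r : ℝ) : IsOpen (coordBall n w r) := by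
  refine isOpen_iff_mem_nhds.2 fun y hy => inter_mem
    (extChartAt_source_mem_nhds' (I := 𝓠 n) hy.1) (iInter_mem.2 fun i => ?_)
  have h1 : ContinuousAt (fun z => |coord (n := n) w z i - coord w w i|) y :=
    ((continuousAt_coord hy.1 i).sub continuousAt_const).abs
  exact h1.eventually (gt_mem_nhds (mem_iInter.1 hy.2 i))

theorem mem_coordBall (w : W) {r : ℝ} (hr : 0 < r) : w ∈ coordBall n w r :=
  ⟨mem_extChartAt_source (I := 𝓠 n) w, mem_iInter.2 fun i => by simpa using hr⟩

/-- In the chart φ is smooth up to the boundary and supported in the half-size box, so φ u is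
polyhomogeneous and vanishes near the outer boundary. The theorem in a chart supplies v. The
integral over f⁻¹(V) is carried back to W with φ times the indicator of f⁻¹(V) as a bounded test
function. -/
theorem exists_push_near [IsManifold (𝓠 n) ∞ W] [T2Space W] [MeasurableSpace W] [BorelSpace W] {f : W → ℝ}
    (hf : IsBMap n f) (hfib : IsFibrationOverPos n f) {E : Set W → Set (ℂ × ℕ)}
    (hE : ∀ G : Set W, IsBhs n G → IsIndexSet (E G))
    (hint : ∀ G : Set W, IsBhs n G → vanishingOrder n f G = 0 → 0 < indexInf (E G))
    {μ : CDensity W} (hμ : IsNiceBDensity n E μ) (w : W) :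
    ∃ O : Set W, IsOpen O ∧ w ∈ O ∧ ∀ φ : W → ℝ, ContMDiff (𝓠 n) 𝓘(ℝ, ℝ) ∞ φ →
      (∀ y, ‖φ y‖ ≤ 1) → (∀ y ∉ O, φ y = 0) →
      ∃ v : ℝ → ℂ, ContDiffOn ℝ ∞ v (Ioi 0) ∧ HasExpansion (pushIndexSet n f E) v ∧
        ∀ a b : ℝ, 0 < a → ∀ V ⊆ Ioo a b, MeasurableSet V →
          IntegrableOn (fun y => (φ y : ℂ) * μ.val y) (f ⁻¹' V ∩ (𝓠 n).interior W) μ.ref ∧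
          ∫ y in f ⁻¹' V ∩ (𝓠 n).interior W, (φ y : ℂ) * μ.val y ∂μ.ref =
            ∫ t in V, v t * (t : ℂ)⁻¹ := by
  obtain ⟨ε₁, u, hε₁, hsub, hu, hval⟩ := hμ w
  obtain ⟨α, a, F, ε₂, hα, hε₂, htar, hFf, hph⟩ := exists_isProductPhase_chart hf hfib w
  set S := boundaryIndices n w
  set c : EuclideanSpace ℝ (Fin n) := coord w w
  set e := extChartAt (𝓠 n) w with he
  obtain ⟨ε, hε, h1, h2, h3⟩ : ∃ ε : ℝ, 0 < ε ∧ ε < ε₁ ∧ ε ≤ ε₂ ∧ ε ≤ 1 :=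
    ⟨min (ε₁ / 2) (min ε₂ 1), by positivity, (min_le_left _ _).trans_lt (by linarith),
      (min_le_right _ _).trans (min_le_left _ _), (min_le_right _ _).trans (min_le_right _ _)⟩
  have hc : ∀ j ∈ S, c j = 0 := center_eq_zero
  have hloc := isIndexSet_localIndexSet hE w
  have hphg := hu.isPhg (fun j _ => hloc j) hc h1 h3
  obtain ⟨δ, hδ, hlow⟩ := exists_pos_lower_bound hf hE hint hα
  have hBt : cornerBox S c ε ⊆ e.target := (cornerBox_mono subset_rfl h1.le).trans hsub
  have hBo : IsOpen (cornerBox S c ε) := isOpen_cornerBox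
  have huc : ContinuousOn u (cornerBox S c ε₁) := by
    rw [IsNiceLocal] at hu
    exact hu.1.continuousOn
  have hcoord : ∀ x ∈ cornerBox S c ε, coord (n := n) w (e.symm x) = x := fun x hx =>
    e.right_inv (hBt hx)
  have hr : ε / 2 < ε := by linarith
  refine ⟨coordBall n w (ε / 2), isOpen_coordBall w _, mem_coordBall w (by positivity),
    fun φ hφ hφ1 hφ0 => ?_⟩
  have hφs : IsSmoothBdd (cornerBox S c ε) fun x => (φ (e.symm x) : ℂ) := by
    refine isSmoothBdd_of_contDiffOn_closed hε hc (Complex.ofRealCLM.contDiff.comp_contDiffOn ?_)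
    exact contDiffOn_comp_extChartAt_symm (hφ.contMDiffOn (s := univ))
      fun x hx => ⟨htar (closedCornerBox_mono h2 hx), mem_univ _⟩
  have hg := hphg.smooth_mul hBo cornerBox_bdd cornerBox_pos
    (fun j _ => (hloc j).logMult_shift) (fun j _ => (hloc j).logMult_finite) hφs
  obtain ⟨v, hv, hve, hvi⟩ := (hph ε hε h2).exists_push hε hr hc hδ hg (by
    rintro x hx ⟨i, hi⟩
    rw [hφ0, Complex.ofReal_zero, zero_mul]
    rintro ⟨-, h⟩
    have h4 := mem_iInter.1 h i
    rw [mem_ofPred_eq, hcoord x hx] at h4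
    exact absurd h4 (not_lt.2 hi.le))
    (fun j _ => (hloc j).logMult_shift) (fun j _ => (hloc j).logMult_finite)
    (fun j _ => hlow j)
  refine ⟨v, hv, hve.mono (subset_pushIndexSet hf hE hα), fun p q hp V hV hVm => ?_⟩
  obtain ⟨hi1, hi2⟩ := hvi p q hp V hV hVm
  have hFm := (hph ε hε h2).measurable
  have hfm : MeasurableSet (f ⁻¹' V) := hf.continuous.measurable hVm
  set θ : W → ℂ := (f ⁻¹' V).indicator fun y => (φ y : ℂ) with hθ
  have hθm : Measurable θ :=
    (Complex.continuous_ofReal.comp hφ.continuous).measurable.indicator hfm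
  have hθ1 : ∀ y, ‖θ y‖ ≤ 1 := fun y => (norm_indicator_le_norm_self _ _).trans (by
    rw [Complex.norm_real]; exact hφ1 y)
  have hθe : EqOn (fun x => θ (e.symm x) * (u x * bInv S x))
      ((F ⁻¹' V).indicator fun x => (φ (e.symm x) : ℂ) * u x * bInv S x) (cornerBox S c ε) := by
    intro x hx
    have h4 := hFf x (cornerBox_mono subset_rfl h2 hx)
    by_cases h5 : F x ∈ V
    · have h6 : e.symm x ∈ f ⁻¹' V := by rwa [mem_preimage, ← h4]
      simp only [hθ]
      rw [indicator_of_mem (mem_preimage.2 h5), indicator_of_mem h6, mul_assoc]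
    · have h6 : e.symm x ∉ f ⁻¹' V := by rwa [mem_preimage, ← h4]
      simp only [hθ]
      rw [indicator_of_notMem (s := F ⁻¹' V) h5, indicator_of_notMem h6, zero_mul]
  obtain ⟨hj1, hj2⟩ := integral_mul_val_eq_of_chart hsub huc hval h1.le hθm hθ1 (by
    rw [integrableOn_congr_fun hθe hBo.measurableSet]
    exact (integrable_indicator_iff (hFm hVm)).2 hi1)
  rw [setIntegral_congr_fun hBo.measurableSet hθe, integral_indicator (hFm hVm), hi2] at hj2
  have hA : MeasurableSet (f ⁻¹' V ∩ (𝓠 n).interior W) :=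
    hfm.inter ((𝓠 n).isOpen_interior (n := ∞) (by simp)).measurableSet
  have hBm : MeasurableSet (e.symm '' cornerBox S c ε) :=
    (isOpen_image_extChartAt_symm hBo hBt).measurableSet
  -- Interior points at which φ ≠ 0 lie in the image of the box, and this image lies in the
  -- interior.
  have hind : (e.symm '' cornerBox S c ε).indicator (fun y => θ y * μ.val y) =
      (f ⁻¹' V ∩ (𝓠 n).interior W).indicator fun y => (φ y : ℂ) * μ.val y := by
    ext y
    by_cases hyV : f y ∈ V
    · have h5 : θ y = φ y := indicator_of_mem (mem_preimage.2 hyV) _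
      by_cases hyB : y ∈ e.symm '' cornerBox S c ε
      · have h6 : y ∈ f ⁻¹' V ∩ (𝓠 n).interior W :=
          ⟨hyV, image_cornerBox_subset_interior hBt hyB⟩
        rw [indicator_of_mem hyB, indicator_of_mem h6, h5]
      · rw [indicator_of_notMem hyB, eq_comm]
        refine indicator_apply_eq_zero.2 fun hyI => ?_
        rw [hφ0 y, Complex.ofReal_zero, zero_mul]
        intro hyO
        exact hyB ⟨coord w y, fun i => ⟨(mem_iInter.1 hyO.2 i).trans hr, fun _ =>
          (mem_interior_iff hyO.1).1 hyI.2 i⟩, e.left_inv hyO.1⟩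
    · have h5 : θ y = 0 := indicator_of_notMem (s := f ⁻¹' V) hyV _
      have h6 : y ∉ f ⁻¹' V ∩ (𝓠 n).interior W := fun h => hyV h.1
      rw [indicator_of_notMem h6]
      exact indicator_apply_eq_zero.2 fun _ => by rw [h5, zero_mul]
  constructor
  · rw [← integrable_indicator_iff hA, ← hind, integrable_indicator_iff hBm]
    exact hj1
  · rw [← integral_indicator hA, ← hind, integral_indicator hBm]
    exact hj2

end Localization

/-! ### Gluing by a partition of unity -/

theorem exists_subset_Ioo_of_isCompact {K : Set ℝ} (hK : K ⊆ Ioi 0) (hKc : IsCompact K) :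
    ∃ a b : ℝ, 0 < a ∧ K ⊆ Ioo a b := by
  rcases K.eq_empty_or_nonempty with rfl | hne
  · exact ⟨1, 1, one_pos, empty_subset _⟩
  · obtain ⟨m, hm, hmin⟩ := hKc.exists_isLeast hne
    obtain ⟨M, hM, hmax⟩ := hKc.exists_isGreatest hne
    have h0 : 0 < m := hK hm
    exact ⟨m / 2, M + 1, by linarith, fun x hx => ⟨by linarith [hmin hx], by linarith [hmax hx]⟩⟩

end PushForward

end

theorem mainTheorem2 {n : ℕ} {W : Type u} [TopologicalSpace W] [T2Space W]
    [SecondCountableTopology W] [ChartedSpace (EuclideanQuadrant n) W]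
    [IsManifold (modelWithCornersEuclideanQuadrant n) ∞ W]
    [MeasurableSpace W] [BorelSpace W]
    (hW : PushForward.EmbeddedBoundary n W)
    (f : W → ℝ) (hf : PushForward.IsBMap n f) (hfib : PushForward.IsFibrationOverPos n f)
    (E : Set W → Set (ℂ × ℕ))
    (hE : ∀ G : Set W, PushForward.IsBhs n G → PushForward.IsIndexSet (E G))
    (hint : ∀ G : Set W, PushForward.IsBhs n G → PushForward.vanishingOrder n f G = 0 →
      0 < PushForward.indexInf (E G))
    (μ : PushForward.CDensity W) (hμ : PushForward.IsNiceBDensity n E μ)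
    (hμc : PushForward.HasCompactSupp n μ) :
    (∃ v : ℝ → ℂ, PushForward.IsNiceHalfLine (PushForward.pushIndexSet n f E) v ∧
      PushForward.PushForwardEq n f μ v) ∧
    ({G : Set W | PushForward.IsBhs n G ∧ 0 < PushForward.vanishingOrder n f G}.Finite →
      PushForward.IsIndexSet (PushForward.pushIndexSet n f E)) := by
  -- With second countability this gives σ-compactness, needed for smooth partitions of unity.
  have : LocallyCompactSpace W := Manifold.locallyCompact_of_finiteDimensional
    (modelWithCornersEuclideanQuadrant n)
  refine ⟨?_, PushForward.isIndexSet_pushIndexSet hE⟩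
  choose O hO hwO hpush using PushForward.exists_push_near hf hfib hE hint hμ
  obtain ⟨K, hK, hKμ⟩ := hμc
  obtain ⟨T, hT⟩ := hK.elim_finite_subcover O hO fun w _ => mem_iUnion.2 ⟨w, hwO w⟩
  -- The functions ρ_w need to add up to 1 only on K, since μ vanishes elsewhere in the interior.
  obtain ⟨ρ, hρ⟩ := SmoothPartitionOfUnity.exists_isSubordinate
    (modelWithCornersEuclideanQuadrant n) hK.isClosed (fun w : T => O w) (fun w => hO w)
    (hT.trans (iUnion₂_subset fun w hw => subset_iUnion (fun w : T => O w) ⟨w, hw⟩))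
  choose v hv hve hvi using fun w : T => hpush w (ρ w) (ρ w).contMDiff
    (fun y => by rw [Real.norm_of_nonneg (ρ.nonneg w y)]; exact ρ.le_one w y)
    (fun y hy => image_eq_zero_of_notMem_tsupport fun h => hy (hρ w h))
  refine ⟨fun t => ∑ w, v w t, (PushForward.HasExpansion.sum _ fun w _ => hve w).isNiceHalfLine
    (ContDiffOn.sum fun w _ => hv w), fun K' hK' hK'c V hV hVm => ?_⟩
  obtain ⟨a, b, ha, hab⟩ := PushForward.exists_subset_Ioo_of_isCompact hK' hK'c
  have hi := fun w => hvi w a b ha V (hV.trans hab) hVm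
  have hae : ∀ᵐ y ∂μ.ref.restrict (f ⁻¹' V ∩ (modelWithCornersEuclideanQuadrant n).interior W),
      ∑ w, (ρ w y : ℂ) * μ.val y = μ.val y := by
    refine (ae_restrict_of_ae_restrict_of_subset inter_subset_right hKμ).mono fun y hy => ?_
    rw [← Finset.sum_mul]
    by_cases hyK : y ∈ K
    · have h1 := ρ.sum_eq_one hyK
      rw [finsum_eq_sum_of_fintype] at h1
      rw [← Complex.ofReal_sum, h1, Complex.ofReal_one, one_mul]
    · rw [hy hyK, mul_zero]
  refine ⟨(integrable_finsetSum _ fun w _ => (hi w).1).congr hae, ?_⟩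
  rw [← integral_congr_ae hae, integral_finsetSum _ fun w _ => (hi w).1]
  simp only [Finset.sum_mul]
  rw [integral_finsetSum _ fun w _ => ?_]
  · exact Finset.sum_congr rfl fun w _ => (hi w).2
  -- Splitting the integral of the finite sum requires integrability of each v_w(t)/t, which is
  -- continuous on the compact set K'.
  · refine IntegrableOn.mono_set (ContinuousOn.integrableOn_compact hK'c ?_) hV
    refine ((hv w).continuousOn.mono hK').mul (Complex.continuous_ofReal.continuousOn.inv₀
      fun t ht => ?_)
    exact_mod_cast (hK' ht).ne'
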